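/- Let $G$ be a compact connected semisimple Lie group with Lie algebra $\mathfrak g$, and let $\mathrm{Kil}$ be the negative of the Killing form of $\mathfrak g$. Let $\mu_\diamond\in\mathfrak g'$, let $K$ be its stabilizer for the coadjoint action, with Lie algebra $\mathfrak k$, so that $G/K$ is the coadjoint orbit of $\mu_\diamond$, and let $\mathfrak m=\mathfrak k^\perp$ with respect to $\mathrm{Kil}$. Vector fields on $G/K$ are the elements of $$\mathcal T(G/K)=\{V\in C^\infty(G,\mathfrak m): V(xs)=\mathrm{Ad}_s^{-1}(V(x)),\ x\in G,\ s\in K\},$$ and $V$ acts on $C^\infty(G/K)$ (right $K$-invariant smooth functions on $G$) by $(\delta_Vf)(x)=\frac{d}{dt}\big|_{t=0}f(x\exp(tV(x)))$. **Kähler structure.** Let $\omega_\diamond(X,Y)=\mu_\diamond([X,Y])$ on $\mathfrak m$, let $\Gamma_\diamond$ be the operator on $\mathfrak m$ with $\omega_\diamond(X,Y)=\mathrm{Kil}(\Gamma_\diamond X,Y)$, let $\Gamma_\diamond=|\Gamma_\diamond|J_\diamond$ be its polar decomposition with respect to $\mathrm{Kil}$, and let $g_\diamond(X,Y)=\omega_\diamond(X,J_\diamond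 Y)$. Then $(g_\diamond,J_\diamond)$ is well defined and unique, $g_\diamond$ is an $\mathrm{Ad}(K)$-invariant inner product on $\mathfrak m$, and $J_\diamond$ is a $g_\diamond$-orthogonal complex structure ($J_\diamond^2=-1$) commuting with $\mathrm{Ad}(K)$. Applied pointwise to $\mathcal T(G/K)$, they are a Riemannian metric and an almost complex structure on $G/K$. **Levi-Civita connection.** Let $(\nabla^c_VW)(x)=\frac{d}{dt}\big|_{t=0}W(x\exp(tV(x)))$ be the canonical connection. There is exactly one connection $\nabla^\diamond=\nabla^c+L$ on $\mathcal T(G/K)$, with $L$ a tensor field, $(L_VW)(x)=L(x)(V(x),W(x))$, that is compatible with $g_\diamond$ and torsion free; and every $\nabla^\diamond_V$ (hence every $L_V$) commutes with $J_\diamond$. **Dirac operator.** Let $\mathfrak m_J$ be $\mathfrak m$ as a complex vector space by means of $J_\diamond$, with the inner product $\langle X,Y\rangle_J=g_\diamond(X,Y)+i\,g_\diamond(J_\diamond X,Y)$, linear in $Y$, and let $\mathcal S=\bigwedge^*\mathfrak m_J$ be the complex exterior algebra with the inner product $\langle X_1\wedge\dots\wedge X_p,Y_1\wedge\dots\wedge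 Y_q\rangle=\delta_{pq}\det[\langle X_k,Y_l\rangle_J]$. For $X\in\mathfrak m$ let $\kappa(X)=i(a(X)+a^\dagger(X))$, where $a^\dagger(X)\xi=X\wedge\xi$ and $a(X)(X_1\wedge\dots\wedge X_p)=\sum_j(-1)^{j-1}\langle X,X_j\rangle_J\,X_1\wedge\dots\wedge\widehat{X_j}\wedge\dots\wedge X_p$. Let $\widetilde{\mathrm{Ad}}$ be the action of $K$ on $\mathcal S$ by algebra automorphisms extending $\mathrm{Ad}$ on $\mathfrak m$. For a character (continuous homomorphism) $\chi:K\to\mathbb T$ put $$\mathcal S(G/K,\chi)=\{\psi\in C^\infty(G,\mathcal S):\psi(xs)=\overline{\chi(s)}\,\widetilde{\mathrm{Ad}}_s^{-1}(\psi(x)),\ x\in G,\ s\in K\}.$$ For $X\in\mathfrak m$ let $(\nabla^{\mathcal S}_X\psi)(x)=\frac{d}{dt}\big|_{t=0}\psi(x\exp(tX))+L^{\mathcal S}_X(x)\psi(x)$, where $L^{\mathcal S}_X(x)$ is the derivation of the exterior algebra $\mathcal S$ extending the complex linear operator $L(x)(X,\cdot)$ on $\mathfrak m_J$, and let $$D^\diamond\psi=\kappa(\mathrm{grad}\,\psi)=\sum_i\kappa(b_i)\,\nabla^{\mathcal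 S}_{b^i}\psi,$$ where $(b_i)$ is a basis of $\mathfrak m$ and $(b^i)$ is its dual basis for $g_\diamond$. **Conclusion.** For every character $\chi$ of $K$ the operator $D^\diamond$ maps $\mathcal S(G/K,\chi)$ into itself and is formally self-adjoint: for all $\psi,\varphi\in\mathcal S(G/K,\chi)$ and every Haar measure on $G$, $$\int_G\langle (D^\diamond\psi)(x),\varphi(x)\rangle\,dx=\int_G\langle\psi(x),(D^\diamond\varphi)(x)\rangle\,dx.$$ -/

import Mathlib

open scoped Manifold ContDiff ComplexConjugate


noncomputable section

namespace CoadjointDirac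

/-! ### Fock space -/

section Fock

variable {M : Type*} [AddCommGroup M] [Module ℂ M]

/-- The complex exterior algebra of a complex vector space (the unpolarized Fock space). -/
abbrev Fock (M : Type*) [AddCommGroup M] [Module ℂ M] : Type _ := ExteriorAlgebra ℂ M

/-- The annihilation operator `a(X)`:
`a(X)(X₁ ∧ ⋯ ∧ Xₚ) = ∑ⱼ (-1)^(j-1) ⟨X, Xⱼ⟩ X₁ ∧ ⋯ ∧ X̂ⱼ ∧ ⋯ ∧ Xₚ`, for a sesquilinear form `B = ⟨·,·⟩` that is
linear in the second variable. -/
def annih (B : M →ₗ⋆[ℂ] M →ₗ[ℂ] ℂ) (X : M) : Fock M →ₗ[ℂ] Fock M :=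
  CliffordAlgebra.contractLeft (B X)

/-- The creation operator `a†(X) : ξ ↦ X ∧ ξ`. -/
def creat (X : M) : Fock M →ₗ[ℂ] Fock M :=
  LinearMap.mulLeft ℂ (ExteriorAlgebra.ι ℂ X)

/-- Clifford multiplication `κ(X) = i (a(X) + a†(X))`. -/
def cliff (B : M →ₗ⋆[ℂ] M →ₗ[ℂ] ℂ) (X : M) : Fock M →ₗ[ℂ] Fock M :=
  Complex.I • (annih B X + creat X)

/-- The opposite of a complex algebra `A`, with complex scalars acting through conjugation; a conjugate
linear, product reversing map into `A` is the same as an algebra homomorphism into `ConjOp A`. -/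
def ConjOp (A : Type*) : Type _ := Aᵐᵒᵖ
instance {A : Type*} [Ring A] : Ring (ConjOp A) := inferInstanceAs (Ring Aᵐᵒᵖ)
instance {A : Type*} [Ring A] [Algebra ℂ A] : Algebra ℂ (ConjOp A) :=
  Algebra.compHom Aᵐᵒᵖ (starRingEnd ℂ)

/-- The conjugate linear map `X₁ ∧ ⋯ ∧ Xₚ ↦ a(Xₚ) ∘ ⋯ ∘ a(X₁)`. -/
def annihWord (B : M →ₗ⋆[ℂ] M →ₗ[ℂ] ℂ) :
    Fock M →ₐ[ℂ] ConjOp (Module.End ℂ (Fock M)) :=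
  ExteriorAlgebra.lift ℂ
    ⟨{ toFun := fun X ↦ MulOpposite.op (annih B X)
       map_add' := fun X Y ↦ by
        simp only [annih, map_add, MulOpposite.op_add]; rfl
       map_smul' := fun c X ↦ by
        simp only [annih, map_smulₛₗ, MulOpposite.op_smul]; rfl }, fun X ↦ by
        refine MulOpposite.unop_injective (LinearMap.ext fun ξ ↦ ?_)
        exact CliffordAlgebra.contractLeft_contractLeft (B X) ξ⟩

/-- The sesquilinear form on the exterior algebra induced by a sesquilinear form `B` on the vector
space: `⟨X₁ ∧ ⋯ ∧ Xₚ, η⟩` is the component in degree `0` of `a(Xₚ) ⋯ a(X₁) η`. It is the form with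
`⟨X₁ ∧ ⋯ ∧ Xₚ, Y₁ ∧ ⋯ ∧ Y_q⟩ = δ_{pq} det (B (X k) (Y l))`; see `fockInner_ιMulti` and
`fockInner_ιMulti_of_ne`, which determine it. -/
def fockInner (B : M →ₗ⋆[ℂ] M →ₗ[ℂ] ℂ) : Fock M →ₗ⋆[ℂ] Fock M →ₗ[ℂ] ℂ :=
  LinearMap.mk₂'ₛₗ (starRingEnd ℂ) (RingHom.id ℂ)
    (fun ξ η ↦ ExteriorAlgebra.algebraMapInv (MulOpposite.unop (annihWord B ξ) η))
    (fun ξ ξ' η ↦ by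
      rw [map_add]
      exact map_add (ExteriorAlgebra.algebraMapInv (R := ℂ) (M := M)) _ _)
    (fun c ξ η ↦ by
      rw [map_smul]
      exact map_smul (ExteriorAlgebra.algebraMapInv (R := ℂ) (M := M)) (starRingEnd ℂ c) _)
    (fun ξ η η' ↦ by rw [map_add, map_add])
    (fun c ξ η ↦ by rw [map_smul, map_smul]; rfl)

theorem annih_ιMulti (B : M →ₗ⋆[ℂ] M →ₗ[ℂ] ℂ) (X : M) {p : ℕ} (Y : Fin (p + 1) → M) :
    annih B X (ExteriorAlgebra.ιMulti ℂ (p + 1) Y) =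
      ∑ j : Fin (p + 1), ((-1) ^ (j : ℕ) * B X (Y j)) •
        ExteriorAlgebra.ιMulti ℂ p (fun k ↦ Y (j.succAbove k)) := by
  induction p with
  | zero =>
    simp [annih, ExteriorAlgebra.ιMulti_succ_apply, CliffordAlgebra.contractLeft_ι, Algebra.smul_def]
  | succ p ih =>
    have h : annih B X (ExteriorAlgebra.ι ℂ (Y 0) * ExteriorAlgebra.ιMulti ℂ (p + 1) (Matrix.vecTail Y)) =
       B X (Y 0) • ExteriorAlgebra.ιMulti ℂ (p + 1) (Matrix.vecTail Y) -
         ExteriorAlgebra.ι ℂ (Y 0) * annih B X (ExteriorAlgebra.ιMulti ℂ (p + 1) (Matrix.vecTail Y)) :=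
      CliffordAlgebra.contractLeft_ι_mul (B X) (Y 0) _
    rw [ExteriorAlgebra.ιMulti_succ_apply, h, ih, Fin.sum_univ_succ (n := p + 1), sub_eq_add_neg,
      Finset.mul_sum, ← Finset.sum_neg_distrib]
    congr 1
    · simp [Matrix.vecTail, Function.comp_def]
    · refine Finset.sum_congr rfl fun j _ ↦ ?_
      rw [ExteriorAlgebra.ιMulti_succ_apply, mul_smul_comm, ← neg_smul]
      simp [Matrix.vecTail, Function.comp_def, pow_succ]

theorem fockInner_zero (B : M →ₗ⋆[ℂ] M →ₗ[ℂ] ℂ) (X : Fin 0 → M) (η : Fock M) :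
    fockInner B (ExteriorAlgebra.ιMulti ℂ 0 X) η = ExteriorAlgebra.algebraMapInv η := by
  rw [ExteriorAlgebra.ιMulti_zero_apply]
  simp only [fockInner, LinearMap.mk₂'ₛₗ_apply, map_one]
  rfl

theorem fockInner_succ (B : M →ₗ⋆[ℂ] M →ₗ[ℂ] ℂ) {p : ℕ} (X : Fin (p + 1) → M) (η : Fock M) :
    fockInner B (ExteriorAlgebra.ιMulti ℂ (p + 1) X) η =
      fockInner B (ExteriorAlgebra.ιMulti ℂ p (Matrix.vecTail X)) (annih B (X 0) η) := by
  rw [ExteriorAlgebra.ιMulti_succ_apply]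
  simp only [fockInner, LinearMap.mk₂'ₛₗ_apply, map_mul]
  have : annihWord B (ExteriorAlgebra.ι ℂ (X 0)) = MulOpposite.op (annih B (X 0)) := by
    exact ExteriorAlgebra.lift_ι_apply ℂ _ _ _
  rw [this]
  rfl

theorem fockInner_ιMulti (B : M →ₗ⋆[ℂ] M →ₗ[ℂ] ℂ) {p : ℕ} (X Y : Fin p → M) :
    fockInner B (ExteriorAlgebra.ιMulti ℂ p X) (ExteriorAlgebra.ιMulti ℂ p Y) =
      Matrix.det (Matrix.of fun k l ↦ B (X k) (Y l)) := by
  induction p with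
  | zero => rw [fockInner_zero]; simp
  | succ p ih =>
    rw [fockInner_succ, annih_ιMulti, map_sum, Matrix.det_succ_row_zero]
    refine Finset.sum_congr rfl fun j _ ↦ ?_
    rw [map_smul, ih]
    rfl

theorem fockInner_ιMulti_of_ne (B : M →ₗ⋆[ℂ] M →ₗ[ℂ] ℂ) {p q : ℕ} (hpq : p ≠ q)
    (X : Fin p → M) (Y : Fin q → M) :
    fockInner B (ExteriorAlgebra.ιMulti ℂ p X) (ExteriorAlgebra.ιMulti ℂ q Y) = 0 := by
  induction p generalizing q with
  | zero =>
    obtain ⟨q, rfl⟩ := Nat.exists_eq_succ_of_ne_zero hpq.symm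
    rw [fockInner_zero, ExteriorAlgebra.ιMulti_succ_apply, map_mul]
    simp [ExteriorAlgebra.algebraMapInv]
  | succ p ih =>
    rw [fockInner_succ]
    cases q with
    | zero =>
      rw [ExteriorAlgebra.ιMulti_zero_apply]
      have : annih B (X 0) 1 = 0 := CliffordAlgebra.contractLeft_one _ _
      rw [this, map_zero]
    | succ q =>
      rw [annih_ιMulti, map_sum]
      refine Finset.sum_eq_zero fun j _ ↦ ?_
      rw [map_smul, ih (by omega), smul_zero]

/-- The algebra homomorphism `ξ ↦ ξ + ε (T ξ)`, where `T` also denotes the extension of `T` to a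
derivation. -/
def dualHom (T : M →ₗ[ℂ] M) : Fock M →ₐ[ℂ] DualNumber (Fock M) :=
  ExteriorAlgebra.lift ℂ
    ⟨{ toFun := fun X ↦ TrivSqZeroExt.inl (ExteriorAlgebra.ι ℂ X) +
          TrivSqZeroExt.inr (ExteriorAlgebra.ι ℂ (T X))
       map_add' := fun X Y ↦ by ext <;> simp
       map_smul' := fun c X ↦ by ext <;> simp }, fun X ↦ by
        ext <;> simp [ExteriorAlgebra.ι_add_mul_swap]⟩

/-- The extension of a linear map `T` to a derivation of the exterior algebra; it is determined by
`extDer_ι` and `extDer_mul`. -/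
def extDer (T : M →ₗ[ℂ] M) : Fock M →ₗ[ℂ] Fock M :=
  (TrivSqZeroExt.sndHom (Fock M) (Fock M)).restrictScalars ℂ ∘ₗ (dualHom T).toLinearMap

theorem fst_dualHom (T : M →ₗ[ℂ] M) (ξ : Fock M) : (dualHom T ξ).fst = ξ := by
  have : (TrivSqZeroExt.fstHom ℂ (Fock M) (Fock M)).comp (dualHom T) = AlgHom.id ℂ (Fock M) := by
    ext X; simp [dualHom]
  exact congrArg (fun f ↦ f ξ) this

theorem extDer_ι (T : M →ₗ[ℂ] M) (X : M) :
    extDer T (ExteriorAlgebra.ι ℂ X) = ExteriorAlgebra.ι ℂ (T X) := by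
  simp [extDer, dualHom]

theorem extDer_mul (T : M →ₗ[ℂ] M) (ξ η : Fock M) :
    extDer T (ξ * η) = extDer T ξ * η + ξ * extDer T η := by
  simp [extDer, fst_dualHom, add_comm]

/-- The Clifford relation. -/
theorem cliff_cliff (B : M →ₗ⋆[ℂ] M →ₗ[ℂ] ℂ) (X Y : M) (ξ : Fock M) :
    cliff B X (cliff B Y ξ) + cliff B Y (cliff B X ξ) = -(B X Y + B Y X) • ξ := by
  have h1 : ∀ U V : M, annih B U (creat V ξ) = B U V • ξ - creat V (annih B U ξ) := fun U V ↦
    CliffordAlgebra.contractLeft_ι_mul (B U) V ξ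
  have h2 : annih B X (annih B Y ξ) = -annih B Y (annih B X ξ) :=
    CliffordAlgebra.contractLeft_comm (B X) (B Y) ξ
  have h3 : creat X (creat Y ξ) = -creat Y (creat X ξ) := by
    rw [eq_neg_iff_add_eq_zero]
    change ExteriorAlgebra.ι ℂ X * (ExteriorAlgebra.ι ℂ Y * ξ) +
      ExteriorAlgebra.ι ℂ Y * (ExteriorAlgebra.ι ℂ X * ξ) = 0
    rw [← mul_assoc, ← mul_assoc, ← add_mul, ExteriorAlgebra.ι_add_mul_swap, zero_mul]
  simp only [cliff, LinearMap.smul_apply, LinearMap.add_apply, map_smul, map_add, smul_smul,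
    smul_add, Complex.I_mul_I, h1, h2, h3]
  module

instance [Module.Finite ℂ M] : Module.Finite ℂ (Fock M) :=
  Module.Finite.of_basis (Module.finBasis ℂ M).ExteriorAlgebra
end Fock

/-! ### The adjoint representation -/

section LieGroup

variable {n : ℕ} {G : Type*} [TopologicalSpace G] [ChartedSpace (EuclideanSpace ℝ (Fin n)) G]
  [Group G]

theorem three_le : (3 : ℕ∞ω) ≤ ∞ := WithTop.coe_le_coe.2 (le_top : (3 : ℕ∞) ≤ ⊤)

instance instLieGroupMinSmoothness [LieGroup (𝓡 n) ∞ G] :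
    LieGroup (𝓡 n) (minSmoothness ℝ 3) G :=
  LieGroup.of_le (n := ∞) (by
    rw [minSmoothness_of_isRCLikeNormedField]; exact three_le)

variable (n G) in
/-- The Lie algebra `𝔤` of `G`. -/
abbrev LieAlg : Type := GroupLieAlgebra (𝓡 n) G

instance : FiniteDimensional ℝ (LieAlg n G) :=
  inferInstanceAs (FiniteDimensional ℝ (EuclideanSpace ℝ (Fin n)))

variable (n) in
/-- `Ad_s`, the differential at the identity of `x ↦ s x s⁻¹`. (Since `s 1 s⁻¹ = 1`, its values are in
the tangent space at the identity.) -/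
def AdCLM (s : G) : LieAlg n G →L[ℝ] LieAlg n G :=
  mfderiv (𝓡 n) (𝓡 n) (fun x : G ↦ s * x * s⁻¹) 1

variable [LieGroup (𝓡 n) ∞ G]

variable (n) in
theorem conj_contMDiff (s : G) : ContMDiff (𝓡 n) (𝓡 n) ∞ (fun x : G ↦ s * x * s⁻¹) :=
    (contMDiff_mul_right (a := s⁻¹)).comp (contMDiff_mul_left (a := s))

variable (n) in
theorem conj_mdiff (s x : G) : MDifferentiableAt (𝓡 n) (𝓡 n) (fun x : G ↦ s * x * s⁻¹) x := 
  (conj_contMDiff n s).contMDiffAt.mdifferentiableAt (by simp)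


variable (n) in
theorem mfderiv_congr_base (f : G → G) {y z : G} (h : y = z) (v : EuclideanSpace ℝ (Fin n)) :
    (id (mfderiv (𝓡 n) (𝓡 n) f y v) : EuclideanSpace ℝ (Fin n)) = mfderiv (𝓡 n) (𝓡 n) f z v := by
  subst h; rfl

theorem AdFun_mul (s t : G) (X : LieAlg n G) : AdCLM n (s * t) X = AdCLM n s (AdCLM n t X) := by
  have h : (fun x : G ↦ (s * t) * x * (s * t)⁻¹) = (fun x : G ↦ s * x * s⁻¹) ∘ (fun x ↦ t * x * t⁻¹) := by
    funext x; simp [mul_assoc]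
  have := mfderiv_comp_apply (I := 𝓡 n) (I' := 𝓡 n) (I'' := 𝓡 n) 1
    (conj_mdiff n s (t * 1 * t⁻¹)) (conj_mdiff n t 1) X
  rw [← h] at this
  exact this.trans (mfderiv_congr_base n _ (by simp) _)

theorem AdFun_one (X : LieAlg n G) : AdCLM n (1 : G) X = X := by
  have h : (fun x : G ↦ 1 * x * 1⁻¹) = id := by funext x; simp
  unfold AdCLM
  rw [h, mfderiv_id]
  rfl

theorem mfderiv_conj_mulInvariantVectorField (s h : G) (X : LieAlg n G) :
    mfderiv (𝓡 n) (𝓡 n) (fun x : G ↦ s * x * s⁻¹) h (mulInvariantVectorField X h) =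
      mulInvariantVectorField (AdCLM n s X) (s * h * s⁻¹) := by
  have hL : ∀ a y : G, MDifferentiableAt (𝓡 n) (𝓡 n) (fun x : G ↦ a * x) y := fun a y ↦
    (contMDiff_mul_left (I := 𝓡 n) (n := ∞) (a := a)).contMDiffAt.mdifferentiableAt (by simp)
  have e : (fun x : G ↦ s * x * s⁻¹) ∘ (fun x ↦ h * x) =
      (fun x ↦ (s * h * s⁻¹) * x) ∘ (fun x : G ↦ s * x * s⁻¹) := by
    funext x; simp [mul_assoc]
  have h1 := mfderiv_comp_apply (I := 𝓡 n) (I' := 𝓡 n) (I'' := 𝓡 n) 1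
    (conj_mdiff n s (h * 1)) (hL h 1) X
  have h2 := mfderiv_comp_apply (I := 𝓡 n) (I' := 𝓡 n) (I'' := 𝓡 n) 1
    (hL (s * h * s⁻¹) (s * 1 * s⁻¹)) (conj_mdiff n s 1) X
  rw [e] at h1
  exact (mfderiv_congr_base n _ (mul_one h).symm _).trans
    ((h1.symm.trans h2).trans (mfderiv_congr_base n _ (by simp) _))

theorem AdCLM_lie (s : G) (X Y : LieAlg n G) : AdCLM n s ⁅X, Y⁆ = ⁅AdCLM n s X, AdCLM n s Y⁆ := by
  set f : G → G := fun x ↦ s * x * s⁻¹ with hf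
  have hinv : ∀ h : G, (mfderiv (𝓡 n) (𝓡 n) f h).IsInvertible := by
    intro h
    have e1 : (fun x : G ↦ s⁻¹ * x * s⁻¹⁻¹) ∘ f = id := by funext x; simp [hf, mul_assoc]
    have e2 : f ∘ (fun x : G ↦ s⁻¹ * x * s⁻¹⁻¹) = id := by funext x; simp [hf, mul_assoc]
    let Φ : Diffeomorph (𝓡 n) (𝓡 n) G G ∞ :=
      { toFun := f
        invFun := fun x ↦ s⁻¹ * x * s⁻¹⁻¹
        left_inv := congrFun e1
        right_inv := congrFun e2
        contMDiff_toFun := conj_contMDiff n s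
        contMDiff_invFun := conj_contMDiff n s⁻¹ }
    exact ⟨Φ.mfderivToContinuousLinearEquiv (by simp) h, rfl⟩
  have hp : ∀ X : LieAlg n G, VectorField.mpullback (𝓡 n) (𝓡 n) f
      (mulInvariantVectorField (AdCLM n s X)) = mulInvariantVectorField X := by
    intro X
    funext h
    rw [VectorField.mpullback_apply, ← mfderiv_conj_mulInvariantVectorField s h X]
    exact (hinv h).inverse_apply_eq.2 rfl
  have h1 : (1 : G) = f 1 := by simp [hf]
  have key := VectorField.mpullback_mlieBracket (I := 𝓡 n) (I' := 𝓡 n) (f := f) (x₀ := 1) (n := ∞)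
    (V := mulInvariantVectorField (AdCLM n s X)) (W := mulInvariantVectorField (AdCLM n s Y))
    (mdifferentiableAt_mulInvariantVectorField _) (mdifferentiableAt_mulInvariantVectorField _)
    (conj_contMDiff n s).contMDiffAt
    (by rw [minSmoothness_of_isRCLikeNormedField]; exact le_trans (by norm_num) three_le)
  rw [hp, hp, VectorField.mpullback_apply] at key
  have k2 := (hinv 1).inverse_apply_eq.1 key
  have h3 : ∀ y : G, y = 1 → (id (VectorField.mlieBracket (𝓡 n) (mulInvariantVectorField (AdCLM n s X))
      (mulInvariantVectorField (AdCLM n s Y)) y) : EuclideanSpace ℝ (Fin n)) =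
      ⁅AdCLM n s X, AdCLM n s Y⁆ := by rintro y rfl; rfl
  exact k2.symm.trans (h3 _ h1.symm)

variable (n G) in
/-- The adjoint representation. -/
def Ad : Representation ℝ G (LieAlg n G) where
  toFun s := AdCLM n s
  map_one' := LinearMap.ext AdFun_one
  map_mul' s t := LinearMap.ext (AdFun_mul s t)

variable (n G) in
/-- The coadjoint representation on the dual space `𝔤'`. -/
def coAd : Representation ℝ G (Module.Dual ℝ (LieAlg n G)) := (Ad n G).dual

variable (n G) in
/-- The negative of the Killing form. -/
def Kil : LinearMap.BilinForm ℝ (LieAlg n G) := -killingForm ℝ (LieAlg n G)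

variable (μ : Module.Dual ℝ (LieAlg n G))

/-- `K`, the stabilizer of `μ` for the coadjoint action. -/
def stab : Subgroup G where
  carrier := {s | coAd n G s μ = μ}
  one_mem' := by simp
  mul_mem' {s t} hs ht := by
    simp only [Set.mem_ofPred_eq] at hs ht ⊢
    rw [map_mul, Module.End.mul_apply, ht, hs]
  inv_mem' {s} hs := by
    simp only [Set.mem_ofPred_eq] at hs ⊢
    conv_lhs => rw [← hs]
    rw [← Module.End.mul_apply, ← map_mul]; simp

variable (n) in
/-- The velocity at time `0` of a curve, as a vector of the model space of the tangent space at its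
initial point. -/
def velocity (γ : ℝ → G) : EuclideanSpace ℝ (Fin n) := mfderiv 𝓘(ℝ, ℝ) (𝓡 n) γ 0 (1 : ℝ)

/-- `𝔨`, the Lie algebra of the closed subgroup `K`: the velocities at the identity of curves in `K`. -/
def kLie : Set (LieAlg n G) :=
  {X | ∃ γ : ℝ → G, γ 0 = 1 ∧ (∀ t, γ t ∈ stab μ) ∧
    MDifferentiableAt 𝓘(ℝ, ℝ) (𝓡 n) γ 0 ∧ velocity n γ = X}

/-- `𝔪 = 𝔨^⊥`, the orthogonal complement for `Kil`. -/
def mSub : Submodule ℝ (LieAlg n G) where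
  carrier := {Y | ∀ X ∈ kLie μ, Kil n G X Y = 0}
  zero_mem' := by simp
  add_mem' := fun hY hY' X hX ↦ by rw [map_add, hY X hX, hY' X hX, add_zero]
  smul_mem' := fun c Y hY X hX ↦ by rw [map_smul, hY X hX, smul_zero]

theorem Kil_Ad (s : G) (X Y : LieAlg n G) : Kil n G (Ad n G s X) (Ad n G s Y) = Kil n G X Y := by
  let e : LieAlg n G ≃ₗ⁅ℝ⁆ LieAlg n G :=
    { toFun := Ad n G s
      invFun := Ad n G s⁻¹
      map_add' := map_add _
      map_smul' := map_smul _
      map_lie' := AdCLM_lie s _ _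
      left_inv := fun X ↦ by rw [← Module.End.mul_apply, ← map_mul]; simp
      right_inv := fun X ↦ by rw [← Module.End.mul_apply, ← map_mul]; simp }
  have := LieAlgebra.killingForm_of_equiv_apply e X Y
  simp only [Kil, LinearMap.neg_apply]
  exact congrArg Neg.neg this

theorem Ad_mem_kLie {s : G} (hs : s ∈ stab μ) {X : LieAlg n G} (hX : X ∈ kLie μ) :
    Ad n G s X ∈ kLie μ := by
  obtain ⟨γ, h0, hγ, hd, rfl⟩ := hX
  refine ⟨fun t ↦ s * γ t * s⁻¹, by simp [h0], fun t ↦ mul_mem (mul_mem hs (hγ t)) (inv_mem hs),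
    (conj_mdiff n s (γ 0)).comp 0 hd, ?_⟩
  have := mfderiv_comp_apply (I := 𝓘(ℝ, ℝ)) (I' := 𝓡 n) (I'' := 𝓡 n) 0
    (conj_mdiff n s (γ 0)) hd (1 : ℝ)
  exact this.trans (mfderiv_congr_base n _ h0 _)

theorem Ad_mem_mSub {s : G} (hs : s ∈ stab μ) {Y : LieAlg n G} (hY : Y ∈ mSub μ) :
    Ad n G s Y ∈ mSub μ := by
  intro X hX
  have := hY _ (Ad_mem_kLie μ (inv_mem hs) hX)
  rw [← Kil_Ad s, ← Module.End.mul_apply, ← map_mul] at this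
  simpa using this

/-- The action `Ad` of `K` on `𝔪`. -/
def AdM (s : stab μ) : mSub μ →ₗ[ℝ] mSub μ :=
  (Ad n G s).restrict fun _ hY ↦ Ad_mem_mSub μ s.2 hY

/-- The Kirillov-Kostant-Souriau form `ω(X, Y) = μ([X, Y])` on `𝔪`. -/
def omega (X Y : mSub μ) : ℝ := μ ⁅(X : LieAlg n G), (Y : LieAlg n G)⁆

/-- A `G`-invariant almost Hermitian structure on `G/K`: a `K`-invariant inner product `g` on `𝔪` and a
`K`-invariant complex structure `J` on `𝔪` that is orthogonal for `g`. -/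
@[ext]
structure AlmostHermitian where
  /-- the inner product -/
  g : LinearMap.BilinForm ℝ (mSub μ)
  /-- the complex structure -/
  J : mSub μ →ₗ[ℝ] mSub μ
  g_symm : ∀ X Y, g X Y = g Y X
  g_pos : ∀ X, X ≠ 0 → 0 < g X X
  J_sq : ∀ X, J (J X) = -X
  g_J : ∀ X Y, g (J X) (J Y) = g X Y
  g_Ad : ∀ (s : stab μ) X Y, g (AdM μ s X) (AdM μ s Y) = g X Y
  J_Ad : ∀ (s : stab μ) X, J (AdM μ s X) = AdM μ s (J X)

variable {μ}

/-- `h` is the canonical Kähler structure `(g_⋄, J_⋄)` of the coadjoint orbit of `μ`: if `Γ` is the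
operator on `𝔪` with `ω(X, Y) = Kil(Γ X, Y)` and `Γ = |Γ| J` is its polar decomposition with respect to
`Kil` (with `|Γ|` self-adjoint and positive, and `J` orthogonal), then `J_⋄ = J` and
`g_⋄(X, Y) = ω(X, J Y)`. -/
def AlmostHermitian.IsCanonicalKahler (h : AlmostHermitian μ) : Prop :=
  (∃ Γ absΓ : mSub μ →ₗ[ℝ] mSub μ,
    (∀ X Y : mSub μ, omega μ X Y = Kil n G (Γ X) Y) ∧
    (∀ X Y : mSub μ, Kil n G (absΓ X) Y = Kil n G X (absΓ Y)) ∧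
    (∀ X : mSub μ, 0 ≤ Kil n G (absΓ X) X) ∧
    (∀ X Y : mSub μ, Kil n G (h.J X) (h.J Y) = Kil n G X Y) ∧
    Γ = absΓ ∘ₗ h.J) ∧
  ∀ X Y : mSub μ, h.g X Y = omega μ X (h.J Y)

/-! ### Smooth functions on `G` and left-invariant differentiation -/

section Smooth

variable (𝕜 : Type*) [RCLike 𝕜] {F : Type*} [AddCommGroup F] [Module 𝕜 F]

variable (n) in
/-- Smoothness of a function on `G` with values in a finite-dimensional vector space: the composites
with all linear functionals (equivalently, all coordinates) are smooth. -/
def IsSmooth (ψ : G → F) : Prop :=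
  ∀ ℓ : F →ₗ[𝕜] 𝕜, ContMDiff (𝓡 n) 𝓘(ℝ, 𝕜) ∞ (fun x ↦ ℓ (ψ x))

/-- The derivative at `t = 0` of `f (x exp (t X))` for a scalar function `f`, that is, the derivative of
`f` at `x` along the left-invariant vector field of `X`. -/
def leftDeriv (f : G → 𝕜) (x : G) (X : LieAlg n G) : 𝕜 :=
  mfderiv (𝓡 n) 𝓘(ℝ, 𝕜) f x (mulInvariantVectorField X x)

/-- The derivative at `t = 0` of `ψ (x exp (t X))` for a function `ψ` with values in a finite-dimensional
vector space, computed in the coordinates of a basis. -/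
def leftDerivVec [FiniteDimensional 𝕜 F] (ψ : G → F) (x : G) (X : LieAlg n G) : F :=
  ∑ i, leftDeriv 𝕜 (fun y ↦ (Module.finBasis 𝕜 F).coord i (ψ y)) x X • Module.finBasis 𝕜 F i

end Smooth

/-! ### Tangent fields and connections on `G/K` -/

variable (μ) in
/-- The elements of `A = C^∞(G/K)`, viewed as functions on `G`. -/
def IsBaseFunction (f : G → ℝ) : Prop :=
  ContMDiff (𝓡 n) 𝓘(ℝ, ℝ) ∞ f ∧ ∀ (x : G) (s : stab μ), f (x * s) = f x

/-- The elements of the module `𝒯(G/K)` of smooth vector fields on `G/K`. -/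
def IsTangentField (V : G → mSub μ) : Prop :=
  IsSmooth n ℝ V ∧ ∀ (x : G) (s : stab μ), V (x * s) = AdM μ s⁻¹ (V x)

/-- The derivation `δ_V` of `C^∞(G/K)` given by a vector field `V`. -/
def fieldDeriv (V : G → mSub μ) (f : G → ℝ) (x : G) : ℝ :=
  leftDeriv ℝ f x (V x : LieAlg n G)

/-- The canonical connection `∇^c` on `𝒯(G/K)`. -/
def canonicalConnection (V W : G → mSub μ) (x : G) : mSub μ :=
  leftDerivVec ℝ W x (V x : LieAlg n G)

variable (μ) in
/-- A connection `∇` on `𝒯(G/K)`, given by its difference `L` from the canonical connection: a tensor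
field such that `(∇_V W)(x) = (∇^c_V W)(x) + L(x)(V(x), W(x))` defines a vector field on `G/K` for all
vector fields `V` and `W` on `G/K`. -/
@[ext]
structure Connection where
  /-- the tensor field `L = ∇ - ∇^c` -/
  L : G → mSub μ →ₗ[ℝ] mSub μ →ₗ[ℝ] mSub μ
  isTangentField : ∀ V W : G → mSub μ, IsTangentField V → IsTangentField W →
    IsTangentField fun x ↦ canonicalConnection V W x + L x (V x) (W x)

namespace Connection

variable (c : Connection μ) (h : AlmostHermitian μ)

/-- `∇_V W`. -/
def cov (V W : G → mSub μ) (x : G) : mSub μ :=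
  canonicalConnection V W x + c.L x (V x) (W x)

/-- `∇` is compatible with the Riemannian metric. -/
def IsMetric : Prop :=
  ∀ U V W : G → mSub μ, IsTangentField U → IsTangentField V → IsTangentField W → ∀ x,
    fieldDeriv U (fun y ↦ h.g (V y) (W y)) x =
      h.g (c.cov U V x) (W x) + h.g (V x) (c.cov U W x)

/-- `∇` has torsion zero: `∇_V W - ∇_W V = [V, W]`, where the bracket is the commutator of vector fields
as derivations of `C^∞(G/K)`. -/
def IsTorsionFree : Prop :=
  ∀ V W : G → mSub μ, IsTangentField V → IsTangentField W →
    ∀ f : G → ℝ, IsBaseFunction μ f → ∀ x,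
      fieldDeriv (fun y ↦ c.cov V W y - c.cov W V y) f x =
        fieldDeriv V (fieldDeriv W f) x - fieldDeriv W (fieldDeriv V f) x

/-- `∇` is the Levi-Civita connection of the Riemannian metric. -/
def IsLeviCivita : Prop := c.IsMetric h ∧ c.IsTorsionFree

/-- Each `∇_V` commutes with `J`. -/
def CommutesWithJ : Prop :=
  ∀ V W : G → mSub μ, IsTangentField V → IsTangentField W → ∀ x,
    c.cov V (fun y ↦ h.J (W y)) x = h.J (c.cov V W x)

/-- Each `L_V` commutes with `J`, that is, `∇` and `∇^c` differ by an operator commuting with `J`. -/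
def TensorCommutesWithJ : Prop :=
  ∀ (x : G) (X Y : mSub μ), c.L x X (h.J Y) = h.J (c.L x X Y)

end Connection

/-! ### Spinors -/

namespace AlmostHermitian

variable (h : AlmostHermitian μ)

/-- `𝔪_J`: the space `𝔪` as a complex vector space, with multiplication by `i` given by `J`. -/
def MJ (_h : AlmostHermitian μ) : Type := mSub μ

instance : AddCommGroup h.MJ := inferInstanceAs (AddCommGroup (mSub μ))

/-- The identity map from `𝔪` to `𝔪_J`. -/
def toMJ : mSub μ ≃+ h.MJ := AddEquiv.refl _

instance : Module ℂ h.MJ where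
  smul c X := h.toMJ (c.re • h.toMJ.symm X + c.im • h.J (h.toMJ.symm X))
  one_smul X := by
    change h.toMJ ((1 : ℂ).re • h.toMJ.symm X + (1 : ℂ).im • h.J (h.toMJ.symm X)) = X
    simp
  mul_smul a b X := by
    apply h.toMJ.symm.injective
    change ((a * b).re • h.toMJ.symm X + (a * b).im • h.J (h.toMJ.symm X) : mSub μ) =
      a.re • (b.re • h.toMJ.symm X + b.im • h.J (h.toMJ.symm X)) +
        a.im • h.J (b.re • h.toMJ.symm X + b.im • h.J (h.toMJ.symm X))
    simp only [Complex.mul_re, Complex.mul_im, map_add, map_smul, h.J_sq]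
    module
  smul_zero c := by
    change h.toMJ (c.re • h.toMJ.symm 0 + c.im • h.J (h.toMJ.symm 0)) = 0
    simp
  smul_add c X Y := by
    apply h.toMJ.symm.injective
    change (c.re • (h.toMJ.symm X + h.toMJ.symm Y) + c.im • h.J (h.toMJ.symm X + h.toMJ.symm Y) :
      mSub μ) = (c.re • h.toMJ.symm X + c.im • h.J (h.toMJ.symm X)) +
        (c.re • h.toMJ.symm Y + c.im • h.J (h.toMJ.symm Y))
    simp only [map_add]
    module
  add_smul a b X := by
    apply h.toMJ.symm.injective
    change ((a + b).re • h.toMJ.symm X + (a + b).im • h.J (h.toMJ.symm X) : mSub μ) =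
      (a.re • h.toMJ.symm X + a.im • h.J (h.toMJ.symm X)) +
        (b.re • h.toMJ.symm X + b.im • h.J (h.toMJ.symm X))
    simp only [Complex.add_re, Complex.add_im]
    module
  zero_smul X := by
    change h.toMJ ((0 : ℂ).re • h.toMJ.symm X + (0 : ℂ).im • h.J (h.toMJ.symm X)) = 0
    simp

theorem smul_def (c : ℂ) (X : h.MJ) :
    c • X = h.toMJ (c.re • h.toMJ.symm X + c.im • h.J (h.toMJ.symm X)) := rfl

instance : Module.Finite ℂ h.MJ := by
  let b := Module.finBasis ℝ (mSub μ)
  refine Module.finite_def.2 (Submodule.fg_def.2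
    ⟨Set.range fun i ↦ h.toMJ (b i), Set.finite_range _, top_le_iff.1 fun X _ ↦ ?_⟩)
  have hX : X = ∑ i, ((b.repr (h.toMJ.symm X) i : ℝ) : ℂ) • h.toMJ (b i) := by
    apply h.toMJ.symm.injective
    rw [map_sum]
    conv_lhs => rw [← b.sum_repr (h.toMJ.symm X)]
    simp only [smul_def, Complex.ofReal_re, Complex.ofReal_im, zero_smul, add_zero,
      AddEquiv.symm_apply_apply]
  rw [hX]
  exact Submodule.sum_mem _ fun i _ ↦ Submodule.smul_mem _ _ (Submodule.subset_span ⟨i, rfl⟩)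

/-- The complex inner product `⟨X, Y⟩_J = g(X, Y) + i g(J X, Y)` on `𝔪_J`, linear in the second
variable. -/
def herm : h.MJ →ₗ⋆[ℂ] h.MJ →ₗ[ℂ] ℂ :=
  LinearMap.mk₂'ₛₗ (starRingEnd ℂ) (RingHom.id ℂ)
    (fun X Y ↦ (h.g (h.toMJ.symm X) (h.toMJ.symm Y) : ℂ) +
      Complex.I * (h.g (h.J (h.toMJ.symm X)) (h.toMJ.symm Y) : ℂ))
    (fun X X' Y ↦ by simp; ring)
    (fun c X Y ↦ by
      simp only [smul_def, AddEquiv.symm_apply_apply, map_add, map_smul, h.J_sq]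
      apply Complex.ext <;> simp)
    (fun X Y Y' ↦ by simp; ring)
    (fun c X Y ↦ by
      have e : h.g (h.toMJ.symm X) (h.J (h.toMJ.symm Y)) =
          -h.g (h.J (h.toMJ.symm X)) (h.toMJ.symm Y) := by
        rw [← h.g_J, h.J_sq]; simp
      simp only [smul_def, AddEquiv.symm_apply_apply, map_add, map_smul, h.g_J, e]
      apply Complex.ext <;> simp <;> ring)

/-- A real linear operator on `𝔪` that commutes with `J`, as a complex linear operator on `𝔪_J`. -/
def complexify (T : mSub μ →ₗ[ℝ] mSub μ) (hT : ∀ X, T (h.J X) = h.J (T X)) :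
    h.MJ →ₗ[ℂ] h.MJ where
  toFun X := h.toMJ (T (h.toMJ.symm X))
  map_add' X Y := by simp
  map_smul' c X := by simp [smul_def, hT]

/-- The space `𝒮 = ℱ(𝔪_J)` of spinors. -/
abbrev Spinor : Type := Fock h.MJ

/-- The action of `K` on spinors by algebra automorphisms extending the action `Ad` on `𝔪`. -/
def AdS (s : stab μ) : h.Spinor →ₐ[ℂ] h.Spinor :=
  ExteriorAlgebra.map (h.complexify (AdM μ s) fun X ↦ (h.J_Ad s X).symm)

/-- The Clifford action `κ(X)` of `X ∈ 𝔪` on spinors. -/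
def kappa (X : mSub μ) : h.Spinor →ₗ[ℂ] h.Spinor := cliff h.herm (h.toMJ X)

/-- The elements of `𝒮(G/K, χ)`, the spinor fields on `G/K` twisted by a character `χ` of `K`. -/
def IsSpinorField (χ : stab μ →ₜ* Circle) (ψ : G → h.Spinor) : Prop :=
  IsSmooth n ℂ ψ ∧
    ∀ (x : G) (s : stab μ), ψ (x * s) = (starRingEnd ℂ) (χ s : ℂ) • h.AdS s⁻¹ (ψ x)

/-- The inner product of spinor fields from `L²(G/K, 𝒮)`; the invariant measure on `G/K` is the image
of a Haar measure `ν` on `G`. -/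
def l2Inner [MeasurableSpace G] (ν : MeasureTheory.Measure G) (ψ φ : G → h.Spinor) : ℂ :=
  ∫ x, fockInner h.herm (ψ x) (φ x) ∂ν

theorem g_nondegenerate : h.g.Nondegenerate := by
  constructor
  · intro X hX
    by_contra h0
    exact (h.g_pos X h0).ne' (hX X)
  · intro X hX
    by_contra h0
    exact (h.g_pos X h0).ne' (hX X)

end AlmostHermitian

section Dirac

variable (h : AlmostHermitian μ) (c : Connection μ) (hc : c.TensorCommutesWithJ h)

/-- `∇^𝒮_X ψ (x)` for a tangent vector `X ∈ 𝔪` at `x`: the spinor connection is the sum of the canonical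
connection and of the derivation of the exterior algebra extending `L_X`. -/
def spinorConnection (ψ : G → h.Spinor) (x : G) (X : mSub μ) : h.Spinor :=
  leftDerivVec ℂ ψ x (X : LieAlg n G) + extDer (h.complexify (c.L x X) (hc x X)) (ψ x)

/-- The Dirac operator `D ψ = κ(grad ψ)`: with respect to a basis `(bᵢ)` of `𝔪` and its dual basis `(bⁱ)`
for the metric, the gradient is `∑ᵢ bᵢ ⊗ ∇^𝒮_{bⁱ} ψ`, and `D ψ = ∑ᵢ κ(bᵢ) ∇^𝒮_{bⁱ} ψ`. -/
def dirac (ψ : G → h.Spinor) (x : G) : h.Spinor :=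
  ∑ i, h.kappa (Module.finBasis ℝ (mSub μ) i)
    (spinorConnection h c hc ψ x
      (LinearMap.BilinForm.dualBasis h.g h.g_nondegenerate (Module.finBasis ℝ (mSub μ)) i))

/-- `D` maps `𝒮(G/K, χ)` into itself and is formally self-adjoint on it:
`⟨D ψ, φ⟩ = ⟨ψ, D φ⟩` for the inner product of `L²(G/K, 𝒮)`. -/
def IsFormallySelfAdjoint [MeasurableSpace G] (ν : MeasureTheory.Measure G)
    (χ : stab μ →ₜ* Circle) (D : (G → h.Spinor) → G → h.Spinor) : Prop :=
  (∀ ψ, h.IsSpinorField χ ψ → h.IsSpinorField χ (D ψ)) ∧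
    ∀ ψ φ, h.IsSpinorField χ ψ → h.IsSpinorField χ φ →
      h.l2Inner ν (D ψ) φ = h.l2Inner ν ψ (D φ)

end Dirac

end LieGroup

end CoadjointDirac

end

/-!
Averaging over the compact group `G` yields an invariant inner product on `𝔤`, for which the
operators `ad X` are skew, so that `Kil` is positive definite. On `𝔪` the skew operator `Γ` is
invertible, and `|Γ|` is the square root of `-Γ²`. Since `ad` of the vector representing `μ` is a
derivation, the eigenvectors of `Γ²` make the Nijenhuis tensor of `J` vanish. A tensor `L` defines
the Levi-Civita connection if and only if it is skew for the metric and has the torsion of the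
canonical connection; the Koszul formula gives the only such `L`, which is constant on `G`. It
commutes with `J` because `J` is integrable and `ω` is closed.

In a `g`-orthonormal basis `(eᵢ)`, the connection `∇` respects the inner product of spinors and
`∇_X (κ(Y) φ) = κ(L_X Y) φ + κ(Y) ∇_X φ`, while every `κ(Y)` is skew-adjoint. Hence
`⟨ψ, D φ⟩ - ⟨D ψ, φ⟩` is the sum of the derivatives of `⟨ψ, κ(eᵢ) φ⟩` along `eᵢ`, up to the term
`⟨ψ, κ(∑ᵢ L_{eᵢ} eᵢ) φ⟩`. That term vanishes since the maps `Y ↦ [Z, Y]_𝔪` are traceless, and the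
derivatives integrate to zero because Haar measure on `G` is right invariant.
-/

noncomputable section

namespace CoadjointDirac

section MixedPartials

variable {E E' F : Type*} [NormedAddCommGroup E] [NormedSpace ℝ E] [NormedAddCommGroup E']
  [NormedSpace ℝ E'] [NormedAddCommGroup F] [NormedSpace ℝ F]

theorem fderiv_partial_comm {f : E × E' → F} {a : E} {b : E'} (hf : ContDiffAt ℝ 2 f (a, b))
    (v : E) (w : E') :
    fderiv ℝ (fun y ↦ fderiv ℝ (fun x ↦ f (x, y)) a v) b w =
      fderiv ℝ (fun x ↦ fderiv ℝ (fun y ↦ f (x, y)) b w) a v := by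
  have hdiff : ∀ᶠ p in nhds (a, b), DifferentiableAt ℝ f p := by
    filter_upwards [hf.eventually (by simp)] with p hp using hp.differentiableAt (by simp)
  have hfst : (fun y ↦ fderiv ℝ (fun x ↦ f (x, y)) a v) =ᶠ[nhds b]
      fun y ↦ fderiv ℝ f (a, y) (v, 0) := by
    filter_upwards [(Continuous.prodMk_right a).continuousAt.eventually hdiff] with y hy
    exact DFunLike.congr_fun
      (HasFDerivAt.comp (f := (·, y)) a hy.hasFDerivAt (hasFDerivAt_prodMk_left a y)).fderiv v
  have hsnd : (fun x ↦ fderiv ℝ (fun y ↦ f (x, y)) b w) =ᶠ[nhds a]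
      fun x ↦ fderiv ℝ f (x, b) (0, w) := by
    filter_upwards [(Continuous.prodMk_left b).continuousAt.eventually hdiff] with x hx
    exact DFunLike.congr_fun
      (HasFDerivAt.comp (f := (x, ·)) b hx.hasFDerivAt (hasFDerivAt_prodMk_right x b)).fderiv w
  have hd2 : HasFDerivAt (fderiv ℝ f) (fderiv ℝ (fderiv ℝ f) (a, b)) (a, b) :=
    ((hf.fderiv_right (m := 1) (by norm_num)).differentiableAt (by simp)).hasFDerivAt
  have hd2_fst := (HasFDerivAt.comp (f := (a, ·)) b hd2 (hasFDerivAt_prodMk_right a b)).clm_apply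
    (hasFDerivAt_const ((v, 0) : E × E') b)
  have hd2_snd := (HasFDerivAt.comp (f := (·, b)) a hd2 (hasFDerivAt_prodMk_left a b)).clm_apply
    (hasFDerivAt_const ((0, w) : E × E') a)
  have hsymm := hf.isSymmSndFDerivAt (by simp) (0, w) (v, 0)
  rw [hfst.fderiv_eq, hsnd.fderiv_eq]
  refine (DFunLike.congr_fun hd2_fst.fderiv w).trans
    (Eq.trans ?_ (DFunLike.congr_fun hd2_snd.fderiv v).symm)
  simpa using hsymm

variable {M M' : Type*} [TopologicalSpace M] [ChartedSpace E M] [TopologicalSpace M']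
  [ChartedSpace E' M']

theorem mvfderiv_eq_fderiv_extChartAt_symm {f : M → F} {a : M}
    (hf : MDifferentiableAt 𝓘(ℝ, E) 𝓘(ℝ, F) f a) (v : E) :
    mvfderiv 𝓘(ℝ, E) f a v =
      fderiv ℝ (fun u ↦ f ((extChartAt 𝓘(ℝ, E) a).symm u)) (extChartAt 𝓘(ℝ, E) a a) v := by
  have h := hf.mfderiv
  rw [modelWithCornersSelf_coe, Set.range_id, fderivWithin_univ] at h
  exact DFunLike.congr_fun h v

variable [IsManifold 𝓘(ℝ, E) ∞ M] [IsManifold 𝓘(ℝ, E') ∞ M']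

theorem contMDiff_mvfderiv_snd {f : M × M' → F}
    (hf : ContMDiff (𝓘(ℝ, E).prod 𝓘(ℝ, E')) 𝓘(ℝ, F) ∞ f) (b : M') (w : E') :
    ContMDiff 𝓘(ℝ, E) 𝓘(ℝ, F) ∞ fun x ↦ (mvfderiv 𝓘(ℝ, E') (fun y ↦ f (x, y)) b w : F) := by
  have : IsManifold 𝓘(ℝ, E') 1 M' := .of_le (n := ∞) (by simp)
  intro x₀
  have h := ContMDiffAt.mfderiv_apply (I := 𝓘(ℝ, E')) (I' := 𝓘(ℝ, F)) (J := 𝓘(ℝ, E))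
    (J' := 𝓘(ℝ, E)) (n := ∞) (m := ∞) (x₀ := x₀) (fun x y ↦ f (x, y)) (fun _ : M ↦ b) id
    (fun _ ↦ w) hf.contMDiffAt contMDiffAt_const contMDiffAt_id contMDiffAt_const (by simp)
  refine h.congr_of_eventuallyEq (.of_forall fun x ↦ ?_)
  have hcoord : inTangentCoordinates 𝓘(ℝ, E') 𝓘(ℝ, F) (fun _ : M ↦ b) (fun x ↦ f (x, b))
      (fun x ↦ mvfderiv 𝓘(ℝ, E') (fun y ↦ f (x, y)) b) x₀ x w =
        mvfderiv 𝓘(ℝ, E') (fun y ↦ f (x, y)) b w := by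
    have hcoords := inTangentCoordinates_eq (I := 𝓘(ℝ, E')) (I' := 𝓘(ℝ, F)) (fun _ : M ↦ b)
      (fun x ↦ f (x, b)) (fun x ↦ mvfderiv 𝓘(ℝ, E') (fun y ↦ f (x, y)) b) (x₀ := x₀) (x := x)
      (mem_chart_source E' b) (mem_chart_source F (f (x, b)))
    have hself := (tangentBundleCore 𝓘(ℝ, E') M').coordChange_self (achart E' b) b
      (mem_chart_source _ _) w
    rw [tangentBundleCore_coordChange_model_space] at hcoords
    exact (DFunLike.congr_fun hcoords w).trans
      (congrArg (mvfderiv 𝓘(ℝ, E') (fun y ↦ f (x, y)) b) hself)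
  exact hcoord.symm

theorem mvfderiv_partial_comm {f : M × M' → F}
    (hf : ContMDiff (𝓘(ℝ, E).prod 𝓘(ℝ, E')) 𝓘(ℝ, F) ∞ f) (a : M) (b : M') (v : E) (w : E') :
    mvfderiv 𝓘(ℝ, E') (fun y ↦ (mvfderiv 𝓘(ℝ, E) (fun x ↦ f (x, y)) a v : F)) b w =
      mvfderiv 𝓘(ℝ, E) (fun x ↦ (mvfderiv 𝓘(ℝ, E') (fun y ↦ f (x, y)) b w : F)) a v := by
  have hfst (y : M') : MDifferentiableAt 𝓘(ℝ, E) 𝓘(ℝ, F) (fun x ↦ f (x, y)) a :=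
    (hf.comp (contMDiff_id.prodMk contMDiff_const)).mdifferentiable (by simp) a
  have hsnd (x : M) : MDifferentiableAt 𝓘(ℝ, E') 𝓘(ℝ, F) (fun y ↦ f (x, y)) b :=
    (hf.comp (contMDiff_const.prodMk contMDiff_id)).mdifferentiable (by simp) b
  have hfst' : ContMDiff 𝓘(ℝ, E') 𝓘(ℝ, F) ∞
      fun y ↦ (mvfderiv 𝓘(ℝ, E) (fun x ↦ f (x, y)) a v : F) :=
    contMDiff_mvfderiv_snd (f := fun p : M' × M ↦ f (p.2, p.1))
      (hf.comp (contMDiff_snd.prodMk contMDiff_fst)) a v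
  have hsnd' := contMDiff_mvfderiv_snd hf b w
  rw [mvfderiv_eq_fderiv_extChartAt_symm (hfst'.mdifferentiable (by simp) b),
    mvfderiv_eq_fderiv_extChartAt_symm (hsnd'.mdifferentiable (by simp) a)]
  simp only [mvfderiv_eq_fderiv_extChartAt_symm (hfst _),
    mvfderiv_eq_fderiv_extChartAt_symm (hsnd _)]
  have hfst_chart := (contMDiffOn_extChartAt_symm (I := 𝓘(ℝ, E)) (n := ∞) a).contMDiffAt
    (extChartAt_target_mem_nhds a)
  have hsnd_chart := (contMDiffOn_extChartAt_symm (I := 𝓘(ℝ, E')) (n := ∞) b).contMDiffAt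
    (extChartAt_target_mem_nhds b)
  have hcharts := hf.contMDiffAt.comp (extChartAt 𝓘(ℝ, E) a a, extChartAt 𝓘(ℝ, E') b b)
    ((hfst_chart.comp (_, _) contDiffAt_fst.contMDiffAt).prodMk
      (hsnd_chart.comp (_, _) contDiffAt_snd.contMDiffAt))
  exact fderiv_partial_comm (hcharts.contDiffAt.of_le (le_trans (by norm_num) three_le)) v w

end MixedPartials

section LeftDeriv

variable {n : ℕ} {G : Type*} [TopologicalSpace G] [ChartedSpace (EuclideanSpace ℝ (Fin n)) G]
  [Group G] {𝕜 : Type*} [RCLike 𝕜] {f f' : G → 𝕜} {x : G}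

theorem leftDeriv_eq_mvfderiv (f : G → 𝕜) (x : G) (X : LieAlg n G) :
    leftDeriv 𝕜 f x X = mvfderiv (𝓡 n) f x (mulInvariantVectorField X x) := rfl

theorem mulInvariantVectorField_one (X : LieAlg n G) :
    (mulInvariantVectorField X (1 : G) : LieAlg n G) = X := by
  have h : (fun x : G ↦ 1 * x) = id := funext one_mul
  unfold mulInvariantVectorField
  rw [h, mfderiv_id]
  rfl

theorem leftDeriv_one (f : G → 𝕜) (X : LieAlg n G) :
    leftDeriv 𝕜 f 1 X = mvfderiv (𝓡 n) f 1 X := by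
  rw [leftDeriv_eq_mvfderiv]
  exact congrArg (mvfderiv (𝓡 n) f 1) (mulInvariantVectorField_one X)

variable (f x) in
theorem leftDeriv_add_right (X Y : LieAlg n G) :
    leftDeriv 𝕜 f x (X + Y) = leftDeriv 𝕜 f x X + leftDeriv 𝕜 f x Y := by
  simp only [leftDeriv_eq_mvfderiv, mulInvariantVectorField_add, Pi.add_apply]
  exact map_add _ _ _

variable (f x) in
theorem leftDeriv_smul_right (c : ℝ) (X : LieAlg n G) :
    leftDeriv 𝕜 f x (c • X) = c • leftDeriv 𝕜 f x X := by
  simp only [leftDeriv_eq_mvfderiv, mulInvariantVectorField_smul, Pi.smul_apply]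
  exact map_smul (mvfderiv (𝓡 n) f x) c _

variable (f x) in
/-- The differential of `f` at `x` in the left trivialization of the tangent bundle. -/
def leftDifferential : LieAlg n G →ₗ[ℝ] 𝕜 where
  toFun X := leftDeriv 𝕜 f x X
  map_add' := leftDeriv_add_right f x
  map_smul' := leftDeriv_smul_right f x

theorem leftDeriv_eq_sum {ι : Type*} [Fintype ι] (b : Module.Basis ι ℝ (LieAlg n G))
    (f : G → 𝕜) (x : G) (X : LieAlg n G) :
    leftDeriv 𝕜 f x X = ∑ i, b.coord i X • leftDeriv 𝕜 f x (b i) := by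
  conv_lhs => rw [← b.sum_repr X]
  exact (map_sum (leftDifferential f x) _ _).trans
    (Finset.sum_congr rfl fun i _ ↦ map_smul (leftDifferential f x) _ _)

theorem leftDeriv_const (c : 𝕜) (x : G) (X : LieAlg n G) :
    leftDeriv 𝕜 (fun _ ↦ c) x X = 0 := by
  rw [leftDeriv_eq_mvfderiv, mvfderiv_const]
  rfl

theorem leftDeriv_clm_comp {𝕜' : Type*} [RCLike 𝕜'] (T : 𝕜 →L[ℝ] 𝕜')
    (hf : MDifferentiableAt (𝓡 n) 𝓘(ℝ, 𝕜) f x) (X : LieAlg n G) :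
    leftDeriv 𝕜' (fun y ↦ T (f y)) x X = T (leftDeriv 𝕜 f x X) := by
  have h := mfderiv_comp_apply x (T.mdifferentiableAt (x := f x)) hf (mulInvariantVectorField X x)
  rw [T.mfderiv_eq] at h
  exact h

theorem leftDeriv_add (hf : MDifferentiableAt (𝓡 n) 𝓘(ℝ, 𝕜) f x)
    (hf' : MDifferentiableAt (𝓡 n) 𝓘(ℝ, 𝕜) f' x) (X : LieAlg n G) :
    leftDeriv 𝕜 (fun y ↦ f y + f' y) x X = leftDeriv 𝕜 f x X + leftDeriv 𝕜 f' x X := by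
  simp only [leftDeriv_eq_mvfderiv, mvfderiv_fun_add hf hf']
  rfl

theorem leftDeriv_mul (hf : MDifferentiableAt (𝓡 n) 𝓘(ℝ, 𝕜) f x)
    (hf' : MDifferentiableAt (𝓡 n) 𝓘(ℝ, 𝕜) f' x) (X : LieAlg n G) :
    leftDeriv 𝕜 (fun y ↦ f y * f' y) x X = leftDeriv 𝕜 f x X * f' x + f x * leftDeriv 𝕜 f' x X := by
  have h := (hf.hasMFDerivAt.mul' hf'.hasMFDerivAt).mfderiv
  refine (DFunLike.congr_fun h (mulInvariantVectorField X x)).trans ?_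
  exact add_comm _ _

theorem leftDeriv_const_mul (hf : MDifferentiableAt (𝓡 n) 𝓘(ℝ, 𝕜) f x) (c : 𝕜)
    (X : LieAlg n G) : leftDeriv 𝕜 (fun y ↦ c * f y) x X = c * leftDeriv 𝕜 f x X :=
  leftDeriv_clm_comp (ContinuousLinearMap.mul ℝ 𝕜 c) hf X

theorem leftDeriv_sum {ι : Type*} (s : Finset ι) {f : ι → G → 𝕜}
    (hf : ∀ i ∈ s, ContMDiff (𝓡 n) 𝓘(ℝ, 𝕜) ∞ (f i)) (X : LieAlg n G) :
    leftDeriv 𝕜 (fun y ↦ ∑ i ∈ s, f i y) x X = ∑ i ∈ s, leftDeriv 𝕜 (f i) x X := by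
  induction s using Finset.cons_induction with
  | empty => simpa using leftDeriv_const 0 x X
  | cons i s hi ih =>
    rw [Finset.forall_mem_cons] at hf
    simp only [Finset.sum_cons]
    rw [leftDeriv_add (hf.1.mdifferentiable (by simp) x)
      ((contMDiff_finsetSum hf.2).mdifferentiable (by simp) x), ih hf.2]

theorem hasDerivAt_comp_of_hasMFDerivAt {γ : ℝ → G} {t : ℝ} {X : LieAlg n G}
    (hf : MDifferentiableAt (𝓡 n) 𝓘(ℝ, 𝕜) f (γ t))
    (hγ : HasMFDerivAt 𝓘(ℝ, ℝ) (𝓡 n) γ t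
      ((1 : ℝ →L[ℝ] ℝ).smulRight (mulInvariantVectorField X (γ t)))) :
    HasDerivAt (fun s ↦ f (γ s)) (leftDeriv 𝕜 f (γ t) X) t := by
  have h : HasFDerivAt (fun s ↦ f (γ s)) ((mvfderiv (𝓡 n) f (γ t)).comp
      ((1 : ℝ →L[ℝ] ℝ).smulRight (mulInvariantVectorField X (γ t)))) t :=
    (HasMFDerivAt.comp t hf.hasMFDerivAt hγ).hasFDerivAt
  exact h.hasDerivAt.congr_deriv (congrArg (mvfderiv (𝓡 n) f (γ t)) (one_smul ℝ _))

variable [LieGroup (𝓡 n) ∞ G]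

variable (n) in
theorem mdifferentiableAt_mul_left (a x : G) :
    MDifferentiableAt (𝓡 n) (𝓡 n) (fun y : G ↦ a * y) x :=
  (contMDiff_mul_left (I := 𝓡 n) (n := ∞) (a := a)).mdifferentiable (by simp) x

theorem leftDeriv_eq_mvfderiv_mul_left (hf : MDifferentiableAt (𝓡 n) 𝓘(ℝ, 𝕜) f x)
    (X : LieAlg n G) : leftDeriv 𝕜 f x X = mvfderiv (𝓡 n) (fun y ↦ f (x * y)) 1 X :=
  (mfderiv_comp_apply_of_eq 1 hf (mdifferentiableAt_mul_left n x 1) (mul_one x) X).symm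

theorem hasDerivAt_leftDeriv {γ : ℝ → G} {X : LieAlg n G}
    (hf : MDifferentiableAt (𝓡 n) 𝓘(ℝ, 𝕜) f x) (hγ_zero : γ 0 = 1)
    (hγ : MDifferentiableAt 𝓘(ℝ, ℝ) (𝓡 n) γ 0) (hX : velocity n γ = X) :
    HasDerivAt (fun t ↦ f (x * γ t)) (leftDeriv 𝕜 f x X) 0 := by
  have hf_mul : MDifferentiableAt (𝓡 n) 𝓘(ℝ, 𝕜) (fun y ↦ f (x * y)) 1 :=
    MDifferentiableAt.comp_of_eq 1 hf (mdifferentiableAt_mul_left n x 1) (mul_one x)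
  have hcomp : MDifferentiableAt 𝓘(ℝ, ℝ) 𝓘(ℝ, 𝕜) (fun t ↦ f (x * γ t)) 0 :=
    MDifferentiableAt.comp_of_eq (g := fun y ↦ f (x * y)) 0 hf_mul hγ hγ_zero
  refine hcomp.differentiableAt.hasDerivAt.congr_deriv ?_
  rw [leftDeriv_eq_mvfderiv_mul_left hf, ← hX, ← fderiv_apply_one_eq_deriv, ← mfderiv_eq_fderiv]
  exact mfderiv_comp_apply_of_eq 0 hf_mul hγ hγ_zero 1

theorem leftDeriv_mul_left (a : G) (hf : MDifferentiableAt (𝓡 n) 𝓘(ℝ, 𝕜) f (a * x))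
    (X : LieAlg n G) : leftDeriv 𝕜 (fun y ↦ f (a * y)) x X = leftDeriv 𝕜 f (a * x) X := by
  have hf_mul : MDifferentiableAt (𝓡 n) 𝓘(ℝ, 𝕜) (fun y ↦ f (a * y)) x :=
    MDifferentiableAt.comp x hf (mdifferentiableAt_mul_left n a x)
  rw [leftDeriv_eq_mvfderiv_mul_left hf_mul, leftDeriv_eq_mvfderiv_mul_left hf]
  simp only [mul_assoc]

theorem leftDeriv_mul_right (s : G) (hf : MDifferentiableAt (𝓡 n) 𝓘(ℝ, 𝕜) f (x * s))
    (X : LieAlg n G) :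
    leftDeriv 𝕜 (fun y ↦ f (y * s)) x X = leftDeriv 𝕜 f (x * s) (Ad n G s⁻¹ X) := by
  have hright : MDifferentiableAt (𝓡 n) (𝓡 n) (fun y : G ↦ y * s) x :=
    (contMDiff_mul_right (I := 𝓡 n) (n := ∞) (a := s)).mdifferentiable (by simp) x
  have hf_mul : MDifferentiableAt (𝓡 n) 𝓘(ℝ, 𝕜) (fun y ↦ f (x * s * y)) 1 :=
    MDifferentiableAt.comp_of_eq 1 hf (mdifferentiableAt_mul_left n (x * s) 1) (mul_one _)
  have hconj := mfderiv_comp_apply_of_eq 1 hf_mul (conj_mdiff n s⁻¹ 1) (by simp) X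
  have hfun : (fun y ↦ f (x * s * y)) ∘ (fun y ↦ s⁻¹ * y * s⁻¹⁻¹) = fun y ↦ f (x * y * s) := by
    funext y
    simp [mul_assoc]
  rw [hfun] at hconj
  rw [leftDeriv_eq_mvfderiv_mul_left (f := fun y ↦ f (y * s)) (MDifferentiableAt.comp x hf hright),
    leftDeriv_eq_mvfderiv_mul_left hf]
  exact hconj

theorem contMDiff_leftDeriv (hf : ContMDiff (𝓡 n) 𝓘(ℝ, 𝕜) ∞ f) (X : LieAlg n G) :
    ContMDiff (𝓡 n) 𝓘(ℝ, 𝕜) ∞ fun x ↦ leftDeriv 𝕜 f x X := by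
  simp only [leftDeriv_eq_mvfderiv_mul_left (hf.mdifferentiable (by simp) _)]
  exact contMDiff_mvfderiv_snd (f := fun p : G × G ↦ f (p.1 * p.2))
    (hf.comp (contMDiff_mul (𝓡 n) ∞)) 1 X

end LeftDeriv

section LieBracket

open VectorField

variable {n : ℕ} {G : Type*} [TopologicalSpace G] [ChartedSpace (EuclideanSpace ℝ (Fin n)) G]
  [Group G] [LieGroup (𝓡 n) ∞ G] {f : G → ℝ}

theorem mlieBracket_mulInvariantVectorField (X Y : LieAlg n G) :
    mlieBracket (𝓡 n) (mulInvariantVectorField X) (mulInvariantVectorField Y) =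
      mulInvariantVectorField (G := G) ⁅X, Y⁆ :=
  (mulInvariantVector_mlieBracket X Y).symm

theorem mulInvariantVectorField_injective (x : G) :
    Function.Injective fun X : LieAlg n G ↦ mulInvariantVectorField X x := by
  intro X Y h
  have hid (Z : LieAlg n G) :
      mfderiv (𝓡 n) (𝓡 n) (x⁻¹ * ·) x (mulInvariantVectorField Z x) = Z := by
    have hx := mfderiv_comp_apply_of_eq 1 (mdifferentiableAt_mul_left n x⁻¹ x)
      (mdifferentiableAt_mul_left n x 1) (mul_one x) Z
    have hfun : (fun y : G ↦ x⁻¹ * y) ∘ (fun y ↦ x * y) = id := by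
      funext y
      simp
    rw [hfun, mfderiv_id] at hx
    exact hx.symm
  exact (hid X).symm.trans ((congrArg (mfderiv (𝓡 n) (𝓡 n) (x⁻¹ * ·) x) h).trans (hid Y))

theorem contMDiff_smul_mulInvariantVectorField (hf : ContMDiff (𝓡 n) 𝓘(ℝ, ℝ) ∞ f)
    (Z : LieAlg n G) :
    ContMDiff (𝓡 n) (𝓡 n).tangent 2 fun x ↦
      (⟨x, (f • mulInvariantVectorField Z) x⟩ : TangentBundle (𝓡 n) G) := by
  have hZ := (contMDiff_mulInvariantVectorField (I := 𝓡 n) (G := G) Z).of_le (m := 2) (by simp)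
  exact (hf.of_le (le_trans (by norm_num) three_le)).smul_section hZ

theorem mlieBracket_mulInvariantVectorField_smul (hf : ContMDiff (𝓡 n) 𝓘(ℝ, ℝ) ∞ f)
    (X Z : LieAlg n G) :
    mlieBracket (𝓡 n) (mulInvariantVectorField X) (f • mulInvariantVectorField Z) =
      (fun x ↦ leftDeriv ℝ f x X) • mulInvariantVectorField Z +
        f • mulInvariantVectorField ⁅X, Z⁆ := by
  funext x
  rw [mlieBracket_smul_right (hf.mdifferentiable (by simp) x)
    (mdifferentiableAt_mulInvariantVectorField Z), mlieBracket_mulInvariantVectorField]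
  rfl

theorem mlieBracket_mlieBracket_smul (hf : ContMDiff (𝓡 n) 𝓘(ℝ, ℝ) ∞ f) (x : G)
    (X Y Z : LieAlg n G) :
    mlieBracket (𝓡 n) (mulInvariantVectorField X)
        (mlieBracket (𝓡 n) (mulInvariantVectorField Y) (f • mulInvariantVectorField Z)) x =
      mulInvariantVectorField (leftDeriv ℝ (fun y ↦ leftDeriv ℝ f y Y) x X • Z +
        leftDeriv ℝ f x Y • ⁅X, Z⁆ + leftDeriv ℝ f x X • ⁅Y, Z⁆ + f x • ⁅X, ⁅Y, Z⁆⁆) x := by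
  have hfY := contMDiff_leftDeriv hf Y
  rw [mlieBracket_mulInvariantVectorField_smul hf,
    mlieBracket_add_right
      ((contMDiff_smul_mulInvariantVectorField hfY Z).mdifferentiable (by simp) x)
      ((contMDiff_smul_mulInvariantVectorField hf ⁅Y, Z⁆).mdifferentiable (by simp) x),
    mlieBracket_mulInvariantVectorField_smul hfY, mlieBracket_mulInvariantVectorField_smul hf]
  simp only [mulInvariantVectorField_add, mulInvariantVectorField_smul, Pi.add_apply,
    Pi.smul_apply, Pi.smul_apply']
  module

/-- In the Jacobi identity for the invariant fields `X`, `Y` and `f • X` everything cancels except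
`(X Y f - Y X f - ⁅X, Y⁆ f) • X`. -/
theorem leftDeriv_lie (hf : ContMDiff (𝓡 n) 𝓘(ℝ, ℝ) ∞ f) (x : G) (X Y : LieAlg n G) :
    leftDeriv ℝ f x ⁅X, Y⁆ =
      leftDeriv ℝ (fun y ↦ leftDeriv ℝ f y Y) x X -
        leftDeriv ℝ (fun y ↦ leftDeriv ℝ f y X) x Y := by
  obtain rfl | hX := eq_or_ne X 0
  · have hzero (g : G → ℝ) (y : G) : leftDeriv (n := n) ℝ g y 0 = 0 :=
      map_zero (leftDifferential g y)
    simp [hzero, leftDeriv_const]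
  have hjacobi := leibniz_identity_mlieBracket_apply (I := 𝓡 n) (x := x)
    (contMDiff_mulInvariantVectorField X x) (contMDiff_mulInvariantVectorField Y x)
    ((contMDiff_smul_mulInvariantVectorField hf X).of_le (by simp) x)
  rw [mlieBracket_mlieBracket_smul hf, mlieBracket_mlieBracket_smul hf,
    mlieBracket_mulInvariantVectorField, mlieBracket_mulInvariantVectorField_smul hf] at hjacobi
  have hjacobi_one : leftDeriv ℝ (fun y ↦ leftDeriv ℝ f y Y) x X • X + leftDeriv ℝ f x Y • ⁅X, X⁆ +
      leftDeriv ℝ f x X • ⁅Y, X⁆ + f x • ⁅X, ⁅Y, X⁆⁆ =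
      leftDeriv ℝ f x ⁅X, Y⁆ • X + f x • ⁅⁅X, Y⁆, X⁆ +
        (leftDeriv ℝ (fun y ↦ leftDeriv ℝ f y X) x Y • X + leftDeriv ℝ f x X • ⁅Y, X⁆ +
          leftDeriv ℝ f x Y • ⁅X, X⁆ + f x • ⁅Y, ⁅X, X⁆⁆) := by
    apply mulInvariantVectorField_injective x
    refine hjacobi.trans ?_
    simp only [mulInvariantVectorField_add, mulInvariantVectorField_smul, Pi.add_apply,
      Pi.smul_apply, Pi.smul_apply']
  have hcoeff : (leftDeriv ℝ (fun y ↦ leftDeriv ℝ f y Y) x X -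
      leftDeriv ℝ (fun y ↦ leftDeriv ℝ f y X) x Y - leftDeriv ℝ f x ⁅X, Y⁆) • X = 0 := by
    linear_combination (norm := module) hjacobi_one - f x • leibniz_lie X Y X
  exact (sub_eq_zero.mp ((smul_eq_zero.mp hcoeff).resolve_right hX)).symm

end LieBracket

section Coframe

variable {n : ℕ} {G : Type*} [TopologicalSpace G] [ChartedSpace (EuclideanSpace ℝ (Fin n)) G]
  [Group G] [LieGroup (𝓡 n) ∞ G]

theorem exists_contMDiff_leftDeriv_one_eq [T2Space G] (ℓ : LieAlg n G →ₗ[ℝ] ℝ) :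
    ∃ f : G → ℝ, ContMDiff (𝓡 n) 𝓘(ℝ, ℝ) ∞ f ∧ ∀ X : LieAlg n G, leftDeriv ℝ f 1 X = ℓ X := by
  let L : EuclideanSpace ℝ (Fin n) →L[ℝ] ℝ := LinearMap.toContinuousLinearMap ℓ
  let ρ : SmoothBumpFunction (𝓡 n) (1 : G) := Classical.choice inferInstance
  have hcoord : ContMDiffOn (𝓡 n) 𝓘(ℝ, ℝ) ∞ (fun y ↦ L (extChartAt (𝓡 n) (1 : G) y))
      (chartAt (EuclideanSpace ℝ (Fin n)) (1 : G)).source :=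
    L.contDiff.contMDiff.comp_contMDiffOn contMDiffOn_extChartAt
  refine ⟨fun y ↦ ρ y • L (extChartAt (𝓡 n) (1 : G) y), ρ.contMDiff_smul hcoord, fun X ↦ ?_⟩
  have hnear : (fun y ↦ ρ y • L (extChartAt (𝓡 n) (1 : G) y)) =ᶠ[nhds 1]
      fun y ↦ L (extChartAt (𝓡 n) (1 : G) y) := by
    filter_upwards [ρ.eventuallyEq_one] with y hy
    simp [hy]
  have hchain := mfderiv_comp_apply (I := 𝓡 n) (I' := 𝓡 n) (I'' := 𝓘(ℝ, ℝ)) (1 : G)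
    (g := L) (f := extChartAt (𝓡 n) (1 : G)) L.mdifferentiableAt
    (mdifferentiableAt_extChartAt (mem_chart_source _ _)) (mulInvariantVectorField X (1 : G))
  unfold leftDeriv
  rw [hnear.mfderiv_eq]
  refine hchain.trans ?_
  rw [mfderiv_eq_fderiv, L.fderiv, mfderiv_extChartAt_self]
  exact congrArg ℓ (mulInvariantVectorField_one X)

end Coframe

section VectorCalculus

variable {n : ℕ} {G : Type*} [TopologicalSpace G] [ChartedSpace (EuclideanSpace ℝ (Fin n)) G]
  {𝕜 : Type*} [RCLike 𝕜] {F F' : Type*} [AddCommGroup F] [Module 𝕜 F] [AddCommGroup F']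
  [Module 𝕜 F'] {ψ φ : G → F}

theorem contMDiff_fun_mul {f f' : G → 𝕜} (hf : ContMDiff (𝓡 n) 𝓘(ℝ, 𝕜) ∞ f)
    (hf' : ContMDiff (𝓡 n) 𝓘(ℝ, 𝕜) ∞ f') :
    ContMDiff (𝓡 n) 𝓘(ℝ, 𝕜) ∞ fun x ↦ f x * f' x :=
  (contDiff_mul (𝕜 := ℝ) (𝔸 := 𝕜)).contMDiff.comp (hf.prodMk_space hf')

theorem eq_of_forall_dual_eq {K V : Type*} [Field K] [AddCommGroup V] [Module K V] {v w : V}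
    (h : ∀ ℓ : V →ₗ[K] K, ℓ v = ℓ w) : v = w :=
  Module.eval_apply_injective K (LinearMap.ext h)

theorem IsSmooth.comp_linearMap (hψ : IsSmooth n 𝕜 ψ) (T : F →ₗ[𝕜] F') :
    IsSmooth n 𝕜 fun x ↦ T (ψ x) := fun ℓ ↦ hψ (ℓ ∘ₗ T)

theorem IsSmooth.add (hψ : IsSmooth n 𝕜 ψ) (hφ : IsSmooth n 𝕜 φ) :
    IsSmooth n 𝕜 fun x ↦ ψ x + φ x := fun ℓ ↦ by
  simp only [map_add]
  exact (hψ ℓ).add (hφ ℓ)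

theorem IsSmooth.sum {ι : Type*} (s : Finset ι) {ψ : ι → G → F} (hψ : ∀ i, IsSmooth n 𝕜 (ψ i)) :
    IsSmooth n 𝕜 fun x ↦ ∑ i ∈ s, ψ i x := fun ℓ ↦ by
  simpa only [map_sum] using contMDiff_finsetSum fun i _ ↦ hψ i ℓ

variable [Group G]

theorem leftDerivVec_add_right [FiniteDimensional 𝕜 F] (ψ : G → F) (x : G) (X Y : LieAlg n G) :
    leftDerivVec 𝕜 ψ x (X + Y) = leftDerivVec 𝕜 ψ x X + leftDerivVec 𝕜 ψ x Y := by
  simp only [leftDerivVec, leftDeriv_add_right, add_smul, Finset.sum_add_distrib]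

theorem leftDerivVec_smul_right [FiniteDimensional 𝕜 F] [Module ℝ F] [IsScalarTower ℝ 𝕜 F]
    (ψ : G → F) (x : G) (c : ℝ) (X : LieAlg n G) :
    leftDerivVec 𝕜 ψ x (c • X) = c • leftDerivVec 𝕜 ψ x X := by
  simp only [leftDerivVec, leftDeriv_smul_right, Finset.smul_sum, smul_assoc]

theorem linear_leftDerivVec [FiniteDimensional 𝕜 F] (ℓ : F →ₗ[𝕜] 𝕜) (hψ : IsSmooth n 𝕜 ψ) (x : G)
    (X : LieAlg n G) : ℓ (leftDerivVec 𝕜 ψ x X) = leftDeriv 𝕜 (fun y ↦ ℓ (ψ y)) x X := by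
  let b := Module.finBasis 𝕜 F
  have hcoord (i) : ContMDiff (𝓡 n) 𝓘(ℝ, 𝕜) ∞ fun y ↦ b.coord i (ψ y) := hψ (b.coord i)
  have hℓ (y : G) : ℓ (ψ y) = ∑ i, ℓ (b i) * b.coord i (ψ y) := by
    conv_lhs => rw [← b.sum_repr (ψ y), map_sum]
    simp [mul_comm]
  simp only [hℓ]
  rw [leftDeriv_sum _ fun i _ ↦ contMDiff_fun_mul contMDiff_const (hcoord i), leftDerivVec, map_sum]
  refine Finset.sum_congr rfl fun i _ ↦ ?_
  rw [leftDeriv_const_mul ((hcoord i).mdifferentiable (by simp) x), map_smul, smul_eq_mul, mul_comm]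

theorem linearMap_leftDerivVec [FiniteDimensional 𝕜 F] [FiniteDimensional 𝕜 F'] (T : F →ₗ[𝕜] F')
    (hψ : IsSmooth n 𝕜 ψ) (x : G) (X : LieAlg n G) :
    T (leftDerivVec 𝕜 ψ x X) = leftDerivVec 𝕜 (fun y ↦ T (ψ y)) x X :=
  eq_of_forall_dual_eq (K := 𝕜) fun ℓ ↦ by
    rw [linear_leftDerivVec ℓ (hψ.comp_linearMap T)]
    exact linear_leftDerivVec (ℓ ∘ₗ T) hψ x X

variable [LieGroup (𝓡 n) ∞ G]

theorem IsSmooth.mul_right (hψ : IsSmooth n 𝕜 ψ) (s : G) :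
    IsSmooth n 𝕜 fun x ↦ ψ (x * s) := fun ℓ ↦ (hψ ℓ).comp (contMDiff_mul_right (a := s))

theorem IsSmooth.mul_left (hψ : IsSmooth n 𝕜 ψ) (a : G) :
    IsSmooth n 𝕜 fun x ↦ ψ (a * x) := fun ℓ ↦ (hψ ℓ).comp (contMDiff_mul_left (a := a))

variable [FiniteDimensional 𝕜 F]

theorem isSmooth_leftDerivVec (hψ : IsSmooth n 𝕜 ψ) (X : LieAlg n G) :
    IsSmooth n 𝕜 fun x ↦ leftDerivVec 𝕜 ψ x X := fun ℓ ↦ by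
  simpa only [linear_leftDerivVec ℓ hψ] using contMDiff_leftDeriv (hψ ℓ) X

theorem leftDerivVec_mul_right (hψ : IsSmooth n 𝕜 ψ) (x s : G) (X : LieAlg n G) :
    leftDerivVec 𝕜 (fun y ↦ ψ (y * s)) x X = leftDerivVec 𝕜 ψ (x * s) (Ad n G s⁻¹ X) :=
  eq_of_forall_dual_eq (K := 𝕜) fun ℓ ↦ by
    rw [linear_leftDerivVec ℓ (hψ.mul_right s), linear_leftDerivVec ℓ hψ,
      leftDeriv_mul_right s ((hψ ℓ).mdifferentiable (by simp) _)]

theorem leftDerivVec_mul_left (hψ : IsSmooth n 𝕜 ψ) (a x : G) (X : LieAlg n G) :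
    leftDerivVec 𝕜 (fun y ↦ ψ (a * y)) x X = leftDerivVec 𝕜 ψ (a * x) X :=
  eq_of_forall_dual_eq (K := 𝕜) fun ℓ ↦ by
    rw [linear_leftDerivVec ℓ (hψ.mul_left a), linear_leftDerivVec ℓ hψ,
      leftDeriv_mul_left a ((hψ ℓ).mdifferentiable (by simp) _)]

end VectorCalculus

section Adjoint

variable {n : ℕ} {G : Type*} [TopologicalSpace G] [ChartedSpace (EuclideanSpace ℝ (Fin n)) G]
  [Group G] [LieGroup (𝓡 n) ∞ G] {f : G → ℝ}

theorem contMDiff_leftDeriv_field (hf : ContMDiff (𝓡 n) 𝓘(ℝ, ℝ) ∞ f) {V : G → LieAlg n G}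
    (hV : IsSmooth n ℝ V) : ContMDiff (𝓡 n) 𝓘(ℝ, ℝ) ∞ fun y ↦ leftDeriv ℝ f y (V y) := by
  simp only [leftDeriv_eq_sum (Module.finBasis ℝ (LieAlg n G)) f _ (V _)]
  exact contMDiff_finsetSum fun i _ ↦ contMDiff_fun_mul (hV _) (contMDiff_leftDeriv hf _)

theorem leftDeriv_leftDeriv_field (hf : ContMDiff (𝓡 n) 𝓘(ℝ, ℝ) ∞ f) {V : G → LieAlg n G}
    (hV : IsSmooth n ℝ V) (x : G) (Y : LieAlg n G) :
    leftDeriv ℝ (fun y ↦ leftDeriv ℝ f y (V y)) x Y =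
      leftDeriv ℝ (fun y ↦ leftDeriv ℝ f y (V x)) x Y +
        leftDeriv ℝ f x (leftDerivVec ℝ V x Y) := by
  let b := Module.finBasis ℝ (LieAlg n G)
  have hf_deriv (i) := contMDiff_leftDeriv hf (b i)
  simp only [leftDeriv_eq_sum b f _ (V _), leftDeriv_eq_sum b f x (leftDerivVec ℝ V x Y),
    smul_eq_mul]
  rw [leftDeriv_sum _ fun i _ ↦ contMDiff_fun_mul (hV (b.coord i)) (hf_deriv i),
    leftDeriv_sum _ fun i _ ↦ contMDiff_fun_mul contMDiff_const (hf_deriv i),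
    ← Finset.sum_add_distrib]
  refine Finset.sum_congr rfl fun i _ ↦ ?_
  rw [leftDeriv_mul ((hV (b.coord i)).mdifferentiable (by simp) x)
      ((hf_deriv i).mdifferentiable (by simp) x),
    leftDeriv_const_mul ((hf_deriv i).mdifferentiable (by simp) x),
    linear_leftDerivVec (b.coord i) hV, add_comm]

variable [T2Space G]

theorem isSmooth_Ad (Y : LieAlg n G) : IsSmooth n ℝ fun s : G ↦ Ad n G s Y := by
  intro ℓ
  obtain ⟨f, hf, hfℓ⟩ := exists_contMDiff_leftDeriv_one_eq ℓ
  have hconj : ContMDiff ((𝓡 n).prod (𝓡 n)) 𝓘(ℝ, ℝ) ∞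
      fun p : G × G ↦ f (p.1 * p.2 * p.1⁻¹) :=
    hf.comp ((contMDiff_fst.mul contMDiff_snd).mul contMDiff_fst.inv)
  have hAd (s : G) : ℓ (Ad n G s Y) = mvfderiv (𝓡 n) (fun x ↦ f (s * x * s⁻¹)) 1 Y := by
    rw [← hfℓ, leftDeriv_one]
    exact (mfderiv_comp_apply_of_eq 1 (hf.mdifferentiable (by simp) 1) (conj_mdiff n s 1)
      (by simp) Y).symm
  simp only [hAd]
  exact contMDiff_mvfderiv_snd hconj 1 Y

theorem isSmooth_Ad_inv (Y : LieAlg n G) : IsSmooth n ℝ fun s : G ↦ Ad n G s⁻¹ Y := fun ℓ ↦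
  (isSmooth_Ad Y ℓ).comp (contMDiff_inv (𝓡 n) ∞)

/-- Differentiating `f (t * s)` at `(1, 1)` first in `t` along `X` and then in `s` along `Y` brings
in `Ad s⁻¹ X`; in the other order it does not. -/
theorem leftDerivVec_Ad_inv_one (X Y : LieAlg n G) :
    leftDerivVec ℝ (fun s : G ↦ Ad n G s⁻¹ X) 1 Y = ⁅X, Y⁆ := by
  refine eq_of_forall_dual_eq (K := ℝ) fun ℓ ↦ ?_
  obtain ⟨f, hf, hfℓ⟩ := exists_contMDiff_leftDeriv_one_eq ℓ
  have hfm (x : G) : MDifferentiableAt (𝓡 n) 𝓘(ℝ, ℝ) f x := hf.mdifferentiable (by simp) x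
  have hpartial := mvfderiv_partial_comm (f := fun p : G × G ↦ f (p.1 * p.2))
    (hf.comp (contMDiff_mul (𝓡 n) ∞)) 1 1 X Y
  have hfst (s : G) : mvfderiv (𝓡 n) (fun t ↦ f (t * s)) 1 X = leftDeriv ℝ f s (Ad n G s⁻¹ X) := by
    rw [← leftDeriv_one, leftDeriv_mul_right s (hfm _), one_mul]
  simp only [hfst, ← leftDeriv_eq_mvfderiv_mul_left (hfm _)] at hpartial
  rw [← leftDeriv_one, ← leftDeriv_one,
    leftDeriv_leftDeriv_field hf (isSmooth_Ad_inv X)] at hpartial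
  simp only [inv_one, map_one, Module.End.one_apply] at hpartial
  rw [← hfℓ, ← hfℓ, leftDeriv_lie hf, ← hpartial]
  ring

theorem leftDerivVec_Ad_inv (s : G) (X Y : LieAlg n G) :
    leftDerivVec ℝ (fun s : G ↦ Ad n G s⁻¹ X) s Y = ⁅Ad n G s⁻¹ X, Y⁆ := by
  have h := leftDerivVec_mul_left (isSmooth_Ad_inv X) s 1 Y
  simp only [mul_inv_rev, map_mul, Module.End.mul_apply, mul_one] at h
  rw [← h, leftDerivVec_Ad_inv_one]

end Adjoint

section InnerProduct

variable {V : Type*} [AddCommGroup V] [Module ℝ V] {B : LinearMap.BilinForm ℝ V}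

/-- `B` is an inner product. Two different inner products, `Kil` and `g_⋄`, are used on `𝔪`, so they
are treated as bilinear forms rather than as instances. -/
structure IsInnerProduct (B : LinearMap.BilinForm ℝ V) : Prop where
  symm : ∀ x y, B x y = B y x
  pos : ∀ x, x ≠ 0 → 0 < B x x

/-- The family `b` is orthonormal for the form `B`. -/
def IsOrthonormal {ι : Type*} [DecidableEq ι] (B : LinearMap.BilinForm ℝ V) (b : ι → V) : Prop :=
  ∀ i j, B (b i) (b j) = if i = j then 1 else 0

namespace IsInnerProduct

variable (hB : IsInnerProduct B)
include hB

theorem self_nonneg (x : V) : 0 ≤ B x x := by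
  rcases eq_or_ne x 0 with rfl | hx
  · simp
  · exact (hB.pos x hx).le

theorem self_eq_zero {x : V} : B x x = 0 ↔ x = 0 :=
  ⟨fun h ↦ by_contra fun hx ↦ (hB.pos x hx).ne' h, fun h ↦ by simp [h]⟩

theorem ext {x y : V} (h : ∀ z, B x z = B y z) : x = y :=
  sub_eq_zero.1 <| hB.self_eq_zero.1 <| by rw [map_sub B, LinearMap.sub_apply, h, sub_self]

theorem nondegenerate : B.Nondegenerate :=
  ⟨fun x h ↦ hB.self_eq_zero.1 (h x), fun x h ↦ hB.self_eq_zero.1 (h x)⟩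

variable [FiniteDimensional ℝ V]

theorem exists_orthonormal_eigenbasis {T : Module.End ℝ V} (hT : ∀ x y, B (T x) y = B x (T y)) :
    ∃ (b : Module.Basis (Fin (Module.finrank ℝ V)) ℝ V) (c : Fin (Module.finrank ℝ V) → ℝ),
      IsOrthonormal B b ∧ ∀ i, T (b i) = c i • b i := by
  let core : InnerProductSpace.Core ℝ V :=
    { inner := fun x y ↦ B x y
      conj_inner_symm := fun x y ↦ hB.symm y x
      re_inner_nonneg := hB.self_nonneg
      add_left := fun x y z ↦ by simp
      smul_left := fun x y r ↦ by simp
      definite := fun x ↦ hB.self_eq_zero.1 }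
  let := core.toNormedAddCommGroup
  let := InnerProductSpace.ofCore core.toCore
  have hsym : T.IsSymmetric := hT
  let b := hsym.eigenvectorBasis rfl
  refine ⟨b.toBasis, hsym.eigenvalues rfl, fun i j ↦ ?_, fun i ↦ by simp [b]⟩
  rw [OrthonormalBasis.coe_toBasis]
  exact orthonormal_iff_ite.1 b.orthonormal i j

theorem exists_orthonormal_basis :
    ∃ b : Module.Basis (Fin (Module.finrank ℝ V)) ℝ V, IsOrthonormal B b := by
  obtain ⟨b, -, hb, -⟩ := hB.exists_orthonormal_eigenbasis (T := 0) (by simp)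
  exact ⟨b, hb⟩

end IsInnerProduct

theorem exists_isInnerProduct (V : Type*) [AddCommGroup V] [Module ℝ V] [FiniteDimensional ℝ V] :
    ∃ B : LinearMap.BilinForm ℝ V, IsInnerProduct B := by
  let b := Module.finBasis ℝ V
  refine ⟨∑ i, LinearMap.BilinForm.linMulLin (b.coord i) (b.coord i), fun x y ↦ ?_, fun x hx ↦ ?_⟩
  · simp only [LinearMap.sum_apply, LinearMap.BilinForm.linMulLin_apply, mul_comm]
  · obtain ⟨i, hi⟩ : ∃ i, b.coord i x ≠ 0 := by
      by_contra! h
      exact hx (b.repr.map_eq_zero_iff.1 (Finsupp.ext h))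
    simp only [LinearMap.sum_apply, LinearMap.BilinForm.linMulLin_apply]
    exact Finset.sum_pos' (fun j _ ↦ mul_self_nonneg _) ⟨i, Finset.mem_univ i, mul_self_pos.2 hi⟩

namespace IsOrthonormal

variable {ι : Type*} [DecidableEq ι] {b : Module.Basis ι ℝ V} (hb : IsOrthonormal B b)
include hb

theorem form_basis_left (i : ι) (x : V) : B (b i) x = b.repr x i := by
  have hcoord : B (b i) = b.coord i := b.ext fun j ↦ by
    simp [hb i j, Finsupp.single_apply, eq_comm]
  rw [hcoord, b.coord_apply]

variable [Fintype ι]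

theorem trace_eq_sum (T : Module.End ℝ V) : LinearMap.trace ℝ V T = ∑ i, B (b i) (T (b i)) := by
  rw [LinearMap.trace_eq_matrix_trace ℝ b, Matrix.trace]
  exact Finset.sum_congr rfl fun i _ ↦ by
    rw [Matrix.diag_apply, LinearMap.toMatrix_apply, hb.form_basis_left]

theorem form_apply_of_eigenbasis {T : Module.End ℝ V} {c : ι → ℝ} (hT : ∀ i, T (b i) = c i • b i)
    (x y : V) : B (T x) y = ∑ i, c i * (b.repr x i * b.repr y i) := by
  conv_lhs => rw [← b.sum_repr x]
  simp only [map_sum, map_smul, hT, LinearMap.sum_apply, LinearMap.smul_apply, smul_eq_mul,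
    hb.form_basis_left, mul_left_comm]

end IsOrthonormal

theorem IsOrthonormal.sum_apply_dualBasis {V S ι κ : Type*} [AddCommGroup V] [Module ℝ V]
    [AddCommGroup S] [Module ℝ S] [Fintype ι] [DecidableEq ι] [Fintype κ] [DecidableEq κ]
    {B : LinearMap.BilinForm ℝ V} {e : Module.Basis κ ℝ V} (he : IsOrthonormal B e)
    [FiniteDimensional ℝ V] (hB : B.Nondegenerate) (b : Module.Basis ι ℝ V)
    (Φ : V →ₗ[ℝ] V →ₗ[ℝ] S) :
    ∑ i, Φ (b i) (B.dualBasis hB b i) = ∑ j, Φ (e j) (e j) := by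
  have hb (i) : b i = ∑ j, B (e j) (b i) • e j := by
    simp only [he.form_basis_left, e.sum_repr]
  have he' (j) : e j = ∑ i, B (e j) (b i) • B.dualBasis hB b i := by
    conv_lhs => rw [← (B.dualBasis hB b).sum_repr (e j)]
    simp only [LinearMap.BilinForm.dualBasis_repr_apply]
  calc ∑ i, Φ (b i) (B.dualBasis hB b i)
      = ∑ i, ∑ j, B (e j) (b i) • Φ (e j) (B.dualBasis hB b i) := by
        refine Finset.sum_congr rfl fun i _ ↦ ?_
        conv_lhs => rw [hb i]
        simp only [map_sum, map_smul, LinearMap.sum_apply, LinearMap.smul_apply]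
    _ = ∑ j, ∑ i, B (e j) (b i) • Φ (e j) (B.dualBasis hB b i) := Finset.sum_comm
    _ = ∑ j, Φ (e j) (e j) := by
        refine Finset.sum_congr rfl fun j _ ↦ ?_
        have hj := congrArg (Φ (e j)) (he' j)
        simpa only [map_sum, map_smul] using hj.symm

section Trace

variable [FiniteDimensional ℝ V] (hB : IsInnerProduct B) {T : Module.End ℝ V}
include hB

theorem trace_eq_zero_of_form_apply_self (hT : ∀ x, B x (T x) = 0) : LinearMap.trace ℝ V T = 0 := by
  obtain ⟨b, hb⟩ := hB.exists_orthonormal_basis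
  rw [hb.trace_eq_sum]
  exact Finset.sum_eq_zero fun i _ ↦ hT _

theorem trace_mul_self_neg_of_skew (hT : ∀ x y, B (T x) y = -B x (T y)) (hT0 : T ≠ 0) :
    LinearMap.trace ℝ V (T * T) < 0 := by
  obtain ⟨b, hb⟩ := hB.exists_orthonormal_basis
  obtain ⟨i, hi⟩ : ∃ i, T (b i) ≠ 0 := by
    by_contra! h
    exact hT0 (b.ext h)
  have htrace : LinearMap.trace ℝ V (T * T) = -∑ i, B (T (b i)) (T (b i)) := by
    simp only [hb.trace_eq_sum, hT, Finset.sum_neg_distrib, neg_neg, Module.End.mul_apply]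
  rw [htrace, neg_lt_zero]
  exact Finset.sum_pos' (fun j _ ↦ hB.self_nonneg _) ⟨i, Finset.mem_univ i, hB.pos _ hi⟩

end Trace

section SquareRoot

theorem exists_aeval_apply_basis {K E ι : Type*} [Field K] [AddCommGroup E] [Module K E] [Finite ι]
    (b : Module.Basis ι K E) {T : Module.End K E} {c : ι → K} (hT : ∀ i, T (b i) = c i • b i)
    (f : K → K) : ∃ p : Polynomial K, ∀ i, Polynomial.aeval T p (b i) = f (c i) • b i := by
  classical
  cases nonempty_fintype ι
  refine ⟨Lagrange.interpolate (Finset.univ.image c) id f, fun i ↦ ?_⟩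
  have heval := Lagrange.eval_interpolate_at_node (v := id) f Function.injective_id.injOn
    (Finset.mem_image_of_mem c (Finset.mem_univ i))
  rw [Module.End.aeval_apply_of_hasEigenvector
    ⟨Module.End.mem_eigenspace_iff.2 (hT i), b.ne_zero i⟩]
  exact congrArg (· • b i) heval

theorem exists_posDef_sqrt [FiniteDimensional ℝ V] (hB : IsInnerProduct B) {A : Module.End ℝ V}
    (hA : ∀ x y, B (A x) y = B x (A y)) (hA_pos : ∀ x, x ≠ 0 → 0 < B (A x) x) :
    ∃ P : Module.End ℝ V, (∀ x y, B (P x) y = B x (P y)) ∧ (∀ x, x ≠ 0 → 0 < B (P x) x) ∧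
      P * P = A ∧ ∀ S, Commute S A → Commute S P := by
  obtain ⟨b, c, hb, hc⟩ := hB.exists_orthonormal_eigenbasis hA
  have hc_pos (i) : 0 < c i := by
    simpa [hc, hb i i] using hA_pos (b i) (b.ne_zero i)
  obtain ⟨p, hp⟩ := exists_aeval_apply_basis b hc Real.sqrt
  have hform := hb.form_apply_of_eigenbasis hp
  refine ⟨Polynomial.aeval A p, fun x y ↦ ?_, fun x hx ↦ ?_, b.ext fun i ↦ ?_,
    fun S hS ↦ Algebra.commute_of_mem_adjoin_singleton_of_commute
      (Polynomial.aeval_mem_adjoin_singleton ℝ A) hS⟩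
  · rw [hB.symm x, hform, hform]
    simp only [mul_comm]
  · obtain ⟨i, hi⟩ : ∃ i, b.repr x i ≠ 0 := by
      by_contra! h
      exact hx (b.repr.map_eq_zero_iff.1 (Finsupp.ext h))
    rw [hform]
    exact Finset.sum_pos' (fun j _ ↦ mul_nonneg (Real.sqrt_nonneg _) (mul_self_nonneg _))
      ⟨i, Finset.mem_univ i, mul_pos (Real.sqrt_pos.2 (hc_pos i)) (mul_self_pos.2 hi)⟩
  · rw [Module.End.mul_apply, hp, map_smul, hp, smul_smul, Real.mul_self_sqrt (hc_pos i).le, hc]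

theorem eq_of_mul_self_eq_of_commute {P Q : Module.End ℝ V} (hP : ∀ x, 0 ≤ B (P x) x)
    (hQ : ∀ x, x ≠ 0 → 0 < B (Q x) x) (hPQ : Commute P Q) (h : P * P = Q * Q) : P = Q := by
  ext x
  by_contra hne
  have hfactor : Q * (P - Q) = -(P * (P - Q)) := by
    rw [mul_sub, mul_sub, h, hPQ.eq]
    abel
  have hQ_pos := hQ _ (sub_ne_zero.2 hne)
  have hP_nonneg := hP (P x - Q x)
  have := LinearMap.congr_fun hfactor x
  simp only [Module.End.mul_apply, LinearMap.sub_apply, LinearMap.neg_apply] at this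
  rw [this, map_neg, LinearMap.neg_apply] at hQ_pos
  linarith

end SquareRoot

theorem injective_of_posDef {Q : Module.End ℝ V} (hQ : ∀ x, x ≠ 0 → 0 < B (Q x) x) :
    Function.Injective Q :=
  (injective_iff_map_eq_zero Q).2 fun x hx ↦ by_contra fun hne ↦ by simpa [hx] using hQ x hne

/-- The polar decomposition `Γ = P J`, with `P` self-adjoint and positive and `J` orthogonal. -/
structure IsPolar (B : LinearMap.BilinForm ℝ V) (Γ P J : Module.End ℝ V) : Prop where
  symm : ∀ x y, B (P x) y = B x (P y)
  nonneg : ∀ x, 0 ≤ B (P x) x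
  orth : ∀ x y, B (J x) (J y) = B x y
  eq : Γ = P * J

section Polar

variable [FiniteDimensional ℝ V] {Γ P J : Module.End ℝ V} (hB : IsInnerProduct B)
  (hΓ : ∀ x y, B (Γ x) y = -B x (Γ y))

include hB hΓ in
theorem exists_posDef_sqrt_neg_mul_self (hΓ_inj : Function.Injective Γ) :
    ∃ P : Module.End ℝ V, (∀ x y, B (P x) y = B x (P y)) ∧ (∀ x, x ≠ 0 → 0 < B (P x) x) ∧
      P * P = -(Γ * Γ) ∧ ∀ S, Commute S (Γ * Γ) → Commute S P := by
  have hform (x y) : B ((-(Γ * Γ)) x) y = B (Γ x) (Γ y) := by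
    rw [LinearMap.neg_apply, Module.End.mul_apply, map_neg, LinearMap.neg_apply, hΓ, neg_neg]
  obtain ⟨P, hP_symm, hP_pos, hP_sq, hP_comm⟩ := exists_posDef_sqrt hB (A := -(Γ * Γ))
    (fun x y ↦ by rw [hB.symm x, hform, hform, hB.symm])
    fun x hx ↦ by
      rw [hform]
      exact hB.pos _ ((map_ne_zero_iff Γ hΓ_inj).2 hx)
  exact ⟨P, hP_symm, hP_pos, hP_sq, fun S hS ↦ hP_comm S hS.neg_right⟩

namespace IsPolar

variable (h : IsPolar B Γ P J)
include h hB hΓ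

theorem mul_self : P * P = -(Γ * Γ) := by
  have hJ_surj : Function.Surjective J := LinearMap.injective_iff_surjective.1 <|
    (injective_iff_map_eq_zero J).2 fun x hx ↦
      hB.self_eq_zero.1 (by rw [← h.orth, hx, map_zero])
  have hP : P = -(J * Γ) := LinearMap.ext fun x ↦ hB.ext fun z ↦ by
    obtain ⟨y, rfl⟩ := hJ_surj z
    have hΓy : P (J y) = Γ y := (LinearMap.congr_fun h.eq y).symm
    rw [h.symm, hΓy, LinearMap.neg_apply, map_neg, LinearMap.neg_apply, Module.End.mul_apply,
      h.orth, hΓ, neg_neg]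
  calc P * P = P * -(J * Γ) := congrArg (P * ·) hP
    _ = -(P * J * Γ) := by rw [mul_neg, mul_assoc]
    _ = -(Γ * Γ) := by rw [← h.eq]

theorem apply_eq_smul {c : ℝ} (hc : 0 < c) {v : V} (hv : Γ (Γ v) = -(c ^ 2) • v) :
    P v = c • v := by
  have hPPv : P (P v) = c ^ 2 • v := by
    rw [← Module.End.mul_apply, h.mul_self hB hΓ, LinearMap.neg_apply, Module.End.mul_apply, hv,
      neg_smul, neg_neg]
  have hPw : P (P v - c • v) = -c • (P v - c • v) := by
    rw [map_sub, map_smul, hPPv]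
    module
  have hnonneg := h.nonneg (P v - c • v)
  rw [hPw, map_smul, LinearMap.smul_apply, smul_eq_mul] at hnonneg
  exact sub_eq_zero.1 <| hB.self_eq_zero.1 <|
    le_antisymm (by nlinarith) (hB.self_nonneg _)

variable (hΓ_inj : Function.Injective Γ)
include hΓ_inj

theorem pos_and_commute :
    (∀ x, x ≠ 0 → 0 < B (P x) x) ∧ ∀ S, Commute S (Γ * Γ) → Commute S P := by
  obtain ⟨Q, -, hQ_pos, hQ_sq, hQ_comm⟩ := exists_posDef_sqrt_neg_mul_self hB hΓ hΓ_inj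
  have hP_sq := h.mul_self hB hΓ
  have hPQ : Commute P Q := hQ_comm P <| by
    rw [← neg_neg (Γ * Γ), ← hP_sq]
    exact ((Commute.refl P).mul_right (Commute.refl P)).neg_right
  obtain rfl := eq_of_mul_self_eq_of_commute h.nonneg hQ_pos hPQ (hP_sq.trans hQ_sq.symm)
  exact ⟨hQ_pos, hQ_comm⟩

theorem injective : Function.Injective P := injective_of_posDef (h.pos_and_commute hB hΓ hΓ_inj).1

theorem commute_of_commute {S : Module.End ℝ V} (hS : Commute S Γ) : Commute S J := by
  have hSP : Commute S P := (h.pos_and_commute hB hΓ hΓ_inj).2 S (hS.mul_right hS)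
  ext x
  apply h.injective hB hΓ hΓ_inj
  refine LinearMap.congr_fun (?_ : P * (S * J) = P * (J * S)) x
  rw [← mul_assoc, ← mul_assoc, ← hSP.eq, mul_assoc, ← h.eq, hS.eq]

theorem commute : Commute P J := by
  have hΓJ : Commute Γ J := h.commute_of_commute hB hΓ hΓ_inj (Commute.refl Γ)
  exact ((h.pos_and_commute hB hΓ hΓ_inj).2 J (hΓJ.mul_left hΓJ).symm).symm

theorem apply_eq_smul_J {c : ℝ} {v : V} (hv : P v = c • v) : Γ v = c • J v :=
  calc Γ v = (P * J) v := LinearMap.congr_fun h.eq v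
    _ = J (P v) := LinearMap.congr_fun (h.commute hB hΓ hΓ_inj).eq v
    _ = c • J v := by rw [hv, map_smul]

theorem J_mul_self : J * J = -1 := by
  have hPJ := h.commute hB hΓ hΓ_inj
  ext x
  apply h.injective hB hΓ hΓ_inj
  apply h.injective hB hΓ hΓ_inj
  refine LinearMap.congr_fun (?_ : P * (P * (J * J)) = P * (P * -1)) x
  calc P * (P * (J * J)) = P * J * (P * J) := by
        rw [hPJ.symm.mul_mul_mul_comm, mul_assoc]
    _ = P * (P * -1) := by
        rw [← h.eq, ← mul_assoc, h.mul_self hB hΓ, mul_neg_one, neg_neg]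

theorem unique {P' J' : Module.End ℝ V} (h' : IsPolar B Γ P' J') : P' = P ∧ J' = J := by
  obtain ⟨hP_pos, hP_comm⟩ := h.pos_and_commute hB hΓ hΓ_inj
  have hsq : P' * P' = P * P := (h'.mul_self hB hΓ).trans (h.mul_self hB hΓ).symm
  have hP'P : Commute P' P := hP_comm P' <| by
    rw [← neg_neg (Γ * Γ), ← h'.mul_self hB hΓ]
    exact ((Commute.refl P').mul_right (Commute.refl P')).neg_right
  obtain rfl := eq_of_mul_self_eq_of_commute h'.nonneg hP_pos hP'P hsq
  exact ⟨rfl, LinearMap.ext fun x ↦ h.injective hB hΓ hΓ_inj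
    (LinearMap.congr_fun (h'.eq.symm.trans h.eq) x)⟩

end IsPolar

include hB hΓ in
theorem exists_isPolar (hΓ_inj : Function.Injective Γ) : ∃ P J, IsPolar B Γ P J := by
  obtain ⟨P, hP_symm, hP_pos, hP_sq, hP_comm⟩ := exists_posDef_sqrt_neg_mul_self hB hΓ hΓ_inj
  let e : V ≃ₗ[ℝ] V := LinearEquiv.ofInjectiveEndo P (injective_of_posDef hP_pos)
  have hΓP : Commute Γ P := hP_comm Γ ((Commute.refl Γ).mul_right (Commute.refl Γ))
  have hPe (x) : P (e.symm x) = x := e.apply_symm_apply x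
  have heΓ (x) : e.symm (Γ x) = Γ (e.symm x) := by
    rw [e.symm_apply_eq]
    exact ((LinearMap.congr_fun hΓP.eq _).symm.trans (congrArg Γ (hPe x))).symm
  refine ⟨P, e.symm * Γ, hP_symm, fun x ↦ ?_, fun x y ↦ ?_, LinearMap.ext fun x ↦ (hPe _).symm⟩
  · rcases eq_or_ne x 0 with rfl | hx
    · simp
    · exact (hP_pos x hx).le
  · have hΓΓ : ∀ z, Γ (Γ z) = -P (P z) := fun z ↦ by
      rw [← Module.End.mul_apply P, hP_sq, LinearMap.neg_apply, neg_neg, Module.End.mul_apply]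
    change B (e.symm (Γ x)) (e.symm (Γ y)) = B x y
    rw [heΓ, heΓ, hΓ, hΓΓ, map_neg, neg_neg, hPe, ← hP_symm, hPe]

end Polar

end InnerProduct

section SesquilinearCalculus

variable {n : ℕ} {G : Type*} [TopologicalSpace G] [ChartedSpace (EuclideanSpace ℝ (Fin n)) G]
  {𝕜 : Type*} [RCLike 𝕜] {σ : 𝕜 →+* 𝕜} {F F' : Type*} [AddCommGroup F] [AddCommGroup F']
  [Module 𝕜 F] [Module 𝕜 F'] (S : F →ₛₗ[σ] F' →ₗ[𝕜] 𝕜) {ψ : G → F} {φ : G → F'}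

theorem sesq_eq_sum {ι : Type*} [Fintype ι] (b : Module.Basis ι 𝕜 F) (v : F) (w : F') :
    S v w = ∑ i, σ (b.coord i v) * S (b i) w := by
  conv_lhs => rw [← b.sum_repr v]
  simp only [map_sum, map_smulₛₗ, LinearMap.sum_apply, LinearMap.smul_apply, smul_eq_mul,
    b.coord_apply]

variable [FiniteDimensional 𝕜 F]

theorem contMDiff_sesq (hσ : Continuous σ) (hψ : IsSmooth n 𝕜 ψ) (hφ : IsSmooth n 𝕜 φ) :
    ContMDiff (𝓡 n) 𝓘(ℝ, 𝕜) ∞ fun y ↦ S (ψ y) (φ y) := by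
  let b := Module.finBasis 𝕜 F
  let σL : 𝕜 →L[ℝ] 𝕜 := σ.toAddMonoidHom.toRealLinearMap hσ
  rw [funext fun y ↦ sesq_eq_sum S b (ψ y) (φ y)]
  exact contMDiff_finsetSum fun i _ ↦
    contMDiff_fun_mul (σL.contMDiff.comp (hψ (b.coord i))) (hφ (S (b i)))

theorem leftDeriv_sesq [FiniteDimensional 𝕜 F'] [Group G] (hσ : Continuous σ)
    (hψ : IsSmooth n 𝕜 ψ) (hφ : IsSmooth n 𝕜 φ) (x : G) (X : LieAlg n G) :
    leftDeriv 𝕜 (fun y ↦ S (ψ y) (φ y)) x X =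
      S (leftDerivVec 𝕜 ψ x X) (φ x) + S (ψ x) (leftDerivVec 𝕜 φ x X) := by
  let b := Module.finBasis 𝕜 F
  let σL : 𝕜 →L[ℝ] 𝕜 := σ.toAddMonoidHom.toRealLinearMap hσ
  have hcoord (i) : ContMDiff (𝓡 n) 𝓘(ℝ, 𝕜) ∞ fun y ↦ σ (b.coord i (ψ y)) :=
    σL.contMDiff.comp (hψ (b.coord i))
  have hleft (i) : leftDeriv 𝕜 (fun y ↦ σ (b.coord i (ψ y))) x X =
      σ (b.coord i (leftDerivVec 𝕜 ψ x X)) := by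
    rw [linear_leftDerivVec (b.coord i) hψ]
    exact leftDeriv_clm_comp σL ((hψ (b.coord i)).mdifferentiable (by simp) x) X
  rw [funext fun y ↦ sesq_eq_sum S b (ψ y) (φ y), sesq_eq_sum S b _ (φ x),
    sesq_eq_sum S b (ψ x), leftDeriv_sum _ fun i _ ↦ contMDiff_fun_mul (hcoord i) (hφ (S (b i))),
    ← Finset.sum_add_distrib]
  refine Finset.sum_congr rfl fun i _ ↦ ?_
  rw [leftDeriv_mul ((hcoord i).mdifferentiable (by simp) x)
    ((hφ (S (b i))).mdifferentiable (by simp) x), hleft, linear_leftDerivVec (S (b i)) hφ]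

end SesquilinearCalculus

section Killing

variable {n : ℕ} {G : Type*} [TopologicalSpace G] [ChartedSpace (EuclideanSpace ℝ (Fin n)) G]
  [Group G] [LieGroup (𝓡 n) ∞ G]

theorem Kil_symm (X Y : LieAlg n G) : Kil n G X Y = Kil n G Y X :=
  congrArg Neg.neg (LieModule.traceForm_comm ℝ _ _ X Y)

theorem Kil_lie_left (X Y Z : LieAlg n G) : Kil n G ⁅X, Y⁆ Z = -Kil n G Y ⁅X, Z⁆ :=
  congrArg Neg.neg (LieModule.traceForm_apply_lie_apply' ℝ (LieAlg n G) (LieAlg n G) X Y Z)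

section AveragedForm

open MeasureTheory

variable [T2Space G]

theorem continuous_form_Ad_inv (B : LinearMap.BilinForm ℝ (LieAlg n G)) (X Y : LieAlg n G) :
    Continuous fun s : G ↦ B (Ad n G s⁻¹ X) (Ad n G s⁻¹ Y) :=
  (contMDiff_sesq B continuous_id (isSmooth_Ad_inv X) (isSmooth_Ad_inv Y)).continuous

variable [CompactSpace G] [MeasurableSpace G] [BorelSpace G]
  (B : LinearMap.BilinForm ℝ (LieAlg n G)) (ν : Measure G) [ν.IsHaarMeasure]

theorem integrable_form_Ad_inv (X Y : LieAlg n G) :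
    Integrable (fun s : G ↦ B (Ad n G s⁻¹ X) (Ad n G s⁻¹ Y)) ν :=
  (continuous_form_Ad_inv B X Y).integrable_of_hasCompactSupport
    (HasCompactSupport.of_compactSpace _)

/-- The average of the form `B` over the adjoint action of a compact group. -/
def averagedForm : LinearMap.BilinForm ℝ (LieAlg n G) :=
  LinearMap.mk₂ ℝ (fun X Y ↦ ∫ s : G, B (Ad n G s⁻¹ X) (Ad n G s⁻¹ Y) ∂ν)
    (fun X X' Y ↦ by
      simp only [map_add, LinearMap.add_apply]
      exact integral_add (integrable_form_Ad_inv B ν X Y) (integrable_form_Ad_inv B ν X' Y))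
    (fun c X Y ↦ by
      simp only [map_smul, LinearMap.smul_apply]
      exact integral_smul c _)
    (fun X Y Y' ↦ by
      simp only [map_add]
      exact integral_add (integrable_form_Ad_inv B ν X Y) (integrable_form_Ad_inv B ν X Y'))
    (fun c X Y ↦ by
      simp only [map_smul]
      exact integral_smul c _)

theorem averagedForm_apply (X Y : LieAlg n G) :
    averagedForm B ν X Y = ∫ s : G, B (Ad n G s⁻¹ X) (Ad n G s⁻¹ Y) ∂ν := rfl

theorem isInnerProduct_averagedForm {B : LinearMap.BilinForm ℝ (LieAlg n G)}
    (hB : IsInnerProduct B) : IsInnerProduct (averagedForm B ν) where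
  symm X Y := by simp only [averagedForm_apply, fun s : G ↦ hB.symm (Ad n G s⁻¹ X)]
  pos X hX := (continuous_form_Ad_inv B X X).integral_pos_of_hasCompactSupport_nonneg_nonzero
    (HasCompactSupport.of_compactSpace _) (fun _ ↦ hB.self_nonneg _) (x := 1) <| by
      simpa [hB.self_eq_zero] using hX

theorem averagedForm_Ad_inv (t : G) (X Y : LieAlg n G) :
    averagedForm B ν (Ad n G t⁻¹ X) (Ad n G t⁻¹ Y) = averagedForm B ν X Y := by
  have : IsTopologicalGroup G := topologicalGroup_of_lieGroup (𝓡 n) ∞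
  rw [averagedForm_apply, averagedForm_apply,
    ← integral_mul_left_eq_self (fun s : G ↦ B (Ad n G s⁻¹ X) (Ad n G s⁻¹ Y)) t]
  simp only [mul_inv_rev, map_mul, Module.End.mul_apply]

theorem averagedForm_lie_left (X Y Z : LieAlg n G) :
    averagedForm B ν ⁅X, Y⁆ Z = -averagedForm B ν Y ⁅X, Z⁆ := by
  have h := leftDeriv_sesq (averagedForm B ν) continuous_id (isSmooth_Ad_inv Y)
    (isSmooth_Ad_inv Z) (1 : G) X
  simp only [averagedForm_Ad_inv, leftDeriv_const, leftDerivVec_Ad_inv_one, inv_one, map_one,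
    Module.End.one_apply] at h
  rw [← lie_skew X Y, ← lie_skew X Z, map_neg, map_neg, LinearMap.neg_apply, neg_neg]
  linarith

end AveragedForm

theorem isInnerProduct_Kil [T2Space G] [CompactSpace G]
    [LieAlgebra.IsSemisimple ℝ (LieAlg n G)] : IsInnerProduct (Kil n G) where
  symm := Kil_symm
  pos X hX := by
    have : IsTopologicalGroup G := topologicalGroup_of_lieGroup (𝓡 n) ∞
    borelize G
    obtain ⟨B, hB⟩ := exists_isInnerProduct (LieAlg n G)
    let ν : MeasureTheory.Measure G := MeasureTheory.Measure.haar
    have had : LieAlgebra.ad ℝ (LieAlg n G) X ≠ 0 := fun h ↦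
      hX ((LieModule.toEnd_eq_zero_iff (R := ℝ) (L := LieAlg n G) (M := LieAlg n G)).1 h)
    exact neg_pos.2 <| trace_mul_self_neg_of_skew (isInnerProduct_averagedForm ν hB)
      (averagedForm_lie_left B ν X) had

end Killing

section Stabilizer

variable {n : ℕ} {G : Type*} [TopologicalSpace G] [ChartedSpace (EuclideanSpace ℝ (Fin n)) G]
  [Group G] [LieGroup (𝓡 n) ∞ G]

theorem exists_local_oneParameter (X : LieAlg n G) :
    ∃ ε > 0, ∃ γ : ℝ → G, γ 0 = 1 ∧ ∀ t ∈ Metric.ball (0 : ℝ) ε, HasMFDerivAt 𝓘(ℝ, ℝ) (𝓡 n) γ t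
      ((1 : ℝ →L[ℝ] ℝ).smulRight (mulInvariantVectorField X (γ t))) := by
  have hsmooth := (contMDiffAt_mulInvariantVectorField X (g := 1)).of_le (m := 1) <| by
    rw [minSmoothness_of_isRCLikeNormedField]
    exact one_le_two
  obtain ⟨γ, hγ_zero, hγ⟩ := exists_isMIntegralCurveAt_of_contMDiffAt_boundaryless (I := 𝓡 n) 0
    hsmooth
  obtain ⟨ε, hε, hball⟩ := Metric.eventually_nhds_iff_ball.1 hγ
  exact ⟨ε, hε, γ, hγ_zero, hball⟩

variable {μ : Module.Dual ℝ (LieAlg n G)}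

theorem mem_stab_iff {s : G} : s ∈ stab μ ↔ ∀ Y : LieAlg n G, μ (Ad n G s⁻¹ Y) = μ Y :=
  LinearMap.ext_iff

theorem apply_Ad_of_mem_stab {s : G} (hs : s ∈ stab μ) (Y : LieAlg n G) :
    μ (Ad n G s Y) = μ Y := by
  simpa only [inv_inv] using mem_stab_iff.1 (inv_mem hs) Y

variable [T2Space G]

theorem leftDeriv_apply_Ad_inv (s : G) (X Y : LieAlg n G) :
    leftDeriv ℝ (fun s ↦ μ (Ad n G s⁻¹ Y)) s X = μ ⁅Ad n G s⁻¹ Y, X⁆ := by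
  rw [← linear_leftDerivVec μ (isSmooth_Ad_inv Y), leftDerivVec_Ad_inv]

theorem apply_lie_of_mem_kLie {X : LieAlg n G} (hX : X ∈ kLie μ) (Y : LieAlg n G) :
    μ ⁅X, Y⁆ = 0 := by
  obtain ⟨γ, hγ_zero, hγ_mem, hγ, hγX⟩ := hX
  have hderiv := hasDerivAt_leftDeriv (x := 1)
    ((isSmooth_Ad_inv Y μ).mdifferentiable (by simp) _) hγ_zero hγ hγX
  have hconst : (fun t ↦ μ (Ad n G (1 * γ t)⁻¹ Y)) = fun _ ↦ μ Y := funext fun t ↦ by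
    rw [one_mul]
    exact mem_stab_iff.1 (hγ_mem t) Y
  rw [hconst] at hderiv
  have hzero := hderiv.unique (hasDerivAt_const _ _)
  rw [leftDeriv_apply_Ad_inv, inv_one, map_one, Module.End.one_apply] at hzero
  rw [← lie_skew, map_neg, hzero, neg_zero]

theorem mem_stab_of_hasMFDerivAt {X : LieAlg n G} (hX : ∀ Y : LieAlg n G, μ ⁅X, Y⁆ = 0) {ε : ℝ}
    {γ : ℝ → G} (hγ_zero : γ 0 = 1) (hγ : ∀ t ∈ Metric.ball (0 : ℝ) ε,
      HasMFDerivAt 𝓘(ℝ, ℝ) (𝓡 n) γ t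
        ((1 : ℝ →L[ℝ] ℝ).smulRight (mulInvariantVectorField X (γ t))))
    {t : ℝ} (ht : t ∈ Metric.ball (0 : ℝ) ε) : γ t ∈ stab μ := by
  refine mem_stab_iff.2 fun Y ↦ ?_
  have hderiv : ∀ u ∈ Metric.ball (0 : ℝ) ε,
      HasDerivAt (fun u ↦ μ (Ad n G (γ u)⁻¹ Y)) 0 u := fun u hu ↦ by
    have h := hasDerivAt_comp_of_hasMFDerivAt
      ((isSmooth_Ad_inv Y μ).mdifferentiable (by simp) _) (hγ u hu)
    rwa [leftDeriv_apply_Ad_inv, ← lie_skew, map_neg, hX, neg_zero] at h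
  have hconst := (convex_ball (0 : ℝ) ε).norm_image_sub_le_of_norm_hasDerivWithin_le (C := 0)
    (fun u hu ↦ (hderiv u hu).hasDerivWithinAt) (fun _ _ ↦ norm_zero.le)
    (Metric.mem_ball_self (Metric.pos_of_mem_ball ht)) ht
  rw [zero_mul, norm_le_zero_iff, sub_eq_zero] at hconst
  simpa [hγ_zero] using hconst

theorem mem_kLie_iff {X : LieAlg n G} :
    X ∈ kLie μ ↔ ∀ Y : LieAlg n G, μ ⁅X, Y⁆ = 0 := by
  classical
  refine ⟨apply_lie_of_mem_kLie, fun hX ↦ ?_⟩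
  obtain ⟨ε, hε, γ, hγ_zero, hγ⟩ := exists_local_oneParameter X
  -- Only a local one-parameter group is at hand, so it is cut off to a curve on all of `ℝ`.
  let δ : ℝ → G := fun t ↦ if t ∈ Metric.ball (0 : ℝ) ε then γ t else 1
  have hδγ : δ =ᶠ[nhds 0] γ := by
    filter_upwards [Metric.ball_mem_nhds 0 hε] with t ht using if_pos ht
  have hδ := (hγ 0 (Metric.mem_ball_self hε)).congr_of_eventuallyEq hδγ
  refine ⟨δ, hδγ.eq_of_nhds.trans hγ_zero, fun t ↦ ?_, hδ.mdifferentiableAt, ?_⟩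
  · by_cases ht : t ∈ Metric.ball (0 : ℝ) ε
    · rw [show δ t = γ t from if_pos ht]
      exact mem_stab_of_hasMFDerivAt hX hγ_zero hγ ht
    · rw [show δ t = 1 from if_neg ht]
      exact one_mem _
  · have hvelocity : ∀ y : G, y = 1 →
        (mulInvariantVectorField X y : EuclideanSpace ℝ (Fin n)) = X := by
      rintro y rfl
      exact mulInvariantVectorField_one X
    rw [velocity, hδ.mfderiv]
    exact (one_smul ℝ _).trans (hvelocity _ hγ_zero)

end Stabilizer

section AdjointAction

variable {n : ℕ} {G : Type*} [TopologicalSpace G] [ChartedSpace (EuclideanSpace ℝ (Fin n)) G]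
  [Group G] [LieGroup (𝓡 n) ∞ G] {μ : Module.Dual ℝ (LieAlg n G)}

theorem AdM_coe (s : stab μ) (X : mSub μ) : (AdM μ s X : LieAlg n G) = Ad n G s X := rfl

theorem AdM_inv_apply (s : stab μ) (X : mSub μ) : AdM μ s (AdM μ s⁻¹ X) = X :=
  Subtype.ext (Representation.self_inv_apply (Ad n G) (s : G) (X : LieAlg n G))

theorem omega_AdM (s : stab μ) (X Y : mSub μ) :
    omega μ (AdM μ s X) (AdM μ s Y) = omega μ X Y :=
  (congrArg μ (AdCLM_lie (s : G) _ _).symm).trans (apply_Ad_of_mem_stab s.2 _)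

variable (μ) in
/-- The restriction of `Kil` to `𝔪`. -/
def KilM : LinearMap.BilinForm ℝ (mSub μ) := (Kil n G).restrict (mSub μ)

theorem KilM_apply (X Y : mSub μ) : KilM μ X Y = Kil n G X Y := rfl

theorem KilM_AdM (s : stab μ) (X Y : mSub μ) :
    KilM μ (AdM μ s X) (AdM μ s Y) = KilM μ X Y := Kil_Ad (s : G) (X : LieAlg n G) Y

end AdjointAction

section Orbit

variable {n : ℕ} {G : Type*} [TopologicalSpace G] [ChartedSpace (EuclideanSpace ℝ (Fin n)) G]
  [Group G] [LieGroup (𝓡 n) ∞ G] [T2Space G] [CompactSpace G]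
  [LieAlgebra.IsSemisimple ℝ (LieAlg n G)] {μ : Module.Dual ℝ (LieAlg n G)}

/-- The element of `𝔤` representing the functional `μ` through the form `Kil`. -/
def dualVec (μ : Module.Dual ℝ (LieAlg n G)) : LieAlg n G :=
  (LinearMap.BilinForm.toDual (Kil n G) isInnerProduct_Kil.nondegenerate).symm μ

theorem Kil_dualVec (μ : Module.Dual ℝ (LieAlg n G)) (X : LieAlg n G) :
    Kil n G (dualVec μ) X = μ X :=
  LinearMap.BilinForm.apply_toDual_symm_apply (hB := isInnerProduct_Kil.nondegenerate) μ X

theorem apply_lie_eq_Kil (X Y : LieAlg n G) : μ ⁅X, Y⁆ = Kil n G ⁅dualVec μ, X⁆ Y := by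
  rw [← lie_skew (dualVec μ) X, map_neg (Kil n G), LinearMap.neg_apply, Kil_lie_left, neg_neg,
    Kil_dualVec]

theorem mem_kLie_iff_lie_eq_zero {X : LieAlg n G} : X ∈ kLie μ ↔ ⁅dualVec μ, X⁆ = 0 := by
  simp only [mem_kLie_iff, apply_lie_eq_Kil]
  exact ⟨fun h ↦ isInnerProduct_Kil.self_eq_zero.1 (h _), fun h Y ↦ by simp [h]⟩

theorem lie_dualVec_mem_mSub (X : LieAlg n G) : ⁅dualVec μ, X⁆ ∈ mSub μ := fun Y hY ↦ by
  rw [Kil_symm, Kil_lie_left, mem_kLie_iff_lie_eq_zero.1 hY, map_zero, neg_zero]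

variable (μ) in
/-- The Lie algebra `𝔨` as a subspace of `𝔤`: the centralizer of the element representing `μ`. -/
def kSub : Submodule ℝ (LieAlg n G) :=
  LinearMap.ker (LieAlgebra.ad ℝ (LieAlg n G) (dualVec μ))

theorem mem_kSub {X : LieAlg n G} : X ∈ kSub μ ↔ X ∈ kLie μ :=
  LinearMap.mem_ker.trans mem_kLie_iff_lie_eq_zero.symm

variable (μ) in
theorem isCompl_mSub_kSub : IsCompl (mSub μ) (kSub μ) := by
  have hm : mSub μ = LinearMap.BilinForm.orthogonal (Kil n G) (kSub μ) :=
    Submodule.ext fun Y ↦ forall_congr' fun X ↦ imp_congr mem_kSub.symm Iff.rfl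
  have hdisjoint : Disjoint (kSub μ) (mSub μ) := Submodule.disjoint_def.2 fun X hXk hXm ↦
    isInnerProduct_Kil.self_eq_zero.1 (hXm X (mem_kSub.1 hXk))
  rw [hm] at hdisjoint ⊢
  exact ((LinearMap.BilinForm.isCompl_orthogonal_iff_disjoint
    fun X Y hXY ↦ by rw [Kil_symm, hXY]).2 hdisjoint).symm

variable (μ) in
/-- The projection of `𝔤 = 𝔪 ⊕ 𝔨` onto `𝔪`. -/
def projM : LieAlg n G →ₗ[ℝ] mSub μ := (mSub μ).projectionOnto (kSub μ) (isCompl_mSub_kSub μ)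

@[simp] theorem projM_coe (Y : mSub μ) : projM μ (Y : LieAlg n G) = Y :=
  Submodule.projectionOnto_apply_left (isCompl_mSub_kSub μ) Y

theorem projM_eq_zero_iff {X : LieAlg n G} : projM μ X = 0 ↔ X ∈ kLie μ :=
  (Submodule.projectionOnto_apply_eq_zero_iff (isCompl_mSub_kSub μ)).trans mem_kSub

theorem eq_zero_of_mem_kLie {X : mSub μ} (hX : (X : LieAlg n G) ∈ kLie μ) : X = 0 := by
  rw [← projM_coe X, projM_eq_zero_iff.2 hX]

theorem sub_projM_mem_kLie (X : LieAlg n G) : X - projM μ X ∈ kLie μ := by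
  rw [← projM_eq_zero_iff, map_sub, projM_coe, sub_self]

theorem projM_Ad (s : stab μ) (X : LieAlg n G) : projM μ (Ad n G s X) = AdM μ s (projM μ X) := by
  have hmem := projM_eq_zero_iff.2 (Ad_mem_kLie μ s.2 (sub_projM_mem_kLie X))
  rwa [map_sub, map_sub, ← AdM_coe, projM_coe, sub_eq_zero] at hmem

theorem Kil_projM (X : LieAlg n G) (Y : mSub μ) :
    Kil n G (projM μ X : LieAlg n G) Y = Kil n G X Y := by
  have horth := Y.2 _ (sub_projM_mem_kLie X)
  rw [map_sub, LinearMap.sub_apply, sub_eq_zero] at horth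
  exact horth.symm

theorem lie_dualVec_projM (X : LieAlg n G) :
    ⁅dualVec μ, (projM μ X : LieAlg n G)⁆ = ⁅dualVec μ, X⁆ := by
  have hzero := mem_kLie_iff_lie_eq_zero.1 (sub_projM_mem_kLie (μ := μ) X)
  rw [lie_sub, sub_eq_zero] at hzero
  exact hzero.symm

theorem apply_lie_projM (X Y : LieAlg n G) : μ ⁅(projM μ X : LieAlg n G), Y⁆ = μ ⁅X, Y⁆ := by
  rw [apply_lie_eq_Kil, apply_lie_eq_Kil, lie_dualVec_projM]

theorem isInnerProduct_KilM : IsInnerProduct (KilM μ) where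
  symm X Y := Kil_symm (X : LieAlg n G) Y
  pos X hX := isInnerProduct_Kil.pos (X : LieAlg n G) (by simpa using hX)

variable (μ) in
/-- The operator `Γ` on `𝔪` with `ω(X, Y) = Kil(Γ X, Y)`. -/
def gammaOp : Module.End ℝ (mSub μ) :=
  (LieAlgebra.ad ℝ (LieAlg n G) (dualVec μ)).restrict fun X _ ↦ lie_dualVec_mem_mSub X

theorem gammaOp_coe (X : mSub μ) :
    (gammaOp μ X : LieAlg n G) = ⁅dualVec μ, (X : LieAlg n G)⁆ := rfl

theorem omega_eq_KilM (X Y : mSub μ) : omega μ X Y = KilM μ (gammaOp μ X) Y :=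
  apply_lie_eq_Kil (X : LieAlg n G) Y

theorem gammaOp_projM (X : LieAlg n G) : gammaOp μ (projM μ X) = projM μ ⁅dualVec μ, X⁆ := by
  rw [← lie_dualVec_projM, ← gammaOp_coe, projM_coe]

theorem gammaOp_skew (X Y : mSub μ) : KilM μ (gammaOp μ X) Y = -KilM μ X (gammaOp μ Y) :=
  Kil_lie_left (dualVec μ) (X : LieAlg n G) Y

theorem gammaOp_injective : Function.Injective (gammaOp μ) :=
  (injective_iff_map_eq_zero _).2 fun _ hX ↦
    eq_zero_of_mem_kLie (mem_kLie_iff_lie_eq_zero.2 (congrArg Subtype.val hX))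

theorem commute_AdM_gammaOp (s : stab μ) : Commute (AdM μ s) (gammaOp μ) :=
  LinearMap.ext fun X ↦ isInnerProduct_KilM.ext fun Y ↦ by
    rw [Module.End.mul_apply, Module.End.mul_apply, ← AdM_inv_apply s Y, KilM_AdM,
      ← omega_eq_KilM, ← omega_eq_KilM, omega_AdM]

end Orbit

section KahlerStructure

variable {n : ℕ} {G : Type*} [TopologicalSpace G] [ChartedSpace (EuclideanSpace ℝ (Fin n)) G]
  [Group G] [LieGroup (𝓡 n) ∞ G] [T2Space G] [CompactSpace G]
  [LieAlgebra.IsSemisimple ℝ (LieAlg n G)] {μ : Module.Dual ℝ (LieAlg n G)}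

theorem IsPolar.KilM_eq_omega {P J : Module.End ℝ (mSub μ)}
    (hPJ : IsPolar (KilM μ) (gammaOp μ) P J) (X Y : mSub μ) :
    KilM μ (P X) Y = omega μ X (J Y) := by
  have hΓ : gammaOp μ X = J (P X) := LinearMap.congr_fun
    (hPJ.eq.trans (hPJ.commute isInnerProduct_KilM gammaOp_skew gammaOp_injective).eq) X
  rw [omega_eq_KilM, hΓ, hPJ.orth]

/-- The almost Hermitian structure with metric `Kil(|Γ| X, Y)` and complex structure `J` attached to
the polar decomposition `Γ = |Γ| J`. -/
def IsPolar.almostHermitian {P J : Module.End ℝ (mSub μ)}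
    (hPJ : IsPolar (KilM μ) (gammaOp μ) P J) : AlmostHermitian μ where
  g := (KilM μ).compLeft P
  J := J
  g_symm X Y := by
    rw [LinearMap.BilinForm.compLeft_apply, LinearMap.BilinForm.compLeft_apply, hPJ.symm,
      isInnerProduct_KilM.symm]
  g_pos := (hPJ.pos_and_commute isInnerProduct_KilM gammaOp_skew gammaOp_injective).1
  J_sq := LinearMap.congr_fun
    (hPJ.J_mul_self isInnerProduct_KilM gammaOp_skew gammaOp_injective)
  g_J X Y := by
    have hPJX : P (J X) = J (P X) := LinearMap.congr_fun
      (hPJ.commute isInnerProduct_KilM gammaOp_skew gammaOp_injective).eq X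
    rw [LinearMap.BilinForm.compLeft_apply, LinearMap.BilinForm.compLeft_apply, hPJX, hPJ.orth]
  g_Ad s X Y := by
    have hPX : AdM μ s (P X) = P (AdM μ s X) := LinearMap.congr_fun
      ((hPJ.pos_and_commute isInnerProduct_KilM gammaOp_skew gammaOp_injective).2 _
        ((commute_AdM_gammaOp s).mul_right (commute_AdM_gammaOp s))).eq X
    rw [LinearMap.BilinForm.compLeft_apply, LinearMap.BilinForm.compLeft_apply, ← hPX, KilM_AdM]
  J_Ad s X := (LinearMap.congr_fun (hPJ.commute_of_commute isInnerProduct_KilM gammaOp_skew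
    gammaOp_injective (commute_AdM_gammaOp s)).eq X).symm

theorem IsPolar.isCanonicalKahler {P J : Module.End ℝ (mSub μ)}
    (hPJ : IsPolar (KilM μ) (gammaOp μ) P J) : hPJ.almostHermitian.IsCanonicalKahler :=
  ⟨⟨gammaOp μ, P, omega_eq_KilM, hPJ.symm, hPJ.nonneg, hPJ.orth, hPJ.eq⟩, hPJ.KilM_eq_omega⟩

namespace AlmostHermitian.IsCanonicalKahler

variable {h : AlmostHermitian μ} (hh : h.IsCanonicalKahler)
include hh

theorem exists_isPolar : ∃ P, IsPolar (KilM μ) (gammaOp μ) P h.J := by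
  obtain ⟨⟨Γ, P, hΓ_omega, hP_symm, hP_nonneg, hJ_orth, hΓ⟩, -⟩ := hh
  obtain rfl : Γ = gammaOp μ := LinearMap.ext fun X ↦ isInnerProduct_KilM.ext fun Y ↦ by
    rw [← omega_eq_KilM, hΓ_omega, KilM_apply]
  exact ⟨P, hP_symm, hP_nonneg, hJ_orth, hΓ⟩

theorem gammaOp_J (X : mSub μ) : gammaOp μ (h.J X) = h.J (gammaOp μ X) := by
  obtain ⟨P, hP⟩ := hh.exists_isPolar
  exact LinearMap.congr_fun (hP.commute_of_commute isInnerProduct_KilM gammaOp_skew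
    gammaOp_injective (Commute.refl _)).eq X

theorem gammaOp_eq_smul_J {X : mSub μ} {c : ℝ} (hc : 0 < c)
    (hX : gammaOp μ (gammaOp μ X) = -(c ^ 2) • X) : gammaOp μ X = c • h.J X := by
  obtain ⟨P, hP⟩ := hh.exists_isPolar
  exact hP.apply_eq_smul_J isInnerProduct_KilM gammaOp_skew gammaOp_injective
    (hP.apply_eq_smul isInnerProduct_KilM gammaOp_skew hc hX)

theorem exists_eigenbasis :
    ∃ (b : Module.Basis (Fin (Module.finrank ℝ (mSub μ))) ℝ (mSub μ))
      (c : Fin (Module.finrank ℝ (mSub μ)) → ℝ),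
      ∀ i, 0 < c i ∧ gammaOp μ (b i) = c i • h.J (b i) := by
  obtain ⟨P, hP⟩ := hh.exists_isPolar
  obtain ⟨b, c, hb, hc⟩ := isInnerProduct_KilM.exists_orthonormal_eigenbasis hP.symm
  refine ⟨b, c, fun i ↦ ⟨?_,
    hP.apply_eq_smul_J isInnerProduct_KilM gammaOp_skew gammaOp_injective (hc i)⟩⟩
  have hP_pos := (hP.pos_and_commute isInnerProduct_KilM gammaOp_skew gammaOp_injective).1
  simpa [hc, hb i i] using hP_pos (b i) (b.ne_zero i)

end AlmostHermitian.IsCanonicalKahler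

variable (μ) in
theorem existsUnique_isCanonicalKahler : ∃! h : AlmostHermitian μ, h.IsCanonicalKahler := by
  obtain ⟨P, J, hPJ⟩ := exists_isPolar isInnerProduct_KilM gammaOp_skew (gammaOp_injective (μ := μ))
  refine ⟨hPJ.almostHermitian, hPJ.isCanonicalKahler, fun h hh ↦ ?_⟩
  obtain ⟨P', hP'⟩ := hh.exists_isPolar
  have hJ : h.J = J := (hPJ.unique isInnerProduct_KilM gammaOp_skew gammaOp_injective hP').2
  refine AlmostHermitian.ext (LinearMap.ext₂ fun X Y ↦ ?_) hJ
  rw [hh.2, hJ]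
  exact (hPJ.KilM_eq_omega X Y).symm

end KahlerStructure

section OrbitFunctions

variable {n : ℕ} {G : Type*} [TopologicalSpace G] [ChartedSpace (EuclideanSpace ℝ (Fin n)) G]
  [Group G] [LieGroup (𝓡 n) ∞ G] {μ : Module.Dual ℝ (LieAlg n G)}

theorem IsTangentField.isSmooth_coe {V : G → mSub μ} (hV : IsTangentField V) :
    IsSmooth n ℝ fun x ↦ (V x : LieAlg n G) := hV.1.comp_linearMap (mSub μ).subtype

theorem IsTangentField.add {V W : G → mSub μ} (hV : IsTangentField V) (hW : IsTangentField W) :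
    IsTangentField fun x ↦ V x + W x :=
  ⟨hV.1.add hW.1, fun x s ↦ by simp only [hV.2, hW.2, map_add]⟩

theorem leftDeriv_base_of_mem_kLie {f : G → ℝ} (hf : IsBaseFunction μ f) (x : G) {X : LieAlg n G}
    (hX : X ∈ kLie μ) : leftDeriv ℝ f x X = 0 := by
  obtain ⟨γ, hγ_zero, hγ_mem, hγ, hγX⟩ := hX
  have hderiv := hasDerivAt_leftDeriv (hf.1.mdifferentiable (by simp) x) hγ_zero hγ hγX
  have hconst : (fun t ↦ f (x * γ t)) = fun _ ↦ f x := funext fun t ↦ hf.2 x ⟨γ t, hγ_mem t⟩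
  rw [hconst] at hderiv
  exact hderiv.unique (hasDerivAt_const _ _)

theorem AlmostHermitian.isInnerProduct_g (h : AlmostHermitian μ) : IsInnerProduct h.g :=
  ⟨h.g_symm, h.g_pos⟩

theorem Ad_mul_inv_apply (x s : G) (Z : LieAlg n G) :
    Ad n G (x * s)⁻¹ Z = Ad n G s⁻¹ (Ad n G x⁻¹ Z) := by
  rw [mul_inv_rev, map_mul, Module.End.mul_apply]

theorem isTangentField_canonicalConnection {V W : G → mSub μ} (hV : IsTangentField V)
    (hW : IsTangentField W) : IsTangentField (canonicalConnection V W) := by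
  refine ⟨fun ℓ ↦ ?_, fun x s ↦ ?_⟩
  · simp only [canonicalConnection, linear_leftDerivVec ℓ hW.1]
    exact contMDiff_leftDeriv_field (hW.1 ℓ) hV.isSmooth_coe
  · have hWs := leftDerivVec_mul_right hW.1 x (s : G) (V x : LieAlg n G)
    simp only [hW.2] at hWs
    rw [canonicalConnection, canonicalConnection, hV.2, AdM_coe,
      linearMap_leftDerivVec (AdM μ s⁻¹) hW.1]
    exact hWs.symm

variable [T2Space G]

theorem isBaseFunction_coAd (Y : LieAlg n G) : IsBaseFunction μ fun x : G ↦ μ (Ad n G x⁻¹ Y) :=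
  ⟨isSmooth_Ad_inv Y μ, fun x s ↦ by
    beta_reduce
    rw [Ad_mul_inv_apply, apply_Ad_of_mem_stab (inv_mem s.2)]⟩

variable [CompactSpace G] [LieAlgebra.IsSemisimple ℝ (LieAlg n G)]

theorem isTangentField_projM_Ad (Z : LieAlg n G) :
    IsTangentField (μ := μ) fun x : G ↦ projM μ (Ad n G x⁻¹ Z) :=
  ⟨(isSmooth_Ad_inv Z).comp_linearMap (projM μ), fun x s ↦ by
    beta_reduce
    rw [Ad_mul_inv_apply, ← projM_Ad, InvMemClass.coe_inv]⟩

theorem exists_isTangentField (x : G) (X : mSub μ) :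
    ∃ V : G → mSub μ, IsTangentField V ∧ V x = X :=
  ⟨_, isTangentField_projM_Ad (Ad n G x (X : LieAlg n G)), by
    rw [Representation.inv_self_apply, projM_coe]⟩

theorem eq_zero_of_leftDeriv_base {x : G} {X : mSub μ}
    (hX : ∀ f : G → ℝ, IsBaseFunction μ f → leftDeriv ℝ f x (X : LieAlg n G) = 0) : X = 0 :=
  eq_zero_of_mem_kLie <| mem_kLie_iff.2 fun Y ↦ by
    have hY := hX _ (isBaseFunction_coAd (Ad n G x Y))
    rw [leftDeriv_apply_Ad_inv, Representation.inv_self_apply] at hY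
    rw [← lie_skew, map_neg, hY, neg_zero]

theorem leftDeriv_base_projM {f : G → ℝ} (hf : IsBaseFunction μ f) (x : G) (X : LieAlg n G) :
    leftDeriv ℝ f x (projM μ X : LieAlg n G) = leftDeriv ℝ f x X := by
  have hzero : leftDifferential f x (X - (projM μ X : LieAlg n G)) = 0 :=
    leftDeriv_base_of_mem_kLie hf x (sub_projM_mem_kLie X)
  rw [map_sub, sub_eq_zero] at hzero
  exact hzero.symm

variable (μ) in
/-- The bracket of `𝔤` followed by the projection onto `𝔪`. -/
def bracketM : mSub μ →ₗ[ℝ] mSub μ →ₗ[ℝ] mSub μ :=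
  LinearMap.mk₂ ℝ (fun X Y ↦ projM μ ⁅(X : LieAlg n G), (Y : LieAlg n G)⁆)
    (fun X X' Y ↦ by simp) (fun c X Y ↦ by simp) (fun X Y Y' ↦ by simp) (fun c X Y ↦ by simp)

theorem bracketM_apply (X Y : mSub μ) :
    bracketM μ X Y = projM μ ⁅(X : LieAlg n G), (Y : LieAlg n G)⁆ := rfl

theorem bracketM_skew (X Y : mSub μ) : bracketM μ X Y = -bracketM μ Y X := by
  rw [bracketM_apply, bracketM_apply, ← lie_skew, map_neg]

theorem bracketM_AdM (s : stab μ) (X Y : mSub μ) :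
    bracketM μ (AdM μ s X) (AdM μ s Y) = AdM μ s (bracketM μ X Y) :=
  (congrArg (projM μ) (AdCLM_lie (s : G) _ _).symm).trans (projM_Ad s _)

theorem fieldDeriv_commutator {V W : G → mSub μ} (hV : IsTangentField V) (hW : IsTangentField W)
    {f : G → ℝ} (hf : IsBaseFunction μ f) (x : G) :
    fieldDeriv V (fieldDeriv W f) x - fieldDeriv W (fieldDeriv V f) x =
      fieldDeriv (fun y ↦ canonicalConnection V W y - canonicalConnection W V y +
        bracketM μ (V y) (W y)) f x := by
  have hcoe {U U' : G → mSub μ} (hU' : IsTangentField U') :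
      (canonicalConnection U U' x : LieAlg n G) =
        leftDerivVec ℝ (fun y ↦ (U' y : LieAlg n G)) x (U x : LieAlg n G) :=
    linearMap_leftDerivVec (mSub μ).subtype hU'.1 x _
  have hbracket : leftDifferential f x (bracketM μ (V x) (W x) : LieAlg n G) =
      leftDeriv ℝ (fun y ↦ leftDeriv ℝ f y (W x : LieAlg n G)) x (V x : LieAlg n G) -
        leftDeriv ℝ (fun y ↦ leftDeriv ℝ f y (V x : LieAlg n G)) x (W x : LieAlg n G) :=
    (leftDeriv_base_projM hf x _).trans (leftDeriv_lie hf.1 x _ _)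
  change leftDeriv ℝ (fun y ↦ leftDeriv ℝ f y (W y : LieAlg n G)) x (V x : LieAlg n G) -
      leftDeriv ℝ (fun y ↦ leftDeriv ℝ f y (V y : LieAlg n G)) x (W x : LieAlg n G) =
    leftDifferential f x (((canonicalConnection V W x : LieAlg n G) -
      (canonicalConnection W V x : LieAlg n G)) + (bracketM μ (V x) (W x) : LieAlg n G))
  rw [map_add, map_sub, hbracket, leftDeriv_leftDeriv_field hf.1 hW.isSmooth_coe,
    leftDeriv_leftDeriv_field hf.1 hV.isSmooth_coe, ← hcoe hW, ← hcoe hV]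
  change _ = leftDeriv ℝ f x _ - leftDeriv ℝ f x _ + _
  ring

end OrbitFunctions

section LeviCivita

variable {n : ℕ} {G : Type*} [TopologicalSpace G] [ChartedSpace (EuclideanSpace ℝ (Fin n)) G]
  [Group G] [LieGroup (𝓡 n) ∞ G] [T2Space G] [CompactSpace G]
  [LieAlgebra.IsSemisimple ℝ (LieAlg n G)] {μ : Module.Dual ℝ (LieAlg n G)}

theorem isMetric_iff (c : Connection μ) (h : AlmostHermitian μ) :
    c.IsMetric h ↔ ∀ x X Y Z, h.g (c.L x X Y) Z + h.g Y (c.L x X Z) = 0 := by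
  have hfields : ∀ U V W : G → mSub μ, IsTangentField V → IsTangentField W → ∀ x,
      (fieldDeriv U (fun y ↦ h.g (V y) (W y)) x =
        h.g (c.cov U V x) (W x) + h.g (V x) (c.cov U W x) ↔
          h.g (c.L x (U x) (V x)) (W x) + h.g (V x) (c.L x (U x) (W x)) = 0) := by
    intro U V W hV hW x
    rw [fieldDeriv, leftDeriv_sesq h.g continuous_id hV.1 hW.1]
    simp only [Connection.cov, canonicalConnection, map_add, LinearMap.add_apply]
    constructor <;> intro hL <;> linarith
  refine ⟨fun hc x X Y Z ↦ ?_, fun hL U V W _ hV hW x ↦ (hfields U V W hV hW x).2 (hL _ _ _ _)⟩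
  obtain ⟨U, hU, rfl⟩ := exists_isTangentField x X
  obtain ⟨V, hV, rfl⟩ := exists_isTangentField x Y
  obtain ⟨W, hW, rfl⟩ := exists_isTangentField x Z
  exact (hfields U V W hV hW x).1 (hc U V W hU hV hW x)

theorem isTorsionFree_iff (c : Connection μ) :
    c.IsTorsionFree ↔ ∀ x X Y, c.L x X Y - c.L x Y X = bracketM μ X Y := by
  have htorsion : ∀ V W : G → mSub μ, IsTangentField V → IsTangentField W →
      ∀ x f, IsBaseFunction μ f →
        (fieldDeriv (fun y ↦ c.cov V W y - c.cov W V y) f x =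
          fieldDeriv V (fieldDeriv W f) x - fieldDeriv W (fieldDeriv V f) x ↔
            leftDifferential f x ((c.L x (V x) (W x) - c.L x (W x) (V x) -
              bracketM μ (V x) (W x) : mSub μ) : LieAlg n G) = 0) := by
    intro V W hV hW x f hf
    have hcov : c.L x (V x) (W x) - c.L x (W x) (V x) - bracketM μ (V x) (W x) =
        (c.cov V W x - c.cov W V x) - (canonicalConnection V W x - canonicalConnection W V x +
          bracketM μ (V x) (W x)) := by
      simp only [Connection.cov]
      abel
    rw [fieldDeriv_commutator hV hW hf, hcov, Submodule.coe_sub, map_sub, sub_eq_zero]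
    rfl
  refine ⟨fun hc x X Y ↦ ?_, fun hL V W hV hW f hf x ↦ (htorsion V W hV hW x f hf).2 ?_⟩
  · obtain ⟨V, hV, rfl⟩ := exists_isTangentField x X
    obtain ⟨W, hW, rfl⟩ := exists_isTangentField x Y
    exact sub_eq_zero.1 <| eq_zero_of_leftDeriv_base fun f hf ↦
      (htorsion V W hV hW x f hf).1 (hc V W hV hW f hf x)
  · rw [hL, sub_self, Submodule.coe_zero, map_zero]

namespace AlmostHermitian

variable (h : AlmostHermitian μ)

/-- The functional `Z ↦ g(∇_X Y, Z)` given by the Koszul formula. -/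
def koszul : mSub μ →ₗ[ℝ] mSub μ →ₗ[ℝ] Module.Dual ℝ (mSub μ) :=
  LinearMap.mk₂ ℝ (fun X Y ↦ (1 / 2 : ℝ) • (h.g (bracketM μ X Y) - h.g X ∘ₗ bracketM μ Y -
      h.g Y ∘ₗ bracketM μ X))
    (fun X X' Y ↦ by
      simp only [map_add, LinearMap.add_apply, LinearMap.add_comp, LinearMap.comp_add]
      module)
    (fun c X Y ↦ by
      simp only [map_smul, LinearMap.smul_apply, LinearMap.smul_comp, LinearMap.comp_smul]
      module)
    (fun X Y Y' ↦ by
      simp only [map_add, LinearMap.add_comp, LinearMap.comp_add]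
      module)
    (fun c X Y ↦ by
      simp only [map_smul, LinearMap.smul_comp, LinearMap.comp_smul]
      module)

/-- The tensor field `L` of the Levi-Civita connection, which is constant on `G`. -/
def lcTensor : mSub μ →ₗ[ℝ] mSub μ →ₗ[ℝ] mSub μ :=
  h.koszul.compr₂ (LinearMap.BilinForm.toDual h.g h.g_nondegenerate).symm.toLinearMap

theorem g_lcTensor (X Y Z : mSub μ) : h.g (h.lcTensor X Y) Z =
    (1 / 2 : ℝ) * (h.g (bracketM μ X Y) Z - h.g X (bracketM μ Y Z) - h.g Y (bracketM μ X Z)) :=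
  LinearMap.BilinForm.apply_toDual_symm_apply (hB := h.g_nondegenerate) (h.koszul X Y) Z

theorem lcTensor_skew (X Y Z : mSub μ) :
    h.g (h.lcTensor X Y) Z + h.g Y (h.lcTensor X Z) = 0 := by
  rw [h.g_symm Y, g_lcTensor, g_lcTensor, bracketM_skew Z Y, map_neg, h.g_symm _ Z, h.g_symm _ Y]
  ring

theorem lcTensor_torsion (X Y : mSub μ) :
    h.lcTensor X Y - h.lcTensor Y X = bracketM μ X Y := by
  refine h.isInnerProduct_g.ext fun Z ↦ ?_
  rw [map_sub, LinearMap.sub_apply, g_lcTensor, g_lcTensor, bracketM_skew Y X, map_neg,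
    LinearMap.neg_apply]
  ring

theorem eq_lcTensor {L : mSub μ →ₗ[ℝ] mSub μ →ₗ[ℝ] mSub μ}
    (hskew : ∀ X Y Z, h.g (L X Y) Z + h.g Y (L X Z) = 0)
    (htorsion : ∀ X Y, L X Y - L Y X = bracketM μ X Y) : L = h.lcTensor := by
  refine LinearMap.ext₂ fun X Y ↦ h.isInnerProduct_g.ext fun Z ↦ ?_
  rw [g_lcTensor, ← htorsion X Y, ← htorsion Y Z, ← htorsion X Z]
  simp only [map_sub, LinearMap.sub_apply]
  have hX := hskew X Y Z
  have hY := hskew Y X Z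
  have hZ := hskew Z X Y
  rw [h.g_symm (L Z X) Y] at hZ
  linarith

theorem lcTensor_AdM (s : stab μ) (X Y : mSub μ) :
    h.lcTensor (AdM μ s X) (AdM μ s Y) = AdM μ s (h.lcTensor X Y) := by
  refine h.isInnerProduct_g.ext fun Z ↦ ?_
  rw [← AdM_inv_apply s Z, h.g_Ad, g_lcTensor, g_lcTensor]
  simp only [bracketM_AdM, h.g_Ad]

theorem isTangentField_lcTensor {V W : G → mSub μ} (hV : IsTangentField V)
    (hW : IsTangentField W) : IsTangentField fun x ↦ h.lcTensor (V x) (W x) :=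
  ⟨fun ℓ ↦ contMDiff_sesq (h.lcTensor.compr₂ ℓ) continuous_id hV.1 hW.1, fun x s ↦ by
    simp only [hV.2, hW.2, lcTensor_AdM]⟩

/-- The Levi-Civita connection of the metric `g`. -/
def lcConnection : Connection μ where
  L _ := h.lcTensor
  isTangentField _ _ hV hW :=
    (isTangentField_canonicalConnection hV hW).add (h.isTangentField_lcTensor hV hW)

theorem isLeviCivita_lcConnection : h.lcConnection.IsLeviCivita h :=
  ⟨(isMetric_iff _ h).2 fun _ ↦ h.lcTensor_skew,
    (isTorsionFree_iff _).2 fun _ ↦ h.lcTensor_torsion⟩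

variable {h} in
theorem eq_lcConnection {c : Connection μ} (hc : c.IsLeviCivita h) : c = h.lcConnection :=
  Connection.ext <| funext fun x ↦
    h.eq_lcTensor ((isMetric_iff c h).1 hc.1 x) ((isTorsionFree_iff c).1 hc.2 x)

theorem existsUnique_isLeviCivita : ∃! c : Connection μ, c.IsLeviCivita h :=
  ⟨_, h.isLeviCivita_lcConnection, fun _ hc ↦ eq_lcConnection hc⟩

end AlmostHermitian

end LeviCivita

theorem AlmostHermitian.g_J_right {n : ℕ} {G : Type*} [TopologicalSpace G]
    [ChartedSpace (EuclideanSpace ℝ (Fin n)) G] [Group G] [LieGroup (𝓡 n) ∞ G]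
    {μ : Module.Dual ℝ (LieAlg n G)} (h : AlmostHermitian μ) (X Y : mSub μ) :
    h.g X (h.J Y) = -h.g (h.J X) Y := by
  rw [← h.g_J, h.J_sq, map_neg]

section Integrable

variable {n : ℕ} {G : Type*} [TopologicalSpace G] [ChartedSpace (EuclideanSpace ℝ (Fin n)) G]
  [Group G] [LieGroup (𝓡 n) ∞ G] [T2Space G] [CompactSpace G]
  [LieAlgebra.IsSemisimple ℝ (LieAlg n G)] {μ : Module.Dual ℝ (LieAlg n G)}

theorem gammaOp_bracketM (X Y : mSub μ) : gammaOp μ (bracketM μ X Y) =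
    bracketM μ (gammaOp μ X) Y + bracketM μ X (gammaOp μ Y) := by
  rw [bracketM_apply, gammaOp_projM, leibniz_lie, map_add]
  rfl

namespace AlmostHermitian

/-- The Nijenhuis tensor of the almost complex structure `J`. -/
def nijenhuis (h : AlmostHermitian μ) : mSub μ →ₗ[ℝ] mSub μ →ₗ[ℝ] mSub μ :=
  (bracketM μ).compl₁₂ h.J h.J - bracketM μ -
    ((bracketM μ).compl₁₂ h.J LinearMap.id).compr₂ h.J -
      ((bracketM μ).compl₁₂ LinearMap.id h.J).compr₂ h.J

theorem nijenhuis_apply (h : AlmostHermitian μ) (X Y : mSub μ) : h.nijenhuis X Y =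
    bracketM μ (h.J X) (h.J Y) - bracketM μ X Y - h.J (bracketM μ (h.J X) Y) -
      h.J (bracketM μ X (h.J Y)) := rfl

namespace IsCanonicalKahler

variable {h : AlmostHermitian μ} (hh : h.IsCanonicalKahler)
include hh

-- If `Γ X = a J X` and `Γ Y = b J Y`, the derivation `Γ` of the bracket makes
-- `⁅JX, Y⁆ + ⁅X, JY⁆` an eigenvector of `Γ²`, on which `Γ` is therefore `(a + b) J`.
theorem nijenhuis_eq_zero_of_eigenvectors {X Y : mSub μ} {a b : ℝ} (ha : 0 < a) (hb : 0 < b)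
    (hX : gammaOp μ X = a • h.J X) (hY : gammaOp μ Y = b • h.J Y) : h.nijenhuis X Y = 0 := by
  have hJX : gammaOp μ (h.J X) = -(a • X) := by
    rw [hh.gammaOp_J, hX, map_smul, h.J_sq, smul_neg]
  have hJY : gammaOp μ (h.J Y) = -(b • Y) := by
    rw [hh.gammaOp_J, hY, map_smul, h.J_sq, smul_neg]
  have hv : gammaOp μ (bracketM μ (h.J X) Y + bracketM μ X (h.J Y)) =
      (a + b) • (bracketM μ (h.J X) (h.J Y) - bracketM μ X Y) := by
    simp only [map_add, gammaOp_bracketM, hX, hY, hJX, hJY, map_smul, map_neg,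
      LinearMap.smul_apply, LinearMap.neg_apply]
    module
  have hu : gammaOp μ (bracketM μ (h.J X) (h.J Y) - bracketM μ X Y) =
      -(a + b) • (bracketM μ (h.J X) Y + bracketM μ X (h.J Y)) := by
    simp only [map_sub, gammaOp_bracketM, hX, hY, hJX, hJY, map_smul, map_neg,
      LinearMap.smul_apply, LinearMap.neg_apply]
    module
  have hJv : gammaOp μ (bracketM μ (h.J X) Y + bracketM μ X (h.J Y)) =
      (a + b) • h.J (bracketM μ (h.J X) Y + bracketM μ X (h.J Y)) :=
    hh.gammaOp_eq_smul_J (add_pos ha hb) <| by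
      rw [hv, map_smul, hu]
      module
  have huv := smul_right_injective _ (add_pos ha hb).ne' (hv.symm.trans hJv)
  rw [nijenhuis_apply, sub_sub, ← map_add, huv, sub_self]

theorem nijenhuis_eq_zero : h.nijenhuis = 0 := by
  obtain ⟨b, c, hb⟩ := hh.exists_eigenbasis
  exact b.ext fun i ↦ b.ext fun j ↦
    hh.nijenhuis_eq_zero_of_eigenvectors (hb i).1 (hb j).1 (hb i).2 (hb j).2

theorem g_J_eq_omega (X Y : mSub μ) : h.g X (h.J Y) = -omega μ X Y := by
  rw [hh.2, h.J_sq, omega_eq_KilM, omega_eq_KilM, map_neg]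

-- `ω` is closed.
theorem g_bracketM_cyclic (X Y Z : mSub μ) :
    h.g (bracketM μ X Y) (h.J Z) + h.g (bracketM μ Y Z) (h.J X) +
      h.g (bracketM μ Z X) (h.J Y) = 0 := by
  have hjacobi := congrArg μ (lie_jacobi (X : LieAlg n G) (Y : LieAlg n G) (Z : LieAlg n G))
  simp only [hh.g_J_eq_omega, omega, bracketM_apply, apply_lie_projM]
  rw [← lie_skew (X : LieAlg n G) ⁅_, _⁆, ← lie_skew (Y : LieAlg n G) ⁅_, _⁆,
    ← lie_skew (Z : LieAlg n G) ⁅_, _⁆] at hjacobi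
  simp only [map_add, map_neg, map_zero] at hjacobi
  linarith

theorem lcTensor_J (X Y : mSub μ) : h.lcTensor X (h.J Y) = h.J (h.lcTensor X Y) := by
  refine h.isInnerProduct_g.ext fun Z ↦ ?_
  have hJ_left : h.g (h.J (h.lcTensor X Y)) Z = -h.g (h.lcTensor X Y) (h.J Z) := by
    rw [h.g_J_right, neg_neg]
  have hnijenhuis : h.g (h.J X) (h.nijenhuis Y Z) = 0 := by simp [hh.nijenhuis_eq_zero]
  rw [nijenhuis_apply, map_sub, map_sub, map_sub, h.g_J, h.g_J, h.g_symm (h.J X),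
    h.g_symm (h.J X)] at hnijenhuis
  have hclosed := hh.g_bracketM_cyclic X Y Z
  have hclosedJ := hh.g_bracketM_cyclic X (h.J Y) (h.J Z)
  rw [bracketM_skew Z X] at hclosed
  rw [h.J_sq, h.J_sq, bracketM_skew (h.J Z) X] at hclosedJ
  simp only [map_neg, LinearMap.neg_apply] at hclosed hclosedJ
  rw [hJ_left, h.g_lcTensor, h.g_lcTensor, h.g_symm (h.J Y), h.g_symm Y (bracketM μ X (h.J Z))]
  linarith

theorem tensorCommutesWithJ {c : Connection μ} (hc : c.IsLeviCivita h) :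
    c.TensorCommutesWithJ h := by
  rw [eq_lcConnection hc]
  exact fun _ ↦ hh.lcTensor_J

theorem commutesWithJ {c : Connection μ} (hc : c.IsLeviCivita h) : c.CommutesWithJ h :=
  fun V W _ hW x ↦ by
    rw [Connection.cov, Connection.cov, canonicalConnection, canonicalConnection, map_add,
      linearMap_leftDerivVec h.J hW.1, hh.tensorCommutesWithJ hc]

end IsCanonicalKahler

end AlmostHermitian

end Integrable

section FockOperators

variable {M : Type*} [AddCommGroup M] [Module ℂ M] {B : M →ₗ⋆[ℂ] M →ₗ[ℂ] ℂ}

open ExteriorAlgebra (ι algebraMapInv)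

@[elab_as_elim]
theorem Fock.induction {P : Fock M → Prop} (algebraMap : ∀ r, P (algebraMap ℂ (Fock M) r))
    (add : ∀ ξ η, P ξ → P η → P (ξ + η)) (ι_mul : ∀ X ξ, P ξ → P (ι ℂ X * ξ)) (ξ : Fock M) : P ξ :=
  CliffordAlgebra.left_induction (0 : QuadraticForm ℂ M) algebraMap add (fun ξ X ↦ ι_mul X ξ) ξ

theorem annih_algebraMap (X : M) (r : ℂ) : annih B X (algebraMap ℂ (Fock M) r) = 0 :=
  CliffordAlgebra.contractLeft_algebraMap _ (B X) r

theorem annih_ι_mul (X Y : M) (ξ : Fock M) :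
    annih B X (ι ℂ Y * ξ) = B X Y • ξ - ι ℂ Y * annih B X ξ :=
  CliffordAlgebra.contractLeft_ι_mul (B X) Y ξ

theorem algebraMapInv_ι_mul (X : M) (ξ : Fock M) : algebraMapInv (ι ℂ X * ξ) = 0 := by
  simp [algebraMapInv]

theorem fockInner_algebraMap (r : ℂ) (η : Fock M) :
    fockInner B (algebraMap ℂ (Fock M) r) η = conj r * algebraMapInv η := by
  have hone := fockInner_zero B (fun _ ↦ 0) η
  rw [ExteriorAlgebra.ιMulti_zero_apply] at hone
  rw [Algebra.algebraMap_eq_smul_one, map_smulₛₗ, LinearMap.smul_apply, hone, smul_eq_mul]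

theorem fockInner_ι_mul (X : M) (ξ η : Fock M) :
    fockInner B (ι ℂ X * ξ) η = fockInner B ξ (annih B X η) := by
  have hword : annihWord B (ι ℂ X) = MulOpposite.op (annih B X) :=
    ExteriorAlgebra.lift_ι_apply ℂ _ _ _
  simp only [fockInner, LinearMap.mk₂'ₛₗ_apply, map_mul, hword]
  rfl

theorem fockInner_annih (hB : ∀ X Y, B X Y = conj (B Y X)) (X : M) (ξ η : Fock M) :
    fockInner B (annih B X ξ) η = fockInner B ξ (ι ℂ X * η) := by
  induction ξ using Fock.induction generalizing η with
  | algebraMap r =>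
    rw [annih_algebraMap, map_zero, LinearMap.zero_apply, fockInner_algebraMap,
      algebraMapInv_ι_mul, mul_zero]
  | add ξ ξ' hξ hξ' => simp only [map_add, LinearMap.add_apply, hξ, hξ']
  | ι_mul Y ξ hξ =>
    simp only [annih_ι_mul, fockInner_ι_mul, map_sub, LinearMap.sub_apply, map_smulₛₗ,
      LinearMap.smul_apply, hξ, hB X Y, Complex.conj_conj, RingHom.id_apply]

theorem cliff_apply (X : M) (ξ : Fock M) :
    cliff B X ξ = Complex.I • (annih B X ξ + ι ℂ X * ξ) := rfl

theorem cliff_add (X Y : M) : cliff B (X + Y) = cliff B X + cliff B Y := by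
  refine LinearMap.ext fun ξ ↦ ?_
  simp only [LinearMap.add_apply, cliff_apply, annih, map_add, add_mul]
  module

theorem cliff_ofReal_smul (c : ℝ) (X : M) : cliff B ((c : ℂ) • X) = (c : ℂ) • cliff B X := by
  refine LinearMap.ext fun ξ ↦ ?_
  simp only [LinearMap.smul_apply, cliff_apply, annih, map_smulₛₗ, Complex.conj_ofReal,
    RingHom.id_apply, smul_mul_assoc]
  module

theorem fockInner_cliff (hB : ∀ X Y, B X Y = conj (B Y X)) (X : M) (ξ η : Fock M) :
    fockInner B (cliff B X ξ) η = -fockInner B ξ (cliff B X η) := by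
  simp only [cliff_apply, map_smulₛₗ, LinearMap.smul_apply, map_add, LinearMap.add_apply,
    fockInner_annih hB, fockInner_ι_mul, Complex.conj_I, RingHom.id_apply, smul_eq_mul]
  ring

theorem extDer_algebraMap (T : M →ₗ[ℂ] M) (r : ℂ) : extDer T (algebraMap ℂ (Fock M) r) = 0 := by
  have hone := extDer_mul T 1 1
  rw [mul_one, mul_one, one_mul, left_eq_add] at hone
  rw [Algebra.algebraMap_eq_smul_one, map_smul, hone, smul_zero]

theorem extDer_ι_mul (T : M →ₗ[ℂ] M) (X : M) (ξ : Fock M) :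
    extDer T (ι ℂ X * ξ) = ι ℂ (T X) * ξ + ι ℂ X * extDer T ξ := by
  rw [extDer_mul, extDer_ι]

theorem extDer_add (T T' : M →ₗ[ℂ] M) : extDer (T + T') = extDer T + extDer T' := by
  refine LinearMap.ext fun ξ ↦ ?_
  induction ξ using Fock.induction with
  | algebraMap r => simp only [LinearMap.add_apply, extDer_algebraMap, add_zero]
  | add ξ η hξ hη => rw [map_add, map_add, hξ, hη]
  | ι_mul X ξ hξ =>
    simp only [LinearMap.add_apply] at hξ ⊢
    simp only [extDer_ι_mul, hξ, LinearMap.add_apply, map_add, add_mul, mul_add]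
    abel

theorem extDer_smul (c : ℂ) (T : M →ₗ[ℂ] M) : extDer (c • T) = c • extDer T := by
  refine LinearMap.ext fun ξ ↦ ?_
  induction ξ using Fock.induction with
  | algebraMap r => simp only [LinearMap.smul_apply, extDer_algebraMap, smul_zero]
  | add ξ η hξ hη => rw [map_add, map_add, hξ, hη]
  | ι_mul X ξ hξ =>
    simp only [extDer_ι_mul, hξ, LinearMap.smul_apply, map_smul, smul_mul_assoc, mul_smul_comm,
      smul_add]

theorem algebraMapInv_extDer (T : M →ₗ[ℂ] M) (ξ : Fock M) : algebraMapInv (extDer T ξ) = 0 := by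
  induction ξ using Fock.induction with
  | algebraMap r => rw [extDer_algebraMap, map_zero]
  | add ξ η hξ hη => rw [map_add, map_add, hξ, hη, add_zero]
  | ι_mul X ξ _ =>
    rw [extDer_ι_mul, map_add, algebraMapInv_ι_mul, algebraMapInv_ι_mul, add_zero]

section SkewAdjoint

variable {T : M →ₗ[ℂ] M} (hT : ∀ X Y, B (T X) Y = -B X (T Y))
include hT

theorem extDer_annih (X : M) (ξ : Fock M) :
    extDer T (annih B X ξ) = annih B (T X) ξ + annih B X (extDer T ξ) := by
  induction ξ using Fock.induction with
  | algebraMap r => simp only [annih_algebraMap, extDer_algebraMap, map_zero, add_zero]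
  | add ξ η hξ hη =>
    simp only [map_add, hξ, hη]
    abel
  | ι_mul Y ξ hξ =>
    simp only [annih_ι_mul, extDer_ι_mul, map_add, map_sub, map_smul, hξ, hT, mul_add]
    module

theorem extDer_cliff (X : M) (ξ : Fock M) :
    extDer T (cliff B X ξ) = cliff B (T X) ξ + cliff B X (extDer T ξ) := by
  simp only [cliff_apply, map_smul, map_add, extDer_annih hT, extDer_ι_mul]
  module

theorem fockInner_extDer (ξ η : Fock M) :
    fockInner B (extDer T ξ) η = -fockInner B ξ (extDer T η) := by
  induction ξ using Fock.induction generalizing η with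
  | algebraMap r =>
    rw [extDer_algebraMap, fockInner_algebraMap, algebraMapInv_extDer, map_zero,
      LinearMap.zero_apply, mul_zero, neg_zero]
  | add ξ ξ' hξ hξ' =>
    simp only [map_add, LinearMap.add_apply, hξ, hξ']
    abel
  | ι_mul X ξ hξ =>
    simp only [extDer_ι_mul, map_add, LinearMap.add_apply, fockInner_ι_mul, hξ, extDer_annih hT]
    abel

end SkewAdjoint

section Functoriality

variable {M' : Type*} [AddCommGroup M'] [Module ℂ M'] {B' : M' →ₗ⋆[ℂ] M' →ₗ[ℂ] ℂ} {f : M →ₗ[ℂ] M'}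

theorem map_ι_mul (f : M →ₗ[ℂ] M') (X : M) (ξ : Fock M) :
    ExteriorAlgebra.map f (ι ℂ X * ξ) = ι ℂ (f X) * ExteriorAlgebra.map f ξ := by
  rw [map_mul, ExteriorAlgebra.map_apply_ι]

theorem map_annih (hf : ∀ X Y, B' (f X) (f Y) = B X Y) (X : M) (ξ : Fock M) :
    ExteriorAlgebra.map f (annih B X ξ) = annih B' (f X) (ExteriorAlgebra.map f ξ) := by
  induction ξ using Fock.induction with
  | algebraMap r => rw [AlgHom.commutes, annih_algebraMap, annih_algebraMap, map_zero]
  | add ξ η hξ hη => simp only [map_add, hξ, hη]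
  | ι_mul Y ξ hξ =>
    rw [annih_ι_mul, map_sub, map_smul, map_ι_mul, map_ι_mul, annih_ι_mul, hf, hξ]

theorem map_cliff (hf : ∀ X Y, B' (f X) (f Y) = B X Y) (X : M) (ξ : Fock M) :
    ExteriorAlgebra.map f (cliff B X ξ) = cliff B' (f X) (ExteriorAlgebra.map f ξ) := by
  rw [cliff_apply, cliff_apply, map_smul, map_add, map_annih hf, map_ι_mul]

theorem map_extDer {T : M →ₗ[ℂ] M} {T' : M' →ₗ[ℂ] M'}
    (hf : ∀ X, f (T X) = T' (f X)) (ξ : Fock M) :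
    ExteriorAlgebra.map f (extDer T ξ) = extDer T' (ExteriorAlgebra.map f ξ) := by
  induction ξ using Fock.induction with
  | algebraMap r => rw [AlgHom.commutes, extDer_algebraMap, extDer_algebraMap, map_zero]
  | add ξ η hξ hη => simp only [map_add, hξ, hη]
  | ι_mul X ξ hξ =>
    rw [extDer_ι_mul, map_add, map_ι_mul, map_ι_mul, map_ι_mul, extDer_ι_mul, hf, hξ]

end Functoriality

end FockOperators

section Integration

open MeasureTheory

theorem isMulRightInvariant_of_compactSpace {G : Type*} [TopologicalSpace G] [Group G]
    [IsTopologicalGroup G] [CompactSpace G] [MeasurableSpace G] [BorelSpace G]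
    (ν : Measure G) [ν.IsHaarMeasure] : ν.IsMulRightInvariant := by
  refine ⟨fun g ↦ ?_⟩
  have hsmul := Measure.isMulInvariant_eq_smul_of_compactSpace (ν.map (· * g)) ν
  have hmass := congrArg (fun ν' : Measure G ↦ ν' Set.univ) hsmul
  rw [Measure.map_apply (measurable_mul_const g) MeasurableSet.univ, Set.preimage_univ] at hmass
  have hfactor : ((ν.map (· * g)).haarScalarFactor ν : ENNReal) = 1 :=
    (ENNReal.mul_left_inj (isOpen_univ.measure_ne_zero ν Set.univ_nonempty)
      (measure_ne_top ν _)).1 (hmass.symm.trans (one_mul _).symm)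
  rw [hsmul, ENNReal.coe_eq_one.1 hfactor, one_smul]

variable {n : ℕ} {G : Type*} [TopologicalSpace G] [ChartedSpace (EuclideanSpace ℝ (Fin n)) G]
  [Group G] [LieGroup (𝓡 n) ∞ G] [CompactSpace G] [MeasurableSpace G] [BorelSpace G]
  {𝕜 : Type*} [RCLike 𝕜] {f : G → 𝕜} (ν : Measure G) [ν.IsHaarMeasure]

theorem integral_leftDeriv (hf : ContMDiff (𝓡 n) 𝓘(ℝ, 𝕜) ∞ f) (X : LieAlg n G) :
    ∫ x, leftDeriv 𝕜 f x X ∂ν = 0 := by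
  have : IsTopologicalGroup G := topologicalGroup_of_lieGroup (𝓡 n) ∞
  have := isMulRightInvariant_of_compactSpace ν
  obtain ⟨ε, hε, γ, hγ_zero, hγ⟩ := exists_local_oneParameter X
  have hcont_deriv : Continuous fun x ↦ leftDeriv 𝕜 f x X := (contMDiff_leftDeriv hf X).continuous
  have hderiv (x : G) : ∀ t ∈ Metric.ball (0 : ℝ) ε,
      HasDerivAt (fun u ↦ f (x * γ u)) (leftDeriv 𝕜 f (x * γ t) X) t := fun t ht ↦ by
    rw [← leftDeriv_mul_left x (hf.mdifferentiable (by simp) _)]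
    exact hasDerivAt_comp_of_hasMFDerivAt (f := fun y ↦ f (x * y))
      ((hf.comp contMDiff_mul_left).mdifferentiable (by simp) _) (hγ t ht)
  have hcont (s : G) : Continuous fun x ↦ f (x * s) :=
    hf.continuous.comp (continuous_mul_const s)
  obtain ⟨C, hC⟩ := isCompact_univ.exists_bound_of_continuousOn hcont_deriv.continuousOn
  have hleibniz := (hasDerivAt_integral_of_dominated_loc_of_deriv_le (μ := ν)
    (F := fun t x ↦ f (x * γ t)) (F' := fun t x ↦ leftDeriv 𝕜 f (x * γ t) X) (bound := fun _ ↦ C)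
    (Metric.ball_mem_nhds 0 hε)
    (.of_forall fun t ↦ (hcont (γ t)).aestronglyMeasurable)
    ((hcont (γ 0)).integrable_of_hasCompactSupport (.of_compactSpace _))
    (hcont_deriv.comp (continuous_mul_const (γ 0))).aestronglyMeasurable
    (.of_forall fun x t _ ↦ hC (x * γ t) trivial) (integrable_const C)
    (.of_forall hderiv)).2
  simp only [integral_mul_right_eq_self f, hγ_zero, mul_one] at hleibniz
  exact hleibniz.unique (hasDerivAt_const _ _)

end Integration

section DiracOperator

variable {n : ℕ} {G : Type*} [TopologicalSpace G] [ChartedSpace (EuclideanSpace ℝ (Fin n)) G]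
  [Group G] [LieGroup (𝓡 n) ∞ G] {μ : Module.Dual ℝ (LieAlg n G)}

namespace AlmostHermitian

variable (h : AlmostHermitian μ)

theorem herm_apply (X Y : h.MJ) : h.herm X Y = (h.g (h.toMJ.symm X) (h.toMJ.symm Y) : ℂ) +
    Complex.I * (h.g (h.J (h.toMJ.symm X)) (h.toMJ.symm Y) : ℂ) := rfl

theorem herm_conj_symm (X Y : h.MJ) : h.herm X Y = conj (h.herm Y X) := by
  rw [herm_apply, herm_apply, h.g_symm (h.J (h.toMJ.symm Y)), h.g_J_right,
    h.g_symm (h.toMJ.symm Y)]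
  simp

theorem symm_complexify {T : mSub μ →ₗ[ℝ] mSub μ} (hT : ∀ X, T (h.J X) = h.J (T X)) (X : h.MJ) :
    h.toMJ.symm (h.complexify T hT X) = T (h.toMJ.symm X) := rfl

theorem herm_complexify_skew {T : mSub μ →ₗ[ℝ] mSub μ} (hT : ∀ X, T (h.J X) = h.J (T X))
    (hg : ∀ X Y, h.g (T X) Y + h.g X (T Y) = 0) (X Y : h.MJ) :
    h.herm (h.complexify T hT X) Y = -h.herm X (h.complexify T hT Y) := by
  have hskew (X Y) : h.g (T X) Y = -h.g X (T Y) := eq_neg_of_add_eq_zero_left (hg X Y)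
  rw [herm_apply, herm_apply, symm_complexify, symm_complexify, ← hT, hskew, hskew]
  push_cast
  ring

theorem herm_AdM (s : stab μ) (X Y : h.MJ) :
    h.herm (h.complexify (AdM μ s) (fun X ↦ (h.J_Ad s X).symm) X)
      (h.complexify (AdM μ s) (fun X ↦ (h.J_Ad s X).symm) Y) = h.herm X Y := by
  rw [herm_apply, herm_apply, symm_complexify, symm_complexify, h.J_Ad, h.g_Ad, h.g_Ad]

theorem toMJ_smul (c : ℝ) (X : mSub μ) : h.toMJ (c • X) = (c : ℂ) • h.toMJ X := by
  rw [smul_def]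
  simp

/-- The Clifford action `κ` as a linear map on `𝔪`. -/
def kappaLinear : mSub μ →ₗ[ℝ] h.Spinor →ₗ[ℂ] h.Spinor where
  toFun := h.kappa
  map_add' X Y := by simp only [kappa, map_add, cliff_add]
  map_smul' c X := by
    simp only [kappa, toMJ_smul, cliff_ofReal_smul]
    rfl

theorem AdS_kappa (s : stab μ) (X : mSub μ) (ξ : h.Spinor) :
    h.AdS s (h.kappa X ξ) = h.kappa (AdM μ s X) (h.AdS s ξ) :=
  map_cliff (h.herm_AdM s) _ _

variable {h} in
theorem AdS_extDer {T T' : mSub μ →ₗ[ℝ] mSub μ} (hT : ∀ X, T (h.J X) = h.J (T X))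
    (hT' : ∀ X, T' (h.J X) = h.J (T' X)) {s : stab μ} (hs : ∀ X, AdM μ s (T X) = T' (AdM μ s X))
    (ξ : h.Spinor) :
    h.AdS s (extDer (h.complexify T hT) ξ) = extDer (h.complexify T' hT') (h.AdS s ξ) :=
  map_extDer (fun X ↦ congrArg h.toMJ (hs (h.toMJ.symm X))) ξ

/-- The operators on spinors extending those of a linear family of operators on `𝔪` that commute
with `J`. -/
def spinorTensor (L : mSub μ →ₗ[ℝ] mSub μ →ₗ[ℝ] mSub μ)
    (hL : ∀ X Y, L X (h.J Y) = h.J (L X Y)) : mSub μ →ₗ[ℝ] h.Spinor →ₗ[ℂ] h.Spinor where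
  toFun X := extDer (h.complexify (L X) (hL X))
  map_add' X Y := by
    rw [← extDer_add]
    congr 1
    refine LinearMap.ext fun Z ↦ h.toMJ.symm.injective ?_
    simp only [symm_complexify, LinearMap.add_apply, map_add]
  map_smul' c X := by
    have hsmul : h.complexify (L (c • X)) (hL (c • X)) = (c : ℂ) • h.complexify (L X) (hL X) :=
      LinearMap.ext fun Z ↦ by
        rw [LinearMap.smul_apply]
        exact (congrArg h.toMJ (LinearMap.congr_fun (map_smul L c X) _)).trans (h.toMJ_smul _ _)
    rw [hsmul, extDer_smul]
    rfl

end AlmostHermitian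

section SpinorConnection

variable {h : AlmostHermitian μ} {c : Connection μ} (hc : c.TensorCommutesWithJ h)

theorem spinorConnection_add_right (ψ : G → h.Spinor) (x : G) (X Y : mSub μ) :
    spinorConnection h c hc ψ x (X + Y) =
      spinorConnection h c hc ψ x X + spinorConnection h c hc ψ x Y :=
  (congrArg₂ (· + ·) (leftDerivVec_add_right (𝕜 := ℂ) ψ x (X : LieAlg n G) (Y : LieAlg n G))
    (LinearMap.congr_fun (map_add (h.spinorTensor (c.L x) (hc x)) X Y) (ψ x))).trans
      (add_add_add_comm _ _ _ _)

theorem spinorConnection_smul_right (ψ : G → h.Spinor) (x : G) (a : ℝ) (X : mSub μ) :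
    spinorConnection h c hc ψ x (a • X) = a • spinorConnection h c hc ψ x X :=
  (congrArg₂ (· + ·) (leftDerivVec_smul_right (𝕜 := ℂ) ψ x a (X : LieAlg n G))
    (LinearMap.congr_fun (map_smul (h.spinorTensor (c.L x) (hc x)) a X) (ψ x))).trans
      (smul_add _ _ _).symm

/-- The bilinear map `(X, Y) ↦ κ(X) ∇_Y ψ` at a point, of which `D ψ` is the trace. -/
def kappaGrad (ψ : G → h.Spinor) (x : G) : mSub μ →ₗ[ℝ] mSub μ →ₗ[ℝ] h.Spinor :=
  LinearMap.mk₂ ℝ (fun X Y ↦ h.kappa X (spinorConnection h c hc ψ x Y))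
    (fun X X' _ ↦ LinearMap.congr_fun (map_add h.kappaLinear X X') _)
    (fun a X _ ↦ LinearMap.congr_fun (map_smul h.kappaLinear a X) _)
    (fun X Y Y' ↦ by rw [spinorConnection_add_right, map_add])
    (fun a X Y ↦ by
      rw [spinorConnection_smul_right]
      exact (h.kappa X).map_smul_of_tower a _)

theorem dirac_eq_sum {ι : Type*} [Fintype ι] [DecidableEq ι] {e : Module.Basis ι ℝ (mSub μ)}
    (he : IsOrthonormal h.g e) (ψ : G → h.Spinor) (x : G) :
    dirac h c hc ψ x = ∑ i, h.kappa (e i) (spinorConnection h c hc ψ x (e i)) :=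
  he.sum_apply_dualBasis h.g_nondegenerate _ (kappaGrad hc ψ x)

section Metric

variable (hskew : ∀ x X Y Z, h.g (c.L x X Y) Z + h.g Y (c.L x X Z) = 0) {ψ φ : G → h.Spinor}
include hskew

theorem leftDeriv_fockInner (hψ : IsSmooth n ℂ ψ) (hφ : IsSmooth n ℂ φ) (x : G) (X : mSub μ) :
    leftDeriv ℂ (fun y ↦ fockInner h.herm (ψ y) (φ y)) x (X : LieAlg n G) =
      fockInner h.herm (spinorConnection h c hc ψ x X) (φ x) +
        fockInner h.herm (ψ x) (spinorConnection h c hc φ x X) := by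
  rw [leftDeriv_sesq (fockInner h.herm) Complex.continuous_conj hψ hφ, spinorConnection,
    spinorConnection, map_add, map_add, LinearMap.add_apply,
    fockInner_extDer (h.herm_complexify_skew (hc x X) (hskew x X))]
  ring

theorem spinorConnection_kappa (hφ : IsSmooth n ℂ φ) (x : G) (X Y : mSub μ) :
    spinorConnection h c hc (fun y ↦ h.kappa Y (φ y)) x X =
      h.kappa (c.L x X Y) (φ x) + h.kappa Y (spinorConnection h c hc φ x X) := by
  have hcliff : extDer (h.complexify (c.L x X) (hc x X)) (h.kappa Y (φ x)) =
      h.kappa (c.L x X Y) (φ x) + h.kappa Y (extDer (h.complexify (c.L x X) (hc x X)) (φ x)) :=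
    extDer_cliff (h.herm_complexify_skew (hc x X) (hskew x X)) _ _
  rw [spinorConnection, spinorConnection, hcliff, map_add, linearMap_leftDerivVec _ hφ]
  abel

variable {ι : Type*} [Fintype ι] [DecidableEq ι] {e : Module.Basis ι ℝ (mSub μ)}

-- The left-hand side is the divergence of the vector field `∑ᵢ ⟨ψ, κ(eᵢ) φ⟩ eᵢ`.
theorem sum_leftDeriv_fockInner_kappa (he : IsOrthonormal h.g e) (hψ : IsSmooth n ℂ ψ)
    (hφ : IsSmooth n ℂ φ) {x : G} (hdiv : ∑ i, c.L x (e i) (e i) = 0) :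
    ∑ i, leftDeriv ℂ (fun y ↦ fockInner h.herm (ψ y) (h.kappa (e i) (φ y))) x
        (e i : LieAlg n G) =
      fockInner h.herm (ψ x) (dirac h c hc φ x) - fockInner h.herm (dirac h c hc ψ x) (φ x) := by
  have hterm (i) : leftDeriv ℂ (fun y ↦ fockInner h.herm (ψ y) (h.kappa (e i) (φ y))) x
      (e i : LieAlg n G) =
        fockInner h.herm (ψ x) (h.kappa (e i) (spinorConnection h c hc φ x (e i))) -
          fockInner h.herm (h.kappa (e i) (spinorConnection h c hc ψ x (e i))) (φ x) +
            fockInner h.herm (ψ x) (h.kappa (c.L x (e i) (e i)) (φ x)) := by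
    rw [leftDeriv_fockInner hc hskew hψ (hφ.comp_linearMap (h.kappa (e i))),
      spinorConnection_kappa hc hskew hφ, map_add,
      show fockInner h.herm (h.kappa (e i) _) (φ x) = _ from
        fockInner_cliff h.herm_conj_symm _ _ _]
    change _ = _ - -fockInner h.herm _ (h.kappa (e i) (φ x)) + _
    ring
  have hkappa : ∑ i, h.kappa (c.L x (e i) (e i)) = 0 := by
    rw [← map_zero h.kappaLinear, ← hdiv, map_sum]
    rfl
  simp only [hterm, Finset.sum_add_distrib, Finset.sum_sub_distrib, ← map_sum,
    ← LinearMap.sum_apply, hkappa, dirac_eq_sum hc he, LinearMap.zero_apply, map_zero, add_zero]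

end Metric

end SpinorConnection

section LeviCivita

variable [T2Space G] [CompactSpace G] [LieAlgebra.IsSemisimple ℝ (LieAlg n G)]

-- The orbit is unimodular.
theorem trace_bracketM (Z : mSub μ) : LinearMap.trace ℝ (mSub μ) (bracketM μ Z) = 0 :=
  trace_eq_zero_of_form_apply_self isInnerProduct_KilM fun X ↦ by
    have hskew := Kil_lie_left (Z : LieAlg n G) (X : LieAlg n G) (X : LieAlg n G)
    rw [Kil_symm (X : LieAlg n G)] at hskew
    rw [isInnerProduct_KilM.symm, KilM_apply, bracketM_apply, Kil_projM]
    linarith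

variable {h : AlmostHermitian μ}

theorem sum_lcTensor_eq_zero {ι : Type*} [Fintype ι] [DecidableEq ι]
    {e : Module.Basis ι ℝ (mSub μ)} (he : IsOrthonormal h.g e) :
    ∑ i, h.lcTensor (e i) (e i) = 0 := by
  refine h.isInnerProduct_g.ext fun Z ↦ ?_
  have hterm (i) : h.g (h.lcTensor (e i) (e i)) Z = h.g (e i) (bracketM μ Z (e i)) := by
    have hself : bracketM μ (e i) (e i) = 0 := by rw [bracketM_apply, lie_self, map_zero]
    rw [AlmostHermitian.g_lcTensor, hself, bracketM_skew (e i) Z]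
    simp only [map_zero, LinearMap.zero_apply, map_neg]
    ring
  simp only [map_sum, LinearMap.sum_apply, hterm, map_zero, LinearMap.zero_apply,
    ← he.trace_eq_sum, trace_bracketM]

variable (hc : h.lcConnection.TensorCommutesWithJ h) {ψ φ : G → h.Spinor}
include hc

theorem isSmooth_spinorConnection (hψ : IsSmooth n ℂ ψ) (X : mSub μ) :
    IsSmooth n ℂ fun x ↦ spinorConnection h h.lcConnection hc ψ x X :=
  (isSmooth_leftDerivVec hψ _).add (hψ.comp_linearMap (extDer (h.complexify _ (hc 1 X))))

theorem isSmooth_dirac (hψ : IsSmooth n ℂ ψ) : IsSmooth n ℂ (dirac h h.lcConnection hc ψ) :=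
  .sum _ fun _ ↦ (isSmooth_spinorConnection hc hψ _).comp_linearMap _

variable {χ : stab μ →ₜ* Circle}

omit [T2Space G] [CompactSpace G] [LieAlgebra.IsSemisimple ℝ (LieAlg n G)] hc in
theorem AlmostHermitian.IsSpinorField.leftDerivVec_mul_right (hψ : h.IsSpinorField χ ψ) (x : G)
    (s : stab μ) (X : mSub μ) :
    leftDerivVec ℂ ψ (x * s) (AdM μ s⁻¹ X : LieAlg n G) =
      (starRingEnd ℂ) (χ s : ℂ) • h.AdS s⁻¹ (leftDerivVec ℂ ψ x (X : LieAlg n G)) := by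
  have hright := CoadjointDirac.leftDerivVec_mul_right hψ.1 x (s : G) (X : LieAlg n G)
  simp only [hψ.2] at hright
  exact hright.symm.trans (linearMap_leftDerivVec
    ((starRingEnd ℂ) (χ s : ℂ) • (h.AdS s⁻¹).toLinearMap) hψ.1 x (X : LieAlg n G)).symm

theorem spinorConnection_mul_right (hψ : h.IsSpinorField χ ψ) (x : G) (s : stab μ) (X : mSub μ) :
    spinorConnection h h.lcConnection hc ψ (x * s) (AdM μ s⁻¹ X) =
      (starRingEnd ℂ) (χ s : ℂ) • h.AdS s⁻¹ (spinorConnection h h.lcConnection hc ψ x X) := by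
  have hL (Y) : AdM μ s⁻¹ (h.lcConnection.L x X Y) =
      h.lcConnection.L (x * s) (AdM μ s⁻¹ X) (AdM μ s⁻¹ Y) := (h.lcTensor_AdM s⁻¹ X Y).symm
  rw [spinorConnection, spinorConnection, hψ.leftDerivVec_mul_right, hψ.2, map_smul, map_add,
    smul_add, AlmostHermitian.AdS_extDer (hc x X) (hc (x * s) _) hL]

theorem isSpinorField_dirac (hψ : h.IsSpinorField χ ψ) :
    h.IsSpinorField χ (dirac h h.lcConnection hc ψ) := by
  refine ⟨isSmooth_dirac hc hψ.1, fun x s ↦ ?_⟩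
  obtain ⟨e, he⟩ := h.isInnerProduct_g.exists_orthonormal_basis
  let A : mSub μ ≃ₗ[ℝ] mSub μ := .ofLinearMap (AdM μ s⁻¹) (AdM μ s)
    (LinearMap.ext fun X ↦ by simpa using AdM_inv_apply s⁻¹ X)
    (LinearMap.ext fun X ↦ AdM_inv_apply s X)
  have hA (i) : e.map A i = AdM μ s⁻¹ (e i) := e.map_apply A i
  have he_map : IsOrthonormal h.g (e.map A) := fun i j ↦ by rw [hA, hA, h.g_Ad, he]
  rw [dirac_eq_sum hc he_map, dirac_eq_sum hc he, map_sum, Finset.smul_sum]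
  refine Finset.sum_congr rfl fun i _ ↦ ?_
  rw [hA, spinorConnection_mul_right hc hψ, map_smul, h.AdS_kappa]

theorem isFormallySelfAdjoint_dirac [MeasurableSpace G] [BorelSpace G]
    (ν : MeasureTheory.Measure G) [ν.IsHaarMeasure] (χ : stab μ →ₜ* Circle) :
    IsFormallySelfAdjoint h ν χ (dirac h h.lcConnection hc) := by
  refine ⟨fun ψ hψ ↦ isSpinorField_dirac hc hψ, fun ψ φ hψ hφ ↦ ?_⟩
  obtain ⟨e, he⟩ := h.isInnerProduct_g.exists_orthonormal_basis
  have hint {f : G → ℂ} (hf : ContMDiff (𝓡 n) 𝓘(ℝ, ℂ) ∞ f) : MeasureTheory.Integrable f ν :=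
    hf.continuous.integrable_of_hasCompactSupport (.of_compactSpace _)
  have hinner {ξ η : G → h.Spinor} (hξ : IsSmooth n ℂ ξ) (hη : IsSmooth n ℂ η) :
      ContMDiff (𝓡 n) 𝓘(ℝ, ℂ) ∞ fun y ↦ fockInner h.herm (ξ y) (η y) :=
    contMDiff_sesq _ Complex.continuous_conj hξ hη
  have hflux (i) : ContMDiff (𝓡 n) 𝓘(ℝ, ℂ) ∞
      fun y ↦ fockInner h.herm (ψ y) (h.kappa (e i) (φ y)) :=
    hinner hψ.1 (hφ.1.comp_linearMap _)
  have hdiv (x) := sum_leftDeriv_fockInner_kappa (x := x) hc (fun _ ↦ h.lcTensor_skew) he hψ.1 hφ.1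
    (sum_lcTensor_eq_zero he)
  rw [AlmostHermitian.l2Inner, AlmostHermitian.l2Inner, eq_comm, ← sub_eq_zero,
    ← MeasureTheory.integral_sub (hint (hinner hψ.1 (isSmooth_dirac hc hφ.1)))
      (hint (hinner (isSmooth_dirac hc hψ.1) hφ.1))]
  simp only [← hdiv]
  rw [MeasureTheory.integral_finsetSum _ fun i _ ↦ hint (contMDiff_leftDeriv (hflux i) _)]
  exact Finset.sum_eq_zero fun i _ ↦ integral_leftDeriv ν (hflux i) _

end LeviCivita

end DiracOperator

end CoadjointDirac

end

theorem corollary7p4_general {n : ℕ} {G : Type*} [TopologicalSpace G]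
    [ChartedSpace (EuclideanSpace ℝ (Fin n)) G] [Group G] [LieGroup (𝓡 n) ∞ G]
    [T2Space G] [CompactSpace G]
    [LieAlgebra.IsSemisimple ℝ (CoadjointDirac.LieAlg n G)]
    [MeasurableSpace G] [BorelSpace G] (ν : MeasureTheory.Measure G) [ν.IsHaarMeasure]
    (μ : Module.Dual ℝ (CoadjointDirac.LieAlg n G)) :
    (∃! h : CoadjointDirac.AlmostHermitian μ, h.IsCanonicalKahler) ∧
    ∀ h : CoadjointDirac.AlmostHermitian μ, h.IsCanonicalKahler →
      (∃! c : CoadjointDirac.Connection μ, c.IsLeviCivita h) ∧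
      ∀ c : CoadjointDirac.Connection μ, c.IsLeviCivita h →
        c.CommutesWithJ h ∧
        ∃ hc : c.TensorCommutesWithJ h, ∀ χ : CoadjointDirac.stab μ →ₜ* Circle,
          CoadjointDirac.IsFormallySelfAdjoint h ν χ (CoadjointDirac.dirac h c hc) := by
  refine ⟨CoadjointDirac.existsUnique_isCanonicalKahler μ, fun h hh ↦
    ⟨h.existsUnique_isLeviCivita, fun c hc ↦ ⟨hh.commutesWithJ hc, hh.tensorCommutesWithJ hc, ?_⟩⟩⟩
  obtain rfl := CoadjointDirac.AlmostHermitian.eq_lcConnection hc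
  exact CoadjointDirac.isFormallySelfAdjoint_dirac _ ν

theorem corollary7p4 {n : ℕ} {G : Type*} [TopologicalSpace G]
    [ChartedSpace (EuclideanSpace ℝ (Fin n)) G] [Group G] [LieGroup (𝓡 n) ∞ G]
    [T2Space G] [CompactSpace G] [ConnectedSpace G]
    [LieAlgebra.IsSemisimple ℝ (CoadjointDirac.LieAlg n G)]
    [MeasurableSpace G] [BorelSpace G] (ν : MeasureTheory.Measure G) [ν.IsHaarMeasure]
    (μ : Module.Dual ℝ (CoadjointDirac.LieAlg n G)) :
    (∃! h : CoadjointDirac.AlmostHermitian μ, h.IsCanonicalKahler) ∧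
    ∀ h : CoadjointDirac.AlmostHermitian μ, h.IsCanonicalKahler →
      (∃! c : CoadjointDirac.Connection μ, c.IsLeviCivita h) ∧
      ∀ c : CoadjointDirac.Connection μ, c.IsLeviCivita h →
        c.CommutesWithJ h ∧
        ∃ hc : c.TensorCommutesWithJ h, ∀ χ : CoadjointDirac.stab μ →ₜ* Circle,
          CoadjointDirac.IsFormallySelfAdjoint h ν χ (CoadjointDirac.dirac h c hc) :=
  corollary7p4_general ν μ
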